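/- For an interval $J\subseteq\mathbb R$ let $S_J$ be the singular integral operator on $L_2(J)$ (complex-valued functions, Lebesgue measure) \[ (S_J\varphi)(x)=\frac1{\pi i}\,\mathrm{p.v.}\!\int_J\frac{\varphi(t)}{t-x}\,dt=\frac1{\pi i}\lim_{\varepsilon\to0^+}\int_{\{t\in J:\ |t-x|>\varepsilon\}}\frac{\varphi(t)}{t-x}\,dt\qquad\text{for a.e. }x\in J . \] Let $H_2^+$ be the Hardy space of functions $F$ analytic in the upper half-plane with $\sup_{y>0}\int_{\mathbb R}|F(x+iy)|^2dx<\infty$, identified with the subspace of $L_2(\mathbb R)$ of their nontangential boundary functions. For $g\in L_\infty(\mathbb R)$ let $T_g$ be the Toeplitz operator on $H_2^+$ given by $T_gf=P^+(gf)$, where $P^+=\frac12(I+S_{\mathbb R})$. Let $\mathcal F f(x)=\frac1{\sqrt{2\pi}}\int_{\mathbb R} f(t)e^{ixt}\,dt$ be the Fourier transform on $L_2(\mathbb R)$ (defined as the limit in $L_2(\mathbb R)$ of the integrals over $[-A,A]$ as $A\to\infty$), and regard $L_2(\mathbb R^+)$ as a subspace of $L_2(\mathbb R)$ through extension by zero.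 Then, for $J=\mathbb R$, $J=\mathbb R^+=(0,\infty)$ and $J=[0,1]$, the formula above defines a bounded linear operator $S_J$ on $L_2(J)$, and \[ \sigma(S_{\mathbb R})=\{-1,1\},\qquad \sigma(S_{\mathbb R^+})=[-1,1],\qquad \sigma(S_{[0,1]})=[-1,1]. \] Moreover, $\mathcal F$ restricts to an isometric isomorphism of $L_2(\mathbb R^+)$ onto $H_2^+$, the formula $Y\varphi(t)=e^{-t/2}\varphi(e^{-t})$, $t>0$, defines an isometric isomorphism $Y$ of $L_2([0,1])$ onto $L_2(\mathbb R^+)$, and \[ \mathcal F\,(S_{\mathbb R^+}-\lambda I)\,\mathcal F^{-1}=T_{-(\operatorname{sign}x+\lambda)}\quad(\lambda\in\mathbb C),\qquad \mathcal F\,Y\,S_{[0,1]}\,Y^{-1}\mathcal F^{-1}=T_{\tanh(\pi x)}\qquad\text{on }H_2^+ . \] -/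

import Mathlib

open MeasureTheory Set Filter Topology
open scoped ENNReal

/-- With `μ` Lebesgue measure on an interval `J` (that is, `volume` for `J = ℝ` and
`volume.restrict J` in general), `T` is the singular integral operator `S_J` on `L₂(J)`:
`(T φ)(x) = (1 / (π i)) p.v. ∫_J φ(t) / (t - x) dt` for almost every `x ∈ J`, where the Cauchy
principal value is the limit of the integrals over `{t ∈ J : |t - x| > ε}` as `ε → 0+`. -/
def IsSingularIntegralOperator (μ : Measure ℝ) (T : Lp ℂ 2 μ →L[ℂ] Lp ℂ 2 μ) : Prop :=
  ∀ φ : Lp ℂ 2 μ, ∀ᵐ x ∂μ,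
    Tendsto (fun ε : ℝ => (1 / ((Real.pi : ℂ) * Complex.I)) *
        ∫ t in {t : ℝ | ε < |t - x|}, φ t / ((t : ℂ) - (x : ℂ)) ∂μ)
      (𝓝[>] 0) (𝓝 (T φ x))

/-- The defining property determines the operator. -/
theorem IsSingularIntegralOperator.unique {μ : Measure ℝ} {T T' : Lp ℂ 2 μ →L[ℂ] Lp ℂ 2 μ}
    (h : IsSingularIntegralOperator μ T) (h' : IsSingularIntegralOperator μ T') : T = T' := by
  ext1 φ
  apply Lp.ext
  filter_upwards [h φ, h' φ] with x hx hx'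
  exact tendsto_nhds_unique hx hx'

/-- The function `F` on the upper half-plane has nontangential limit `f x` at almost every
real point `x`: the limit is `f x` in every cone `|re z - x| < a * im z`, `a > 0`. -/
def HasNontangentialBoundaryValue (F : ℂ → ℂ) (f : ℝ → ℂ) : Prop :=
  ∀ᵐ x : ℝ, ∀ a : ℝ, 0 < a →
    Tendsto F (𝓝[{z : ℂ | 0 < z.im ∧ |z.re - x| < a * z.im}] (x : ℂ)) (𝓝 (f x))

/-- `F` belongs to the Hardy space of analytic functions in the upper half-plane whose
`L₂` norms on the horizontal lines are bounded. -/
def IsHardyFunction (F : ℂ → ℂ) : Prop :=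
  DifferentiableOn ℂ F {z : ℂ | 0 < z.im} ∧
    ∃ M : ℝ≥0∞, M < ∞ ∧ ∀ y : ℝ, 0 < y →
      eLpNorm (fun x : ℝ => F ((x : ℂ) + (y : ℂ) * Complex.I)) 2 volume ≤ M

theorem continuous_horizontal {F : ℂ → ℂ} (hF : DifferentiableOn ℂ F {z : ℂ | 0 < z.im})
    {y : ℝ} (hy : 0 < y) : Continuous (fun x : ℝ => F ((x : ℂ) + (y : ℂ) * Complex.I)) := by
  refine hF.continuousOn.comp_continuous (by fun_prop) ?_
  intro x
  simpa using hy

/-- The Hardy space `H₂⁺` of the upper half-plane, each function being identified with its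
nontangential boundary function in `L₂(ℝ)`. -/
def hardySpace : Submodule ℂ (Lp ℂ 2 (volume : Measure ℝ)) where
  carrier := {f | ∃ F : ℂ → ℂ, IsHardyFunction F ∧ HasNontangentialBoundaryValue F f}
  zero_mem' := by
    refine ⟨fun _ => 0, ⟨differentiableOn_const _, 0, by simp, fun y _ => by simp⟩, ?_⟩
    filter_upwards [Lp.coeFn_zero ℂ 2 (volume : Measure ℝ)] with x hx a _
    rw [hx]
    exact tendsto_const_nhds
  add_mem' := by
    rintro f g ⟨F, ⟨hF, M, hM, hFM⟩, hf⟩ ⟨G, ⟨hG, N, hN, hGN⟩, hg⟩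
    refine ⟨fun z => F z + G z, ⟨hF.add hG, M + N, ENNReal.add_lt_top.2 ⟨hM, hN⟩, ?_⟩, ?_⟩
    · intro y hy
      exact (eLpNorm_add_le (continuous_horizontal hF hy).aestronglyMeasurable
        (continuous_horizontal hG hy).aestronglyMeasurable (by norm_num)).trans
        (add_le_add (hFM y hy) (hGN y hy))
    · filter_upwards [hf, hg, Lp.coeFn_add f g] with x hfx hgx hx a ha
      rw [hx]
      exact (hfx a ha).add (hgx a ha)
  smul_mem' := by
    rintro c f ⟨F, ⟨hF, M, hM, hFM⟩, hf⟩
    refine ⟨fun z => c * F z, ⟨hF.const_mul c, ‖c‖ₑ * M, ENNReal.mul_lt_top (by simp) hM, ?_⟩, ?_⟩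
    · intro y hy
      have := eLpNorm_const_smul (μ := volume) (p := 2) c
        (fun x : ℝ => F ((x : ℂ) + (y : ℂ) * Complex.I))
      exact this.le.trans (mul_le_mul_right (hFM y hy) _)
    · filter_upwards [hf, Lp.coeFn_smul c f] with x hfx hx a ha
      rw [hx]
      exact (hfx a ha).const_mul c

/-- `T` is the Toeplitz operator with (bounded) symbol `g` on `H₂⁺`: `T f = P⁺ (g f)`, where
`P⁺ = (I + S_ℝ) / 2`. -/
def IsToeplitzOperator (g : ℝ → ℂ) (T : hardySpace →L[ℂ] hardySpace) : Prop :=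
  ∃ S : Lp ℂ 2 (volume : Measure ℝ) →L[ℂ] Lp ℂ 2 (volume : Measure ℝ),
    IsSingularIntegralOperator volume S ∧
    ∀ f : hardySpace, ∃ h : Lp ℂ 2 (volume : Measure ℝ),
      (∀ᵐ x : ℝ, h x = g x * (f : Lp ℂ 2 (volume : Measure ℝ)) x) ∧
      (T f : Lp ℂ 2 (volume : Measure ℝ)) = (1 / 2 : ℂ) • (h + S h)

/-- `h` is the `L₂` Fourier transform of `f ∈ L₂(μ)`, `μ` being Lebesgue measure on a subset
of `ℝ` outside of which `f` is extended by zero: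
`h(x) = lim_{A → ∞} (1 / √(2π)) ∫_{-A}^{A} f(t) exp(i x t) dt`, as a limit in `L₂(ℝ)`. -/
def IsFourierTransform (μ : Measure ℝ) (f h : ℝ → ℂ) : Prop :=
  Tendsto (fun A : ℝ => eLpNorm (fun x : ℝ =>
      (1 / (Real.sqrt (2 * Real.pi) : ℂ)) *
        (∫ t in Icc (-A) A, f t * Complex.exp (Complex.I * (x : ℂ) * (t : ℂ)) ∂μ) - h x)
      2 volume) atTop (𝓝 0)

/-- The weighted composition `f ↦ w * (f ∘ θ)` is a contraction from `L₂(μ)` to `L₂(ν)`. -/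
structure IsWeightedContraction (μ ν : Measure ℝ) (w : ℝ → ℂ) (θ : ℝ → ℝ) : Prop where
  measurable_weight : Measurable w
  measurable_map : Measurable θ
  lintegral_le : ∀ g : ℝ → ℝ≥0∞, Measurable g →
    ∫⁻ t, ‖w t‖ₑ ^ 2 * g (θ t) ∂ν ≤ ∫⁻ x, g x ∂μ

namespace IsWeightedContraction

variable {μ ν : Measure ℝ} {w : ℝ → ℂ} {θ : ℝ → ℝ}

theorem ae_imp (h : IsWeightedContraction μ ν w θ) {p : ℝ → Prop} (hp : ∀ᵐ x ∂μ, p x) :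
    ∀ᵐ t ∂ν, w t ≠ 0 → p (θ t) := by
  obtain ⟨s, hps, hs, hs0⟩ := exists_measurable_superset_of_null (ae_iff.1 hp)
  have h1 := h.lintegral_le (s.indicator 1) (measurable_one.indicator hs)
  have hm : Measurable fun t => ‖w t‖ₑ ^ 2 * s.indicator (1 : ℝ → ℝ≥0∞) (θ t) :=
    (h.measurable_weight.enorm.pow_const 2).mul
      ((measurable_one.indicator hs).comp h.measurable_map)
  rw [lintegral_indicator_one hs, hs0, nonpos_iff_eq_zero, lintegral_eq_zero_iff hm] at h1
  filter_upwards [h1] with t ht hw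
  by_contra hpt
  have hmem : θ t ∈ s := hps hpt
  simp [hmem, hw] at ht

theorem ae_congr (h : IsWeightedContraction μ ν w θ) {f g : ℝ → ℂ} (hfg : f =ᵐ[μ] g) :
    (fun t => w t * f (θ t)) =ᵐ[ν] fun t => w t * g (θ t) := by
  filter_upwards [h.ae_imp hfg] with t ht
  by_cases hw : w t = 0
  · simp [hw]
  · rw [ht hw]

theorem eLpNorm_two_eq {α : Type*} [MeasurableSpace α] (μ : Measure α) (f : α → ℂ) :
    eLpNorm f 2 μ = (∫⁻ x, ‖f x‖ₑ ^ 2 ∂μ) ^ (1 / 2 : ℝ) := by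
  rw [eLpNorm_eq_lintegral_rpow_enorm_toReal (by norm_num) (by norm_num)]
  simp

theorem aestronglyMeasurable (h : IsWeightedContraction μ ν w θ) (f : Lp ℂ 2 μ) :
    AEStronglyMeasurable (fun t => w t * f (θ t)) ν :=
  (h.measurable_weight.mul
    ((Lp.stronglyMeasurable f).measurable.comp h.measurable_map)).aestronglyMeasurable

theorem eLpNorm_le (h : IsWeightedContraction μ ν w θ) (f : Lp ℂ 2 μ) :
    eLpNorm (fun t => w t * f (θ t)) 2 ν ≤ eLpNorm f 2 μ := by
  rw [eLpNorm_two_eq, eLpNorm_two_eq]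
  refine ENNReal.rpow_le_rpow ?_ (by norm_num)
  refine le_trans (le_of_eq ?_) (h.lintegral_le (fun x => ‖f x‖ₑ ^ 2)
    ((Lp.stronglyMeasurable f).measurable.enorm.pow_const 2))
  exact lintegral_congr fun t => by rw [enorm_mul, mul_pow]

theorem memLp (h : IsWeightedContraction μ ν w θ) (f : Lp ℂ 2 μ) :
    MemLp (fun t => w t * f (θ t)) 2 ν :=
  ⟨h.aestronglyMeasurable f, (h.eLpNorm_le f).trans_lt (Lp.eLpNorm_lt_top f)⟩

/-- The operator `f ↦ w * (f ∘ θ)` from `L₂(μ)` to `L₂(ν)`. -/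
noncomputable def toCLM (h : IsWeightedContraction μ ν w θ) : Lp ℂ 2 μ →L[ℂ] Lp ℂ 2 ν :=
  LinearMap.mkContinuous
    { toFun := fun f => (h.memLp f).toLp
      map_add' := fun f g => by
        rw [← MemLp.toLp_add, MemLp.toLp_eq_toLp_iff]
        filter_upwards [h.ae_congr (Lp.coeFn_add f g)] with t ht
        rw [ht]; simp [mul_add]
      map_smul' := fun c f => by
        simp only [RingHom.id_apply]
        rw [← MemLp.toLp_const_smul, MemLp.toLp_eq_toLp_iff]
        filter_upwards [h.ae_congr (Lp.coeFn_smul c f)] with t ht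
        rw [ht]; simp [mul_left_comm] } 1
    (fun f => by
      simp only [LinearMap.coe_mk, AddHom.coe_mk, one_mul]
      rw [Lp.norm_toLp, Lp.norm_def]
      exact ENNReal.toReal_mono (Lp.eLpNorm_ne_top f) (h.eLpNorm_le f))

theorem coeFn_toCLM (h : IsWeightedContraction μ ν w θ) (f : Lp ℂ 2 μ) :
    h.toCLM f =ᵐ[ν] fun t => w t * f (θ t) :=
  (h.memLp f).coeFn_toLp

theorem norm_toCLM_le (h : IsWeightedContraction μ ν w θ) (f : Lp ℂ 2 μ) :
    ‖h.toCLM f‖ ≤ ‖f‖ := by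
  have := LinearMap.mkContinuous_norm_le _ zero_le_one _ |> (h.toCLM).le_of_opNorm_le (x := f)
  simpa using this

theorem norm_toCLM (h : IsWeightedContraction μ ν w θ)
    (heq : ∀ g : ℝ → ℝ≥0∞, Measurable g → ∫⁻ t, ‖w t‖ₑ ^ 2 * g (θ t) ∂ν = ∫⁻ x, g x ∂μ)
    (f : Lp ℂ 2 μ) : ‖h.toCLM f‖ = ‖f‖ := by
  rw [Lp.norm_def, Lp.norm_def, eLpNorm_congr_ae (h.coeFn_toCLM f), eLpNorm_two_eq, eLpNorm_two_eq,
    ← heq (fun x => ‖f x‖ₑ ^ 2) ((Lp.stronglyMeasurable f).measurable.enorm.pow_const 2)]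
  congr 2
  exact lintegral_congr fun t => by rw [enorm_mul, mul_pow]

/-- Two mutually inverse weighted compositions form an isometric isomorphism. -/
noncomputable def toEquiv {w' : ℝ → ℂ} {θ' : ℝ → ℝ} (h : IsWeightedContraction μ ν w θ)
    (h' : IsWeightedContraction ν μ w' θ')
    (hl : ∀ᵐ x ∂μ, θ (θ' x) = x ∧ w' x * w (θ' x) = 1)
    (hr : ∀ᵐ t ∂ν, θ' (θ t) = t ∧ w t * w' (θ t) = 1) :
    Lp ℂ 2 μ ≃ₗᵢ[ℂ] Lp ℂ 2 ν :=
  have hl' : ∀ f, h'.toCLM (h.toCLM f) = f := fun f => by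
    apply Lp.ext
    filter_upwards [h'.coeFn_toCLM (h.toCLM f), h'.ae_congr (h.coeFn_toCLM f), hl] with x h1 h2 h3
    rw [h1, h2, h3.1, ← mul_assoc, h3.2, one_mul]
  have hr' : ∀ f, h.toCLM (h'.toCLM f) = f := fun f => by
    apply Lp.ext
    filter_upwards [h.coeFn_toCLM (h'.toCLM f), h.ae_congr (h'.coeFn_toCLM f), hr] with x h1 h2 h3
    rw [h1, h2, h3.1, ← mul_assoc, h3.2, one_mul]
  { toLinearEquiv := LinearEquiv.ofLinearMap h.toCLM.toLinearMap h'.toCLM.toLinearMap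
      (LinearMap.ext hr') (LinearMap.ext hl')
    norm_map' := fun f => le_antisymm (h.norm_toCLM_le f) (by
      conv_lhs => rw [← hl' f]
      exact h'.norm_toCLM_le _) }

theorem coeFn_toEquiv {w' : ℝ → ℂ} {θ' : ℝ → ℝ} (h : IsWeightedContraction μ ν w θ)
    (h' : IsWeightedContraction ν μ w' θ')
    (hl : ∀ᵐ x ∂μ, θ (θ' x) = x ∧ w' x * w (θ' x) = 1)
    (hr : ∀ᵐ t ∂ν, θ' (θ t) = t ∧ w t * w' (θ t) = 1) (f : Lp ℂ 2 μ) :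
    h.toEquiv h' hl hr f =ᵐ[ν] fun t => w t * f (θ t) :=
  h.coeFn_toCLM f

theorem coeFn_toEquiv_symm {w' : ℝ → ℂ} {θ' : ℝ → ℝ} (h : IsWeightedContraction μ ν w θ)
    (h' : IsWeightedContraction ν μ w' θ')
    (hl : ∀ᵐ x ∂μ, θ (θ' x) = x ∧ w' x * w (θ' x) = 1)
    (hr : ∀ᵐ t ∂ν, θ' (θ t) = t ∧ w t * w' (θ t) = 1) (f : Lp ℂ 2 ν) :
    (h.toEquiv h' hl hr).symm f =ᵐ[μ] fun t => w' t * f (θ' t) :=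
  h'.coeFn_toCLM f

/-- Multiplication by a function bounded by one. -/
theorem mul (μ : Measure ℝ) {w : ℝ → ℂ} (hw : Measurable w) (hb : ∀ t, ‖w t‖ ≤ 1) :
    IsWeightedContraction μ μ w id :=
  ⟨hw, measurable_id, fun g _ => lintegral_mono fun t => by
    have : ‖w t‖ₑ ≤ 1 := by
      rw [← ofReal_norm]; exact ENNReal.ofReal_le_one.2 (hb t)
    calc ‖w t‖ₑ ^ 2 * g (id t) ≤ 1 ^ 2 * g t := by gcongr; simp
      _ = g t := by simp⟩

theorem lintegral_indicator_weight (μ : Measure ℝ) {s : Set ℝ} (hs : MeasurableSet s)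
    (g : ℝ → ℝ≥0∞) :
    ∫⁻ t, ‖s.indicator (1 : ℝ → ℂ) t‖ₑ ^ 2 * g (id t) ∂μ = ∫⁻ x in s, g x ∂μ := by
  rw [← lintegral_indicator hs]
  refine lintegral_congr fun t => ?_
  by_cases ht : t ∈ s <;> simp [ht]

/-- Extension by zero. -/
theorem extend (μ : Measure ℝ) {s : Set ℝ} (hs : MeasurableSet s) :
    IsWeightedContraction (μ.restrict s) μ (s.indicator 1) id :=
  ⟨measurable_one.indicator hs, measurable_id,
    fun g _ => (lintegral_indicator_weight μ hs g).le⟩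

/-- Restriction to a subset. -/
theorem restrict (μ : Measure ℝ) (s : Set ℝ) :
    IsWeightedContraction μ (μ.restrict s) 1 id :=
  ⟨measurable_one, measurable_id, fun g _ => by
    simpa using lintegral_mono' Measure.restrict_le_self le_rfl⟩

end IsWeightedContraction

section ExtendRestrict

variable {s : Set ℝ} (hs : MeasurableSet s)

/-- Extension by zero from `L₂(s)` to `L₂(ℝ)`. -/
noncomputable def extendZero :
    Lp ℂ 2 (volume.restrict s) →L[ℂ] Lp ℂ 2 (volume : Measure ℝ) :=
  (IsWeightedContraction.extend volume hs).toCLM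

theorem coeFn_extendZero (f : Lp ℂ 2 (volume.restrict s)) :
    extendZero hs f =ᵐ[volume] s.indicator f := by
  filter_upwards [(IsWeightedContraction.extend volume hs).coeFn_toCLM f] with t ht
  rw [extendZero, ht]
  by_cases h : t ∈ s <;> simp [h]

theorem norm_extendZero (f : Lp ℂ 2 (volume.restrict s)) : ‖extendZero hs f‖ = ‖f‖ :=
  IsWeightedContraction.norm_toCLM _
    (fun g _ => IsWeightedContraction.lintegral_indicator_weight volume hs g) f

variable (s) in
/-- Restriction from `L₂(ℝ)` to `L₂(s)`. -/
noncomputable def restrictTo :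
    Lp ℂ 2 (volume : Measure ℝ) →L[ℂ] Lp ℂ 2 (volume.restrict s) :=
  (IsWeightedContraction.restrict volume s).toCLM

theorem coeFn_restrictTo (f : Lp ℂ 2 (volume : Measure ℝ)) :
    restrictTo s f =ᵐ[volume.restrict s] f := by
  filter_upwards [(IsWeightedContraction.restrict volume s).coeFn_toCLM f] with t ht
  rw [restrictTo, ht]
  simp

theorem norm_restrictTo_le (f : Lp ℂ 2 (volume : Measure ℝ)) : ‖restrictTo s f‖ ≤ ‖f‖ :=
  IsWeightedContraction.norm_toCLM_le _ f

theorem restrictTo_extendZero (f : Lp ℂ 2 (volume.restrict s)) :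
    restrictTo s (extendZero hs f) = f := by
  apply Lp.ext
  filter_upwards [coeFn_restrictTo (s := s) (extendZero hs f),
    ae_restrict_of_ae (coeFn_extendZero hs f), ae_restrict_mem hs] with t h1 h2 h3
  rw [h1, h2, indicator_of_mem h3]

theorem coeFn_extendZero_restrictTo (f : Lp ℂ 2 (volume : Measure ℝ)) :
    extendZero hs (restrictTo s f) =ᵐ[volume] s.indicator f := by
  filter_upwards [coeFn_extendZero hs (restrictTo s f),
    (ae_restrict_iff' hs).1 (coeFn_restrictTo (s := s) f)] with t h1 h2
  rw [h1]
  by_cases h : t ∈ s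
  · simp [h, h2 h]
  · simp [h]

theorem inner_extendZero (f : Lp ℂ 2 (volume : Measure ℝ)) (g : Lp ℂ 2 (volume.restrict s)) :
    inner ℂ f (extendZero hs g) = inner ℂ (restrictTo s f) g := by
  rw [L2.inner_def, L2.inner_def, ← integral_indicator hs]
  refine integral_congr_ae ?_
  filter_upwards [coeFn_extendZero hs g, (ae_restrict_iff' hs).1 (coeFn_restrictTo (s := s) f)]
    with t h1 h2
  by_cases h : t ∈ s
  · simp [h, h1, h2 h]
  · simp [h, h1]

end ExtendRestrict

/-- Multiplication by a measurable function bounded by one on `L₂(ℝ)`. -/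
noncomputable def mulOp {w : ℝ → ℂ} (hw : Measurable w) (hb : ∀ t, ‖w t‖ ≤ 1) :
    Lp ℂ 2 (volume : Measure ℝ) →L[ℂ] Lp ℂ 2 (volume : Measure ℝ) :=
  (IsWeightedContraction.mul volume hw hb).toCLM

theorem coeFn_mulOp {w : ℝ → ℂ} (hw : Measurable w) (hb : ∀ t, ‖w t‖ ≤ 1)
    (f : Lp ℂ 2 (volume : Measure ℝ)) : mulOp hw hb f =ᵐ[volume] fun t => w t * f t :=
  (IsWeightedContraction.mul volume hw hb).coeFn_toCLM f

theorem norm_mulOp_le {w : ℝ → ℂ} (hw : Measurable w) (hb : ∀ t, ‖w t‖ ≤ 1)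
    (f : Lp ℂ 2 (volume : Measure ℝ)) : ‖mulOp hw hb f‖ ≤ ‖f‖ :=
  (IsWeightedContraction.mul volume hw hb).norm_toCLM_le f

section FourierConsistency

open FourierTransform SchwartzMap

theorem integral_schwartz_smul_fourier {f : ℝ → ℂ} (hf : Integrable f) (g : 𝓢(ℝ, ℂ)) :
    ∫ x, 𝓕 g x • f x = ∫ x, g x • 𝓕 f x := by
  have := VectorFourier.integral_fourierIntegral_smul_eq_flip (μ := (volume : Measure ℝ))
    (ν := (volume : Measure ℝ)) (L := innerₗ ℝ) Real.continuous_fourierChar continuous_inner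
    g.integrable hf
  rw [flip_innerₗ] at this
  exact this

/-- The `L₂` Fourier transform of an integrable function is given by the Fourier integral. -/
theorem coeFn_fourier_toLp {f : ℝ → ℂ} (hf : Integrable f) (hf2 : MemLp f 2) :
    (𝓕 hf2.toLp : Lp ℂ 2 (volume : Measure ℝ)) =ᵐ[volume] 𝓕 f := by
  refine ae_eq_of_integral_contDiff_smul_eq
    ((Lp.memLp _).locallyIntegrable (by norm_num)) ?_ fun g hg hgs => ?_
  · exact (VectorFourier.fourierIntegral_continuous Real.continuous_fourierChar
      (L := innerₗ ℝ) continuous_inner hf).locallyIntegrable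
  have hgs' : HasCompactSupport fun x => (g x : ℂ) := hgs.comp_left Complex.ofReal_zero
  set φ : 𝓢(ℝ, ℂ) := hgs'.toSchwartzMap (Complex.ofRealCLM.contDiff.comp hg)
  have hφ : ∀ x, φ x = (g x : ℂ) := fun x => rfl
  have h1 := congrArg (fun T : 𝓢'(ℝ, ℂ) => T φ)
    (Lp.fourier_toTemperedDistribution_eq hf2.toLp)
  simp only [TemperedDistribution.fourier_apply, Lp.toTemperedDistribution_apply] at h1
  calc ∫ x, g x • (𝓕 hf2.toLp : Lp ℂ 2 (volume : Measure ℝ)) x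
      = ∫ x, φ x • (𝓕 hf2.toLp : Lp ℂ 2 (volume : Measure ℝ)) x := by
        simp [hφ]
    _ = ∫ x, 𝓕 φ x • hf2.toLp f x := h1.symm
    _ = ∫ x, 𝓕 φ x • f x := by
        refine integral_congr_ae ?_
        filter_upwards [hf2.coeFn_toLp] with x hx
        rw [hx]
    _ = ∫ x, φ x • 𝓕 f x := integral_schwartz_smul_fourier hf φ
    _ = ∫ x, g x • 𝓕 f x := by simp [hφ]

/-- The reflection `f ↦ f (-·)` on `L₂(ℝ)`. -/
noncomputable def reflect : Lp ℂ 2 (volume : Measure ℝ) →L[ℂ] Lp ℂ 2 (volume : Measure ℝ) :=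
  IsWeightedContraction.toCLM (w := 1) (θ := Neg.neg)
    ⟨measurable_one, measurable_neg, fun g hg => by
      have := (Measure.measurePreserving_neg (volume : Measure ℝ)).lintegral_comp hg
      simpa using this.le⟩

theorem coeFn_reflect (f : Lp ℂ 2 (volume : Measure ℝ)) :
    reflect f =ᵐ[volume] fun t => f (-t) := by
  filter_upwards [IsWeightedContraction.coeFn_toCLM _ f] with t ht
  rw [reflect, ht]
  simp

theorem ae_comp_neg {p : ℝ → Prop} (h : ∀ᵐ x : ℝ, p x) : ∀ᵐ x : ℝ, p (-x) :=
  (Measure.measurePreserving_neg (volume : Measure ℝ)).quasiMeasurePreserving.ae h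

theorem reflect_reflect (f : Lp ℂ 2 (volume : Measure ℝ)) : reflect (reflect f) = f := by
  apply Lp.ext
  filter_upwards [coeFn_reflect (reflect f), ae_comp_neg (coeFn_reflect f)] with t h1 h2
  rw [h1, h2, neg_neg]

theorem fourierInv_eq_reflect_fourier (f : Lp ℂ 2 (volume : Measure ℝ)) :
    𝓕⁻ f = reflect (𝓕 f) := by
  refine DenseRange.induction_on (p := fun f => 𝓕⁻ f = reflect (𝓕 f))
    (SchwartzMap.denseRange_toLpCLM (μ := (volume : Measure ℝ)) (E := ℝ) (F := ℂ) (p := 2)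
      ENNReal.ofNat_ne_top) f ?_ fun g => ?_
  · exact isClosed_eq (Lp.fourierTransformₗᵢ ℝ ℂ).symm.continuous
      (reflect.continuous.comp (Lp.fourierTransformₗᵢ ℝ ℂ).continuous)
  · simp only [toLpCLM_apply, toLp_fourierInv_eq, toLp_fourier_eq]
    apply Lp.ext
    filter_upwards [coeFn_reflect ((𝓕 g).toLp 2), ae_comp_neg ((𝓕 g).coeFn_toLp 2 volume),
      (𝓕⁻ g).coeFn_toLp 2 volume] with t h1 h2 h3
    rw [h1, h2, h3, fourierInv_coe, fourier_coe, Real.fourierInv_eq_fourier_neg]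

theorem coeFn_fourierInv_toLp {f : ℝ → ℂ} (hf : Integrable f) (hf2 : MemLp f 2) :
    (𝓕⁻ hf2.toLp : Lp ℂ 2 (volume : Measure ℝ)) =ᵐ[volume] 𝓕⁻ f := by
  rw [fourierInv_eq_reflect_fourier]
  filter_upwards [coeFn_reflect (𝓕 hf2.toLp), ae_comp_neg (coeFn_fourier_toLp hf hf2)] with t h1 h2
  rw [h1, h2, Real.fourierInv_eq_fourier_neg]

end FourierConsistency

/-- A weighted change of variables. -/
theorem IsWeightedContraction.of_deriv {s : Set ℝ} (hs : MeasurableSet s) {θ θ' : ℝ → ℝ}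
    {w : ℝ → ℂ} (hw : Measurable w) (hθ : Measurable θ)
    (hd : ∀ t ∈ s, HasDerivWithinAt θ (θ' t) s t) (hi : InjOn θ s)
    (hwd : ∀ t ∈ s, ‖w t‖ ^ 2 = |θ' t|) :
    IsWeightedContraction (volume.restrict (θ '' s)) (volume.restrict s) w θ := by
  refine ⟨hw, hθ, fun g _ => le_of_eq ?_⟩
  rw [lintegral_image_eq_lintegral_abs_deriv_mul hs hd hi]
  refine setLIntegral_congr_fun hs fun t ht => ?_
  rw [← hwd t ht, ENNReal.ofReal_pow (norm_nonneg _), ofReal_norm]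

section Fourier

open Real

theorem norm_inv_sqrt_two_pi_sq : ‖(1 / (√(2 * π) : ℂ))‖ ^ 2 = |(2 * π)⁻¹| := by
  rw [norm_div, norm_one, Complex.norm_real, norm_of_nonneg (by positivity), div_pow,
    sq_sqrt (by positivity), abs_of_pos (by positivity)]
  simp

theorem isWeightedContraction_dilation :
    IsWeightedContraction volume volume (fun _ => 1 / (√(2 * π) : ℂ)) (fun x => x * (2 * π)⁻¹) := by
  have := IsWeightedContraction.of_deriv (s := univ) (θ := fun x : ℝ => x * (2 * π)⁻¹)
    (θ' := fun _ => (2 * π)⁻¹) (w := fun _ => 1 / (√(2 * π) : ℂ)) MeasurableSet.univ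
    measurable_const (by fun_prop)
    (fun t _ => (hasDerivAt_mul_const (2 * π)⁻¹).hasDerivWithinAt)
    (fun a _ b _ h => by simpa [pi_ne_zero] using h) (fun _ _ => norm_inv_sqrt_two_pi_sq)
  have hs : Function.Surjective fun x : ℝ => x * (2 * π)⁻¹ := mul_right_surjective₀ (by positivity)
  rwa [image_univ, hs.range_eq, Measure.restrict_univ] at this

theorem isWeightedContraction_dilation_symm :
    IsWeightedContraction volume volume (fun _ => (√(2 * π) : ℂ)) (fun x => x * (2 * π)) := by
  have := IsWeightedContraction.of_deriv (s := univ) (θ := fun x : ℝ => x * (2 * π))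
    (θ' := fun _ => (2 * π)) (w := fun _ => (√(2 * π) : ℂ)) MeasurableSet.univ
    measurable_const (by fun_prop)
    (fun t _ => (hasDerivAt_mul_const (2 * π)).hasDerivWithinAt)
    (fun a _ b _ h => by simpa [pi_ne_zero] using h) (fun _ _ => by
      rw [Complex.norm_real, norm_of_nonneg (by positivity), sq_sqrt (by positivity),
        abs_of_pos (by positivity)])
  have hs : Function.Surjective fun x : ℝ => x * (2 * π) := mul_right_surjective₀ (by positivity)
  rwa [image_univ, hs.range_eq, Measure.restrict_univ] at this

theorem sqrt_two_pi_ne_zero : (√(2 * π) : ℂ) ≠ 0 := by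
  exact_mod_cast (sqrt_pos.2 (by positivity : 0 < 2 * π)).ne'

/-- The unitary dilation `f ↦ (2π)^(-1/2) f(· / 2π)`. -/
noncomputable def dilation : Lp ℂ 2 (volume : Measure ℝ) ≃ₗᵢ[ℂ] Lp ℂ 2 (volume : Measure ℝ) :=
  isWeightedContraction_dilation.toEquiv isWeightedContraction_dilation_symm
    (ae_of_all _ fun x => ⟨by field_simp, by field_simp [sqrt_two_pi_ne_zero]⟩)
    (ae_of_all _ fun x => ⟨by field_simp, by field_simp [sqrt_two_pi_ne_zero]⟩)

theorem coeFn_dilation (f : Lp ℂ 2 (volume : Measure ℝ)) :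
    dilation f =ᵐ[volume] fun x => 1 / (√(2 * π) : ℂ) * f (x * (2 * π)⁻¹) :=
  IsWeightedContraction.coeFn_toEquiv _ _ _ _ f

theorem coeFn_dilation_symm (f : Lp ℂ 2 (volume : Measure ℝ)) :
    dilation.symm f =ᵐ[volume] fun x => (√(2 * π) : ℂ) * f (x * (2 * π)) :=
  IsWeightedContraction.coeFn_toEquiv_symm _ _ _ _ f

/-- The Fourier integral `(2π)^(-1/2) ∫ f(t) exp(ixt) dt`. -/
noncomputable def fourierInt (f : ℝ → ℂ) (x : ℝ) : ℂ :=
  1 / (√(2 * π) : ℂ) * ∫ t, f t * Complex.exp (Complex.I * x * t)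

/-- The unitary Fourier transform on `L₂(ℝ)` with kernel `(2π)^(-1/2) exp(ixt)`. -/
noncomputable def unitaryFourier :
    Lp ℂ 2 (volume : Measure ℝ) ≃ₗᵢ[ℂ] Lp ℂ 2 (volume : Measure ℝ) :=
  (Lp.fourierTransformₗᵢ ℝ ℂ).symm.trans dilation

theorem coeFn_unitaryFourier {f : ℝ → ℂ} (hf : Integrable f) (hf2 : MemLp f 2) :
    unitaryFourier hf2.toLp =ᵐ[volume] fourierInt f := by
  filter_upwards [coeFn_dilation ((Lp.fourierTransformₗᵢ ℝ ℂ).symm hf2.toLp),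
    isWeightedContraction_dilation.ae_imp (coeFn_fourierInv_toLp hf hf2)] with x h1 h2
  refine h1.trans ?_
  rw [fourierInt]
  congr 1
  refine (h2 (by simp [pi_pos.le, pi_ne_zero])).trans ?_
  rw [Real.fourierInv_eq']
  refine integral_congr_ae (ae_of_all _ fun t => ?_)
  simp only [RCLike.inner_apply, conj_trivial, smul_eq_mul]
  rw [mul_comm]
  congr 2
  push_cast
  field_simp

theorem coeFn_unitaryFourier_symm {f : ℝ → ℂ} (hf : Integrable f) (hf2 : MemLp f 2) :
    unitaryFourier.symm hf2.toLp =ᵐ[volume] fun x => fourierInt f (-x) := by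
  have hg : Integrable fun x => (√(2 * π) : ℂ) * f (x * (2 * π)) :=
    (hf.comp_mul_right' (by positivity)).const_mul _
  have hae : dilation.symm hf2.toLp =ᵐ[volume] fun x => (√(2 * π) : ℂ) * f (x * (2 * π)) :=
    (coeFn_dilation_symm _).trans (isWeightedContraction_dilation_symm.ae_congr hf2.coeFn_toLp)
  have hg2 : MemLp (fun x => (√(2 * π) : ℂ) * f (x * (2 * π))) 2 :=
    (memLp_congr_ae hae).1 (Lp.memLp _)
  have heq : dilation.symm hf2.toLp = hg2.toLp := Lp.ext (hae.trans hg2.coeFn_toLp.symm)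
  have h0 : unitaryFourier.symm hf2.toLp = Lp.fourierTransformₗᵢ ℝ ℂ hg2.toLp := by
    rw [← heq]; rfl
  rw [h0]
  filter_upwards [coeFn_fourier_toLp hg hg2] with x h1
  refine h1.trans ?_
  rw [fourierInt, Real.fourier_real_eq_integral_exp_smul]
  have h2 := Measure.integral_comp_mul_right
    (fun t : ℝ => f t * Complex.exp (Complex.I * ((-x : ℝ) : ℂ) * t)) (2 * π)
  rw [abs_of_pos (by positivity)] at h2
  have h3 : (∫ t, f t * Complex.exp (Complex.I * ((-x : ℝ) : ℂ) * t)) =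
      (2 * π : ℝ) • ∫ t : ℝ, f (t * (2 * π)) *
        Complex.exp (Complex.I * ((-x : ℝ) : ℂ) * ((t * (2 * π) : ℝ) : ℂ)) := by
    rw [h2, smul_smul, mul_inv_cancel₀ (by positivity), one_smul]
  have h4 : (1 / (√(2 * π) : ℂ)) * ((2 * π : ℝ) : ℂ) = (√(2 * π) : ℂ) := by
    rw [div_mul_eq_mul_div, one_mul, div_eq_iff sqrt_two_pi_ne_zero, ← Complex.ofReal_mul,
      mul_self_sqrt (by positivity)]
  rw [h3, Complex.real_smul, ← mul_assoc, h4, ← integral_const_mul]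
  refine integral_congr_ae (ae_of_all _ fun t => ?_)
  simp only [smul_eq_mul]
  rw [mul_comm, mul_assoc]
  congr 3
  push_cast
  ring

theorem unitaryFourier_symm_apply (f : Lp ℂ 2 (volume : Measure ℝ)) :
    unitaryFourier.symm f = reflect (unitaryFourier f) := by
  refine DenseRange.induction_on (p := fun f => unitaryFourier.symm f = reflect (unitaryFourier f))
    (SchwartzMap.denseRange_toLpCLM (μ := (volume : Measure ℝ)) (E := ℝ) (F := ℂ) (p := 2)
      ENNReal.ofNat_ne_top) f ?_ fun g => ?_
  · exact isClosed_eq unitaryFourier.symm.continuous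
      (reflect.continuous.comp unitaryFourier.continuous)
  · have hg : SchwartzMap.toLpCLM ℝ ℂ 2 (volume : Measure ℝ) g = (g.memLp 2 volume).toLp := rfl
    rw [hg]
    apply Lp.ext
    filter_upwards [coeFn_unitaryFourier_symm g.integrable (g.memLp 2),
      ae_comp_neg (coeFn_unitaryFourier g.integrable (g.memLp 2)),
      coeFn_reflect (unitaryFourier (g.memLp 2).toLp)] with t h1 h2 h3
    rw [h1, h3, h2]

theorem reflect_unitaryFourier_symm (f : Lp ℂ 2 (volume : Measure ℝ)) :
    reflect (unitaryFourier.symm f) = unitaryFourier f := by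
  rw [unitaryFourier_symm_apply, reflect_reflect]

theorem unitaryFourier_reflect (f : Lp ℂ 2 (volume : Measure ℝ)) :
    unitaryFourier (reflect f) = unitaryFourier.symm f := by
  rw [LinearIsometryEquiv.eq_symm_apply, ← reflect_unitaryFourier_symm,
    LinearIsometryEquiv.symm_apply_apply, reflect_reflect]

/-- A square integrable and integrable function with zero Fourier integral vanishes. -/
theorem ae_eq_zero_of_fourierInt_eq_zero {f : ℝ → ℂ} (hf : Integrable f) (hf2 : MemLp f 2)
    (h : ∀ x : ℝ, ∫ t : ℝ, f t * Complex.exp (Complex.I * (x : ℂ) * (t : ℂ)) = 0) : f =ᵐ[volume] 0 := by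
  have h0 : unitaryFourier hf2.toLp = 0 := by
    apply Lp.ext
    filter_upwards [coeFn_unitaryFourier hf hf2, Lp.coeFn_zero ℂ 2 (volume : Measure ℝ)]
      with x h1 h2
    rw [h1, h2, fourierInt, h x]
    simp
  rw [LinearIsometryEquiv.map_eq_zero_iff] at h0
  exact hf2.coeFn_toLp.symm.trans (h0 ▸ Lp.coeFn_zero ℂ 2 (volume : Measure ℝ))

end Fourier

theorem isFourierTransform_unitaryFourier {s : Set ℝ} (hs : MeasurableSet s)
    (f : Lp ℂ 2 (volume.restrict s)) :
    IsFourierTransform (volume.restrict s) f (unitaryFourier (extendZero hs f)) := by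
  set e := extendZero hs f with he
  have hg2 : ∀ A : ℝ, MemLp ((Icc (-A) A).indicator e) 2 volume := fun A =>
    (Lp.memLp e).indicator measurableSet_Icc
  have hg1 : ∀ A : ℝ, Integrable ((Icc (-A) A).indicator e) volume := fun A => by
    rw [integrable_indicator_iff measurableSet_Icc]
    exact ((Lp.memLp e).restrict _).integrable (by norm_num)
  have hint : ∀ A x : ℝ, ∫ t in Icc (-A) A, f t * Complex.exp (Complex.I * (x : ℂ) * (t : ℂ))
      ∂(volume.restrict s) =
      ∫ t, (Icc (-A) A).indicator e t * Complex.exp (Complex.I * (x : ℂ) * (t : ℂ)) := by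
    intro A x
    rw [Measure.restrict_restrict measurableSet_Icc, ← integral_indicator (measurableSet_Icc.inter hs)]
    refine integral_congr_ae ?_
    filter_upwards [coeFn_extendZero hs f] with t ht
    by_cases h1 : t ∈ Icc (-A) A <;> by_cases h2 : t ∈ s <;>
      simp only [indicator, mem_inter_iff, h1, h2, and_true, and_false,
        if_true, if_false, he, ht, zero_mul]
  have hkey : ∀ A : ℝ, eLpNorm (fun x : ℝ => (1 / (Real.sqrt (2 * Real.pi) : ℂ)) *
        (∫ t in Icc (-A) A, f t * Complex.exp (Complex.I * (x : ℂ) * (t : ℂ)) ∂(volume.restrict s))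
        - unitaryFourier e x) 2 volume = eLpNorm ((Icc (-A) A)ᶜ.indicator e) 2 volume := by
    intro A
    have h1 : eLpNorm (fun x : ℝ => (1 / (Real.sqrt (2 * Real.pi) : ℂ)) *
        (∫ t in Icc (-A) A, f t * Complex.exp (Complex.I * (x : ℂ) * (t : ℂ)) ∂(volume.restrict s))
        - unitaryFourier e x) 2 volume = ‖unitaryFourier ((hg2 A).toLp - e)‖ₑ := by
      rw [Lp.enorm_def]
      refine eLpNorm_congr_ae ?_
      rw [map_sub]
      filter_upwards [coeFn_unitaryFourier (hg1 A) (hg2 A),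
        Lp.coeFn_sub (unitaryFourier (hg2 A).toLp) (unitaryFourier e)] with x hx1 hx2
      rw [hx2, Pi.sub_apply, hx1, fourierInt, hint]
    rw [h1, ← ofReal_norm, LinearIsometryEquiv.norm_map, ofReal_norm, Lp.enorm_def]
    rw [← eLpNorm_neg]
    refine eLpNorm_congr_ae ?_
    filter_upwards [Lp.coeFn_sub (hg2 A).toLp e, (hg2 A).coeFn_toLp] with x hx1 hx2
    rw [Pi.neg_apply, hx1, Pi.sub_apply, hx2]
    by_cases h1 : x ∈ Icc (-A) A <;> simp [indicator, h1]
  unfold IsFourierTransform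
  simp_rw [hkey]
  simp_rw [IsWeightedContraction.eLpNorm_two_eq]
  have h0 : (0 : ℝ≥0∞) = 0 ^ (1 / 2 : ℝ) := by rw [ENNReal.zero_rpow_of_pos (by norm_num)]
  rw [h0]
  refine Tendsto.ennrpow_const _ ?_
  have hz : (0 : ℝ≥0∞) = ∫⁻ _ : ℝ, 0 := by simp
  rw [hz]
  refine tendsto_lintegral_filter_of_dominated_convergence (fun t => ‖e t‖ₑ ^ 2) ?_ ?_ ?_ ?_
  · exact Eventually.of_forall fun A =>
      (((Lp.stronglyMeasurable e).measurable.indicator measurableSet_Icc.compl).enorm.pow_const 2)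
  · refine Eventually.of_forall fun A => ae_of_all _ fun t => ?_
    by_cases h1 : t ∈ Icc (-A) A <;> simp [indicator, h1]
  · have := (Lp.memLp e).eLpNorm_lt_top
    rw [IsWeightedContraction.eLpNorm_two_eq] at this
    exact ((ENNReal.rpow_lt_top_iff_of_pos (by norm_num)).1 this).ne
  · refine ae_of_all _ fun t => tendsto_const_nhds.congr' ?_
    filter_upwards [eventually_ge_atTop |t|] with A hA
    have : t ∈ Icc (-A) A := abs_le.1 hA
    simp [indicator, this]

section Kernels

open Real

/-- The function `exp(izt)` on `t > 0`, extended by zero. -/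
noncomputable def expPlus (z : ℂ) : ℝ → ℂ :=
  (Ioi 0).indicator fun t : ℝ => Complex.exp (Complex.I * z * t)

theorem norm_exp_I_mul (z : ℂ) (t : ℝ) :
    ‖Complex.exp (Complex.I * z * t)‖ = Real.exp (-z.im * t) := by
  rw [Complex.norm_exp]; simp

theorem integrable_expPlus {z : ℂ} (hz : 0 < z.im) : Integrable (expPlus z) := by
  rw [expPlus, integrable_indicator_iff measurableSet_Ioi]
  exact integrableOn_exp_mul_complex_Ioi (by simpa using hz) 0

theorem memLp_expPlus {z : ℂ} (hz : 0 < z.im) : MemLp (expPlus z) 2 := by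
  rw [memLp_two_iff_integrable_sq_norm (integrable_expPlus hz).aestronglyMeasurable]
  refine (integrable_expPlus (z := 2 * z) (by simpa using hz)).norm.congr (ae_of_all _ fun t => ?_)
  by_cases ht : t ∈ Ioi (0 : ℝ)
  · simp only [expPlus, indicator_of_mem ht, norm_exp_I_mul]
    rw [← Real.exp_nat_mul]
    congr 1
    simp
    ring
  · simp [expPlus, ht]

theorem fourierInt_expPlus {z : ℂ} (hz : 0 < z.im) (u : ℝ) :
    fourierInt (expPlus z) u = 1 / (√(2 * π) : ℂ) * (Complex.I / (u + z)) := by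
  rw [fourierInt]
  congr 1
  have hre : (Complex.I * (u + z)).re < 0 := by simpa using hz
  have hne : (u + z : ℂ) ≠ 0 := fun h => by
    have := congrArg Complex.im h
    simp at this; exact hz.ne' this
  have h := integral_exp_mul_complex_Ioi hre 0
  calc ∫ t, expPlus z t * Complex.exp (Complex.I * u * t)
      = ∫ t in Ioi (0 : ℝ), Complex.exp (Complex.I * (u + z) * t) := by
        rw [← integral_indicator measurableSet_Ioi]
        refine integral_congr_ae (ae_of_all _ fun t => ?_)
        by_cases ht : t ∈ Ioi (0 : ℝ)
        · simp only [expPlus, indicator_of_mem ht, ← Complex.exp_add]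
          congr 1; ring
        · simp [expPlus, ht]
    _ = Complex.I / (u + z) := by
        rw [h]; field_simp; simp

/-- The function `exp(-izt)` on `t < 0`, extended by zero. -/
noncomputable def expMinus (z : ℂ) (t : ℝ) : ℂ := expPlus z (-t)

theorem integrable_expMinus {z : ℂ} (hz : 0 < z.im) : Integrable (expMinus z) :=
  (integrable_expPlus hz).comp_neg

theorem memLp_expMinus {z : ℂ} (hz : 0 < z.im) : MemLp (expMinus z) 2 :=
  (memLp_expPlus hz).comp_measurePreserving (Measure.measurePreserving_neg (volume : Measure ℝ))

theorem fourierInt_comp_neg (f : ℝ → ℂ) (u : ℝ) :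
    fourierInt (fun t => f (-t)) u = fourierInt f (-u) := by
  rw [fourierInt, fourierInt, ← integral_neg_eq_self]
  simp

theorem fourierInt_expMinus {z : ℂ} (hz : 0 < z.im) (u : ℝ) :
    fourierInt (expMinus z) u = -(1 / (√(2 * π) : ℂ) * (Complex.I / (u - z))) := by
  have : fourierInt (expMinus z) u = fourierInt (expPlus z) (-u) := fourierInt_comp_neg _ u
  rw [this, fourierInt_expPlus hz, ← mul_neg, ← div_neg]
  congr 2
  push_cast
  ring

theorem coeFn_unitaryFourier_expPlus {z : ℂ} (hz : 0 < z.im) :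
    unitaryFourier (memLp_expPlus hz).toLp =ᵐ[volume]
      fun u => 1 / (√(2 * π) : ℂ) * (Complex.I / (u + z)) :=
  (coeFn_unitaryFourier (integrable_expPlus hz) (memLp_expPlus hz)).trans
    (ae_of_all _ fun u => fourierInt_expPlus hz u)

theorem coeFn_unitaryFourier_expMinus {z : ℂ} (hz : 0 < z.im) :
    unitaryFourier (memLp_expMinus hz).toLp =ᵐ[volume]
      fun u => -(1 / (√(2 * π) : ℂ) * (Complex.I / (u - z))) :=
  (coeFn_unitaryFourier (integrable_expMinus hz) (memLp_expMinus hz)).trans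
    (ae_of_all _ fun u => fourierInt_expMinus hz u)

theorem kernel_plus_eq {w : ℂ} (hw : w.im < 0) :
    (fun u : ℝ => 1 / ((u : ℂ) - w)) =ᵐ[volume]
      ((-Complex.I * (√(2 * π) : ℂ)) •
        unitaryFourier (memLp_expPlus (z := -w) (by simpa using hw)).toLp :
          Lp ℂ 2 (volume : Measure ℝ)) := by
  filter_upwards [Lp.coeFn_smul (-Complex.I * (√(2 * π) : ℂ))
      (unitaryFourier (memLp_expPlus (z := -w) (by simpa using hw)).toLp),
    coeFn_unitaryFourier_expPlus (z := -w) (by simpa using hw)] with u h1 h2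
  rw [h1, Pi.smul_apply, h2, smul_eq_mul, ← sub_eq_add_neg]
  have := sqrt_two_pi_ne_zero
  calc 1 / ((u : ℂ) - w) = (-(Complex.I * Complex.I)) * (1 / ((u : ℂ) - w)) := by simp
    _ = _ := by field_simp

theorem kernel_minus_eq {w : ℂ} (hw : 0 < w.im) :
    (fun u : ℝ => 1 / ((u : ℂ) - w)) =ᵐ[volume]
      ((Complex.I * (√(2 * π) : ℂ)) • unitaryFourier (memLp_expMinus hw).toLp :
          Lp ℂ 2 (volume : Measure ℝ)) := by
  filter_upwards [Lp.coeFn_smul (Complex.I * (√(2 * π) : ℂ))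
      (unitaryFourier (memLp_expMinus hw).toLp),
    coeFn_unitaryFourier_expMinus hw] with u h1 h2
  rw [h1, Pi.smul_apply, h2, smul_eq_mul]
  have := sqrt_two_pi_ne_zero
  calc 1 / ((u : ℂ) - w) = (-(Complex.I * Complex.I)) * (1 / ((u : ℂ) - w)) := by simp
    _ = _ := by field_simp

theorem memLp_cauchyKernel {w : ℂ} (hw : w.im ≠ 0) :
    MemLp (fun u : ℝ => 1 / ((u : ℂ) - w)) 2 := by
  rcases lt_or_gt_of_ne hw with h | h
  · exact (memLp_congr_ae (kernel_plus_eq h)).2 (Lp.memLp _)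
  · exact (memLp_congr_ae (kernel_minus_eq h)).2 (Lp.memLp _)

/-- The Cauchy kernel `1 / (u - w)` as an element of `L₂(ℝ)`. -/
noncomputable def cauchyKernel {w : ℂ} (hw : w.im ≠ 0) : Lp ℂ 2 (volume : Measure ℝ) :=
  (memLp_cauchyKernel hw).toLp

theorem coeFn_cauchyKernel {w : ℂ} (hw : w.im ≠ 0) :
    cauchyKernel hw =ᵐ[volume] fun u => 1 / ((u : ℂ) - w) :=
  (memLp_cauchyKernel hw).coeFn_toLp

theorem cauchyKernel_eq_of_neg {w : ℂ} (hw : w.im < 0) :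
    cauchyKernel hw.ne = (-Complex.I * (√(2 * π) : ℂ)) •
        unitaryFourier (memLp_expPlus (z := -w) (by simpa using hw)).toLp :=
  Lp.ext ((coeFn_cauchyKernel hw.ne).trans (kernel_plus_eq hw))

theorem cauchyKernel_eq_of_pos {w : ℂ} (hw : 0 < w.im) :
    cauchyKernel hw.ne' =
      (Complex.I * (√(2 * π) : ℂ)) • unitaryFourier (memLp_expMinus hw).toLp :=
  Lp.ext ((coeFn_cauchyKernel hw.ne').trans (kernel_minus_eq hw))

end Kernels

section HilbertOp

theorem measurable_sign : Measurable fun x : ℝ => (Real.sign x : ℂ) := by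
  refine Complex.measurable_ofReal.comp ?_
  unfold Real.sign
  exact Measurable.ite measurableSet_Iio measurable_const
    (Measurable.ite measurableSet_Ioi measurable_const measurable_const)

theorem norm_sign_le (x : ℝ) : ‖(Real.sign x : ℂ)‖ ≤ 1 := by
  rcases Real.sign_apply_eq x with h | h | h <;> simp [h]

/-- Multiplication by the sign function. -/
noncomputable def signOp : Lp ℂ 2 (volume : Measure ℝ) →L[ℂ] Lp ℂ 2 (volume : Measure ℝ) :=
  mulOp measurable_sign norm_sign_le

theorem coeFn_signOp (f : Lp ℂ 2 (volume : Measure ℝ)) :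
    signOp f =ᵐ[volume] fun t => (Real.sign t : ℂ) * f t :=
  coeFn_mulOp _ _ f

theorem signOp_signOp (f : Lp ℂ 2 (volume : Measure ℝ)) : signOp (signOp f) = f := by
  apply Lp.ext
  filter_upwards [coeFn_signOp (signOp f), coeFn_signOp f,
    compl_mem_ae_iff.2 (measure_singleton (0 : ℝ))] with t h1 h2 h3
  rw [h1, h2, ← mul_assoc]
  have h3 : t ≠ 0 := h3
  rcases lt_or_gt_of_ne h3 with h | h <;> simp [Real.sign_of_neg, Real.sign_of_pos, h]

theorem inner_mulOp {w : ℝ → ℂ} (hw : Measurable w) (hb : ∀ t, ‖w t‖ ≤ 1)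
    (hr : ∀ t, star (w t) = w t) (f g : Lp ℂ 2 (volume : Measure ℝ)) :
    inner ℂ (mulOp hw hb f) g = inner ℂ f (mulOp hw hb g) := by
  rw [L2.inner_def, L2.inner_def]
  refine integral_congr_ae ?_
  filter_upwards [coeFn_mulOp hw hb f, coeFn_mulOp hw hb g] with t h1 h2
  have := hr t
  simp only [h1, h2, RCLike.inner_apply, map_mul, Complex.star_def] at this ⊢
  rw [this]; ring

/-- The singular integral operator on `L₂(ℝ)`, defined by its Fourier multiplier. -/
noncomputable def hilbertOp : Lp ℂ 2 (volume : Measure ℝ) →L[ℂ] Lp ℂ 2 (volume : Measure ℝ) :=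
  (unitaryFourier.toContinuousLinearEquiv : _ →L[ℂ] _) ∘L signOp ∘L
    (unitaryFourier.symm.toContinuousLinearEquiv : _ →L[ℂ] _)

theorem hilbertOp_apply (f : Lp ℂ 2 (volume : Measure ℝ)) :
    hilbertOp f = unitaryFourier (signOp (unitaryFourier.symm f)) := rfl

theorem hilbertOp_hilbertOp (f : Lp ℂ 2 (volume : Measure ℝ)) : hilbertOp (hilbertOp f) = f := by
  simp [hilbertOp_apply, signOp_signOp]

theorem norm_hilbertOp_le (f : Lp ℂ 2 (volume : Measure ℝ)) : ‖hilbertOp f‖ ≤ ‖f‖ := by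
  rw [hilbertOp_apply, LinearIsometryEquiv.norm_map]
  exact (norm_mulOp_le _ _ _).trans (LinearIsometryEquiv.norm_map _ _).le

theorem inner_hilbertOp (f g : Lp ℂ 2 (volume : Measure ℝ)) :
    inner ℂ (hilbertOp f) g = inner ℂ f (hilbertOp g) := by
  rw [hilbertOp_apply, hilbertOp_apply, LinearIsometryEquiv.inner_map_eq_flip,
    ← LinearIsometryEquiv.inner_map_map unitaryFourier.symm f,
    LinearIsometryEquiv.symm_apply_apply]
  exact inner_mulOp _ _ (fun t => by simp) _ _

theorem signOp_reflect (f : Lp ℂ 2 (volume : Measure ℝ)) :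
    signOp (reflect f) = -reflect (signOp f) := by
  apply Lp.ext
  filter_upwards [coeFn_signOp (reflect f), coeFn_reflect f, coeFn_reflect (signOp f),
    ae_comp_neg (coeFn_signOp f), Lp.coeFn_neg (reflect (signOp f))] with t h1 h2 h3 h4 h5
  rw [h1, h2, h5, Pi.neg_apply, h3, h4]
  simp [Real.sign_neg]

theorem unitaryFourier_hilbertOp (f : Lp ℂ 2 (volume : Measure ℝ)) :
    unitaryFourier (hilbertOp f) = -signOp (unitaryFourier f) := by
  rw [hilbertOp_apply, unitaryFourier_symm_apply, signOp_reflect, map_neg, map_neg,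
    unitaryFourier_reflect]
  exact congrArg Neg.neg (unitaryFourier.apply_symm_apply _)

theorem signOp_expPlus {z : ℂ} (hz : 0 < z.im) :
    signOp (memLp_expPlus hz).toLp = (memLp_expPlus hz).toLp := by
  apply Lp.ext
  filter_upwards [coeFn_signOp (memLp_expPlus hz).toLp, (memLp_expPlus hz).coeFn_toLp] with t h1 h2
  rw [h1, h2, expPlus]
  by_cases ht : t ∈ Ioi (0 : ℝ)
  · simp [Real.sign_of_pos ht]
  · simp [ht]

theorem signOp_expMinus {z : ℂ} (hz : 0 < z.im) :
    signOp (memLp_expMinus hz).toLp = -(memLp_expMinus hz).toLp := by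
  apply Lp.ext
  filter_upwards [coeFn_signOp (memLp_expMinus hz).toLp, (memLp_expMinus hz).coeFn_toLp,
    Lp.coeFn_neg (memLp_expMinus hz).toLp] with t h1 h2 h3
  rw [h3, Pi.neg_apply, h1, h2, expMinus, expPlus]
  by_cases ht : -t ∈ Ioi (0 : ℝ)
  · simp [Real.sign_of_neg (show t < 0 by simpa using ht)]
  · simp [ht]

theorem hilbertOp_cauchyKernel_of_neg {w : ℂ} (hw : w.im < 0) :
    hilbertOp (cauchyKernel hw.ne) = cauchyKernel hw.ne := by
  rw [cauchyKernel_eq_of_neg hw, map_smul, hilbertOp_apply, LinearIsometryEquiv.symm_apply_apply,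
    signOp_expPlus (by simpa using hw)]

theorem hilbertOp_cauchyKernel_of_pos {w : ℂ} (hw : 0 < w.im) :
    hilbertOp (cauchyKernel hw.ne') = -cauchyKernel hw.ne' := by
  rw [cauchyKernel_eq_of_pos hw, map_smul, hilbertOp_apply, LinearIsometryEquiv.symm_apply_apply,
    signOp_expMinus hw, map_neg, smul_neg]

end HilbertOp

section ApproximateIdentity

theorem lintegral_Ioi_layer {a : ℝ} (ha : 0 ≤ a) :
    ∫⁻ s in Ioi a, ENNReal.ofReal (2 * s / (1 + s ^ 2) ^ 2) = ENNReal.ofReal (1 / (1 + a ^ 2)) := by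
  have hd : ∀ s ∈ Ioi a, HasDerivAt (fun s : ℝ => -(1 + s ^ 2)⁻¹) (2 * s / (1 + s ^ 2) ^ 2) s := by
    intro s _
    have h1 : HasDerivAt (fun s : ℝ => 1 + s ^ 2) (2 * s) s := by
      simpa using (hasDerivAt_pow 2 s).const_add 1
    have := (h1.inv (by positivity)).neg
    rwa [neg_div, neg_neg] at this
  have hpos : ∀ s ∈ Ioi a, 0 ≤ 2 * s / (1 + s ^ 2) ^ 2 := fun s hs => by
    have : 0 ≤ s := ha.trans (le_of_lt hs)
    positivity
  have hc : ContinuousWithinAt (fun s : ℝ => -(1 + s ^ 2)⁻¹) (Ici a) a := by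
    refine ContinuousAt.continuousWithinAt (ContinuousAt.neg (ContinuousAt.inv₀ (by fun_prop) ?_))
    positivity
  have ht : Tendsto (fun s : ℝ => -(1 + s ^ 2)⁻¹) atTop (𝓝 0) := by
    rw [← neg_zero]
    exact (tendsto_inv_atTop_zero.comp
      (tendsto_atTop_add_const_left _ 1 (tendsto_pow_atTop (by norm_num)))).neg
  rw [← ofReal_integral_eq_lintegral_ofReal (integrableOn_Ioi_deriv_of_nonneg hc hd hpos ht)
    ((ae_restrict_iff' measurableSet_Ioi).2 (ae_of_all _ hpos)),
    integral_Ioi_of_hasDerivAt_of_nonneg hc hd hpos ht]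
  congr 1
  simp

/-- The Poisson kernel (times `π`) as a superposition of normalized indicator functions. -/
theorem poisson_eq_lintegral {ε : ℝ} (hε : 0 < ε) (d : ℝ) :
    ENNReal.ofReal (ε / (d ^ 2 + ε ^ 2)) = ∫⁻ s in Ioi (0 : ℝ),
      ENNReal.ofReal (2 * s / (1 + s ^ 2) ^ 2) * (ENNReal.ofReal ε⁻¹ *
        (Iio (ε * s)).indicator 1 |d|) := by
  have h0 : ε / (d ^ 2 + ε ^ 2) = 1 / (1 + (|d| / ε) ^ 2) * ε⁻¹ := by
    rw [div_pow, sq_abs]; field_simp; ring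
  have ha : 0 ≤ |d| / ε := by positivity
  rw [h0, ENNReal.ofReal_mul (by positivity), ← lintegral_Ioi_layer ha,
    ← lintegral_mul_const' _ _ ENNReal.ofReal_ne_top, ← lintegral_indicator measurableSet_Ioi,
    ← lintegral_indicator measurableSet_Ioi]
  refine lintegral_congr fun s => ?_
  by_cases h1 : s ∈ Ioi (|d| / ε)
  · have h2 : s ∈ Ioi (0 : ℝ) := ha.trans_lt h1
    have h3 : |d| ∈ Iio (ε * s) := by
      have := (div_lt_iff₀ hε).1 h1
      rw [mem_Iio]; linarith
    simp [indicator_of_mem h1, indicator_of_mem h2, indicator_of_mem h3]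
  · have h3 : |d| ∉ Iio (ε * s) := fun h => h1 (by
      rw [mem_Ioi, div_lt_iff₀ hε, mul_comm]; exact h)
    rw [indicator_of_notMem h1]
    by_cases h2 : s ∈ Ioi (0 : ℝ)
    · rw [indicator_of_mem h2, indicator_of_notMem h3]; simp
    · rw [indicator_of_notMem h2]

theorem lintegral_poisson_eq {Ψ : ℝ → ℝ≥0∞} (hΨ : Measurable Ψ) (x : ℝ) {ε : ℝ} (hε : 0 < ε) :
    ∫⁻ u, ENNReal.ofReal (ε / ((u - x) ^ 2 + ε ^ 2)) * Ψ u = ∫⁻ s in Ioi (0 : ℝ),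
      ENNReal.ofReal (2 * s / (1 + s ^ 2) ^ 2) * (ENNReal.ofReal ε⁻¹ *
        ∫⁻ u in Metric.ball x (ε * s), Ψ u) := by
  simp_rw [poisson_eq_lintegral hε]
  have hm : Measurable fun p : ℝ × ℝ => ENNReal.ofReal (2 * p.2 / (1 + p.2 ^ 2) ^ 2) *
      (ENNReal.ofReal ε⁻¹ * (Iio (ε * p.2)).indicator (1 : ℝ → ℝ≥0∞) |p.1 - x|) := by
    refine Measurable.mul (by fun_prop) (measurable_const.mul ?_)
    have : (fun p : ℝ × ℝ => (Iio (ε * p.2)).indicator (1 : ℝ → ℝ≥0∞) |p.1 - x|) =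
        {p : ℝ × ℝ | |p.1 - x| < ε * p.2}.indicator 1 := by
      ext p; by_cases h : |p.1 - x| < ε * p.2 <;> simp [indicator, h]
    rw [this]
    exact measurable_one.indicator (measurableSet_lt (by fun_prop) (by fun_prop))
  have h1 : ∀ u, (∫⁻ s in Ioi (0 : ℝ), ENNReal.ofReal (2 * s / (1 + s ^ 2) ^ 2) *
      (ENNReal.ofReal ε⁻¹ * (Iio (ε * s)).indicator (1 : ℝ → ℝ≥0∞) |u - x|)) * Ψ u =
      ∫⁻ s in Ioi (0 : ℝ), ENNReal.ofReal (2 * s / (1 + s ^ 2) ^ 2) *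
      (ENNReal.ofReal ε⁻¹ * (Iio (ε * s)).indicator (1 : ℝ → ℝ≥0∞) |u - x|) * Ψ u := fun u =>
    (lintegral_mul_const _ (hm.comp (measurable_prodMk_left (x := u)))).symm
  simp_rw [h1]
  rw [lintegral_lintegral_swap ((hm.mul (hΨ.comp measurable_fst)).aemeasurable)]
  refine lintegral_congr fun s => ?_
  rw [← lintegral_indicator Metric.isOpen_ball.measurableSet, ← mul_assoc,
    ← lintegral_const_mul _ (hΨ.indicator Metric.isOpen_ball.measurableSet)]
  refine lintegral_congr fun u => ?_
  by_cases h : |u - x| < ε * s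
  · have h2 : u ∈ Metric.ball x (ε * s) := by rwa [Metric.mem_ball, Real.dist_eq]
    simp [indicator, h2, h]
  · have h2 : u ∉ Metric.ball x (ε * s) := by rwa [Metric.mem_ball, Real.dist_eq]
    simp [indicator, h2, h]

/-- The Poisson averages of `Ψ` tend to zero where the means of `Ψ` over balls do. -/
theorem tendsto_lintegral_poisson {Ψ : ℝ → ℝ≥0∞} (hΨ : Measurable Ψ) {x : ℝ}
    (h0 : Tendsto (fun r : ℝ => ENNReal.ofReal r⁻¹ * ∫⁻ u in Metric.ball x r, Ψ u)
      (𝓝[>] 0) (𝓝 0))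
    {K : ℝ≥0∞} (hK : K ≠ ∞) (hb : ∀ r : ℝ, 0 < r →
      ENNReal.ofReal r⁻¹ * ∫⁻ u in Metric.ball x r, Ψ u ≤ K) :
    Tendsto (fun ε : ℝ => ∫⁻ u, ENNReal.ofReal (ε / ((u - x) ^ 2 + ε ^ 2)) * Ψ u)
      (𝓝[>] 0) (𝓝 0) := by
  have hk : ∀ s : ℝ, 0 < s → ∀ ε : ℝ, 0 < ε →
      ENNReal.ofReal (2 * s / (1 + s ^ 2) ^ 2) * (ENNReal.ofReal ε⁻¹ *
        ∫⁻ u in Metric.ball x (ε * s), Ψ u) =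
      ENNReal.ofReal (2 * s ^ 2 / (1 + s ^ 2) ^ 2) * (ENNReal.ofReal (ε * s)⁻¹ *
        ∫⁻ u in Metric.ball x (ε * s), Ψ u) := by
    intro s hs ε hε
    rw [← mul_assoc, ← mul_assoc, ← ENNReal.ofReal_mul (by positivity),
      ← ENNReal.ofReal_mul (by positivity)]
    congr 2
    field_simp
  have hev : (fun ε : ℝ => ∫⁻ s in Ioi (0 : ℝ), ENNReal.ofReal (2 * s / (1 + s ^ 2) ^ 2) *
      (ENNReal.ofReal ε⁻¹ * ∫⁻ u in Metric.ball x (ε * s), Ψ u)) =ᶠ[𝓝[>] 0]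
      fun ε : ℝ => ∫⁻ u, ENNReal.ofReal (ε / ((u - x) ^ 2 + ε ^ 2)) * Ψ u := by
    filter_upwards [self_mem_nhdsWithin] with ε hε
    exact (lintegral_poisson_eq hΨ x hε).symm
  refine Tendsto.congr' hev ?_
  have hz : (0 : ℝ≥0∞) = ∫⁻ _ in Ioi (0 : ℝ), 0 := by simp
  rw [hz]
  refine tendsto_lintegral_filter_of_dominated_convergence
    (fun s => ENNReal.ofReal (2 * (1 + s ^ 2)⁻¹) * K) ?_ ?_ ?_ ?_
  · refine Eventually.of_forall fun ε => Measurable.mul (by fun_prop) (measurable_const.mul ?_)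
    have hmono : Monotone fun r : ℝ => ∫⁻ u in Metric.ball x r, Ψ u := fun r r' h =>
      lintegral_mono_set (Metric.ball_subset_ball h)
    exact hmono.measurable.comp (measurable_const_mul ε)
  · filter_upwards [self_mem_nhdsWithin] with ε hε
    have hε : 0 < ε := hε
    refine (ae_restrict_iff' measurableSet_Ioi).2 (ae_of_all _ fun s hs => ?_)
    have hs : 0 < s := hs
    rw [hk s hs ε hε]
    gcongr
    · rw [pow_two (1 + s ^ 2), ← div_div, ← div_eq_mul_inv]
      gcongr
      rw [div_le_iff₀ (by positivity)]
      nlinarith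
    · exact hb _ (by positivity)
  · rw [lintegral_mul_const' _ _ hK]
    refine ENNReal.mul_ne_top (ne_of_lt ?_) hK
    exact (((integrable_inv_one_add_sq.const_mul 2).restrict).lintegral_lt_top)
  · refine (ae_restrict_iff' measurableSet_Ioi).2 (ae_of_all _ fun s hs => ?_)
    have hs : 0 < s := hs
    have ht : Tendsto (fun ε : ℝ => ε * s) (𝓝[>] 0) (𝓝[>] 0) := by
      refine tendsto_nhdsWithin_iff.2 ⟨?_, ?_⟩
      · have : Tendsto (fun ε : ℝ => ε * s) (𝓝 0) (𝓝 (0 * s)) := by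
          exact (continuous_mul_const s).tendsto 0
        rw [zero_mul] at this
        exact this.mono_left nhdsWithin_le_nhds
      · filter_upwards [self_mem_nhdsWithin] with ε hε
        exact mul_pos hε hs
    have h1 := ENNReal.Tendsto.const_mul (h0.comp ht)
      (Or.inr (ENNReal.ofReal_ne_top (r := 2 * s ^ 2 / (1 + s ^ 2) ^ 2)))
    rw [mul_zero] at h1
    refine h1.congr' ?_
    filter_upwards [self_mem_nhdsWithin] with ε hε
    exact (hk s hs ε hε).symm

/-- `x` is a Lebesgue point of `f` with respect to Poisson averages. -/
def IsPoissonPoint (f : ℝ → ℂ) (x : ℝ) : Prop :=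
  Tendsto (fun ε : ℝ => ∫⁻ u, ENNReal.ofReal (ε / ((u - x) ^ 2 + ε ^ 2)) * ‖f u - f x‖ₑ)
      (𝓝[>] 0) (𝓝 0)

theorem lintegral_sq_ne_top (f : Lp ℂ 2 (volume : Measure ℝ)) : ∫⁻ u, ‖f u‖ₑ ^ 2 ≠ ∞ := by
  have := (Lp.memLp f).eLpNorm_lt_top
  rw [IsWeightedContraction.eLpNorm_two_eq] at this
  exact ((ENNReal.rpow_lt_top_iff_of_pos (by norm_num)).1 this).ne

theorem ae_isPoissonPoint (f : Lp ℂ 2 (volume : Measure ℝ)) : ∀ᵐ x, IsPoissonPoint f x := by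
  have hloc : LocallyIntegrable f volume := (Lp.memLp f).locallyIntegrable (by norm_num)
  filter_upwards [IsUnifLocDoublingMeasure.ae_tendsto_average_norm_sub volume hloc 1] with x hx
  have hfm : Measurable f := (Lp.stronglyMeasurable f).measurable
  have hm : Measurable fun u => ‖f u - f x‖ₑ := (hfm.sub_const _).enorm
  have h1 := hx (l := 𝓝[>] (0 : ℝ)) (fun _ => x) id tendsto_id (by
    filter_upwards [self_mem_nhdsWithin] with r hr
    simpa using le_of_lt hr)
  have hle : ∀ r : ℝ, 0 < r → ENNReal.ofReal r⁻¹ * ∫⁻ u in Metric.ball x r, ‖f u - f x‖ₑ ≤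
      ENNReal.ofReal (2 * ⨍ y in Metric.closedBall x r, ‖f y - f x‖) := by
    intro r hr
    have hint : IntegrableOn (fun y => f y - f x) (Metric.closedBall x r) :=
      (hloc.integrableOn_isCompact (isCompact_closedBall x r)).sub
        (integrableOn_const (by rw [Real.volume_closedBall]; exact ENNReal.ofReal_ne_top))
    calc ENNReal.ofReal r⁻¹ * ∫⁻ u in Metric.ball x r, ‖f u - f x‖ₑ
        ≤ ENNReal.ofReal r⁻¹ * ∫⁻ u in Metric.closedBall x r, ‖f u - f x‖ₑ := by
          gcongr; exact Metric.ball_subset_closedBall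
      _ = ENNReal.ofReal (2 * ⨍ y in Metric.closedBall x r, ‖f y - f x‖) := by
          rw [← ofReal_integral_norm_eq_lintegral_enorm hint, ← ENNReal.ofReal_mul (by positivity),
            setAverage_eq, Measure.real, Real.volume_closedBall,
            ENNReal.toReal_ofReal (by positivity), smul_eq_mul]
          congr 1
          field_simp
  have h0 : Tendsto (fun r : ℝ => ENNReal.ofReal r⁻¹ * ∫⁻ u in Metric.ball x r, ‖f u - f x‖ₑ)
      (𝓝[>] 0) (𝓝 0) := by
    have h2 := ENNReal.tendsto_ofReal (h1.const_mul 2)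
    rw [mul_zero, ENNReal.ofReal_zero] at h2
    refine tendsto_of_tendsto_of_tendsto_of_le_of_le' tendsto_const_nhds h2
      (Eventually.of_forall fun _ => zero_le) ?_
    filter_upwards [self_mem_nhdsWithin] with r hr using hle r hr
  obtain ⟨r₀, hr₀, hr₀'⟩ := (mem_nhdsGT_iff_exists_Ioo_subset' (show (0 : ℝ) < 1 by norm_num)).1
    (h0.eventually (gt_mem_nhds (show (0 : ℝ≥0∞) < 1 by norm_num)))
  have hr₀ : 0 < r₀ := hr₀
  set N := ∫⁻ u, ‖f u‖ₑ ^ 2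
  refine tendsto_lintegral_poisson hm h0
    (K := 1 + (2 + 2 * ‖f x‖ₑ + ENNReal.ofReal r₀⁻¹ * N)) ?_ fun r hr => ?_
  · have : N ≠ ∞ := lintegral_sq_ne_top f
    finiteness
  · rcases lt_or_ge r r₀ with h | h
    · exact (le_of_lt (hr₀' ⟨hr, h⟩)).trans le_self_add
    · refine le_trans ?_ le_add_self
      have hpt : ∀ u, ‖f u - f x‖ₑ ≤ (1 + ‖f x‖ₑ) + ‖f u‖ₑ ^ 2 := fun u => by
        have ha : ‖f u‖ₑ ≤ 1 + ‖f u‖ₑ ^ 2 := by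
          rcases le_total ‖f u‖ₑ 1 with h | h
          · exact h.trans le_self_add
          · refine le_trans ?_ le_add_self
            rw [pow_two]; exact le_mul_of_one_le_right zero_le h
        calc ‖f u - f x‖ₑ ≤ ‖f u‖ₑ + ‖f x‖ₑ := enorm_sub_le
          _ ≤ (1 + ‖f u‖ₑ ^ 2) + ‖f x‖ₑ := by gcongr
          _ = _ := by ring
      have hrr : ENNReal.ofReal r⁻¹ * ENNReal.ofReal r = 1 := by
        rw [← ENNReal.ofReal_mul (by positivity), inv_mul_cancel₀ hr.ne', ENNReal.ofReal_one]
      calc ENNReal.ofReal r⁻¹ * ∫⁻ u in Metric.ball x r, ‖f u - f x‖ₑ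
          ≤ ENNReal.ofReal r⁻¹ * ∫⁻ u in Metric.ball x r, ((1 + ‖f x‖ₑ) + ‖f u‖ₑ ^ 2) := by
            gcongr with u; exact hpt u
        _ ≤ ENNReal.ofReal r⁻¹ * ((1 + ‖f x‖ₑ) * ENNReal.ofReal (2 * r) + N) := by
            rw [lintegral_add_left measurable_const, setLIntegral_const, Real.volume_ball]
            gcongr
            exact setLIntegral_le_lintegral _ _
        _ = (ENNReal.ofReal r⁻¹ * ENNReal.ofReal r) * (2 + 2 * ‖f x‖ₑ) +
              ENNReal.ofReal r⁻¹ * N := by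
            rw [ENNReal.ofReal_mul (by norm_num), ENNReal.ofReal_ofNat]
            ring
        _ ≤ 2 + 2 * ‖f x‖ₑ + ENNReal.ofReal r₀⁻¹ * N := by
            rw [hrr, one_mul]
            gcongr

end ApproximateIdentity

section PoissonIntegral

/-- The cone with vertex `x` in the upper half-plane. -/
def cone (x a : ℝ) : Set ℂ := {z : ℂ | 0 < z.im ∧ |z.re - x| < a * z.im}

/-- The Poisson kernel of the upper half-plane, times `π`. -/
noncomputable def poissonKer (z : ℂ) (u : ℝ) : ℝ := z.im / ((u - z.re) ^ 2 + z.im ^ 2)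

theorem poissonKer_nonneg {z : ℂ} (hz : 0 < z.im) (u : ℝ) : 0 ≤ poissonKer z u := by
  rw [poissonKer]; positivity

theorem poissonKer_eq {z : ℂ} (hz : 0 < z.im) (u : ℝ) : poissonKer z u =
    1 / (2 * Complex.I) * (1 / ((u : ℂ) - z) - 1 / ((u : ℂ) - (starRingEnd ℂ) z)) := by
  have h1 : (u : ℂ) - z ≠ 0 := fun h => by
    have := congrArg Complex.im h; simp at this; exact hz.ne' this
  have h2 : (u : ℂ) - (starRingEnd ℂ) z ≠ 0 := fun h => by
    have := congrArg Complex.im h; simp at this; exact hz.ne' this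
  have h3 : ((u : ℂ) - z) * ((u : ℂ) - (starRingEnd ℂ) z) =
      (((u - z.re) ^ 2 + z.im ^ 2 : ℝ) : ℂ) := by
    rw [show (u : ℂ) - (starRingEnd ℂ) z = (starRingEnd ℂ) (u - z) by simp, Complex.mul_conj,
      Complex.normSq_apply]
    congr 1
    simp
    ring
  have h4 : z - (starRingEnd ℂ) z = 2 * Complex.I * z.im := by
    apply Complex.ext <;> simp; ring
  rw [div_sub_div _ _ h1 h2, h3, poissonKer, Complex.ofReal_div,
    show 1 * ((u : ℂ) - (starRingEnd ℂ) z) - ((u : ℂ) - z) * 1 = z - (starRingEnd ℂ) z by ring, h4]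
  field_simp

theorem memLp_poissonKer {z : ℂ} (hz : 0 < z.im) :
    MemLp (fun u => (poissonKer z u : ℂ)) 2 := by
  simp_rw [poissonKer_eq hz]
  refine ((memLp_cauchyKernel hz.ne').sub (memLp_cauchyKernel ?_)).const_mul _
  simpa using hz.ne'

theorem integrable_poissonKer {z : ℂ} (hz : 0 < z.im) : Integrable (poissonKer z) := by
  have h := ((integrable_inv_one_add_sq.comp_div hz.ne').comp_sub_right z.re).mul_const (z.im⁻¹)
  refine h.congr (ae_of_all _ fun u => ?_)
  simp only [poissonKer]
  field_simp
  ring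

theorem integral_poissonKer {z : ℂ} (hz : 0 < z.im) : ∫ u, poissonKer z u = Real.pi := by
  have h : ∀ u, poissonKer z u = z.im⁻¹ * (1 + ((u - z.re) / z.im) ^ 2)⁻¹ := fun u => by
    simp only [poissonKer]
    field_simp
    ring
  simp_rw [h]
  rw [integral_const_mul, integral_sub_right_eq_self (fun u => (1 + (u / z.im) ^ 2)⁻¹),
    Measure.integral_comp_div (fun u => (1 + u ^ 2)⁻¹), integral_univ_inv_one_add_sq,
    abs_of_pos hz, smul_eq_mul, ← mul_assoc, inv_mul_cancel₀ hz.ne', one_mul]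

/-- In a cone, the Poisson kernel is comparable with the one at the point above the vertex. -/
theorem poissonKer_le {z : ℂ} {x a : ℝ} (hz : z ∈ cone x a) (u : ℝ) :
    poissonKer z u ≤ (2 + 2 * a ^ 2) * (z.im / ((u - x) ^ 2 + z.im ^ 2)) := by
  obtain ⟨h0, h1⟩ := hz
  have h2 : (z.re - x) ^ 2 ≤ a ^ 2 * z.im ^ 2 := by
    rw [← mul_pow, ← sq_abs]
    exact pow_le_pow_left₀ (abs_nonneg _) h1.le 2
  rw [poissonKer, ← mul_div_assoc, div_le_div_iff₀ (by positivity) (by positivity)]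
  have h3 : (u - x) ^ 2 + z.im ^ 2 ≤ (2 + 2 * a ^ 2) * ((u - z.re) ^ 2 + z.im ^ 2) := by
    have : (u - x) ^ 2 ≤ 2 * (u - z.re) ^ 2 + 2 * (z.re - x) ^ 2 := by
      nlinarith [sq_nonneg ((u - z.re) - (z.re - x))]
    nlinarith [mul_nonneg (sq_nonneg a) (sq_nonneg (u - z.re)), sq_nonneg z.im]
  nlinarith [mul_le_mul_of_nonneg_left h3 h0.le]

/-- The Poisson integral of `f`. -/
noncomputable def poissonInt (f : ℝ → ℂ) (z : ℂ) : ℂ :=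
  1 / (Real.pi : ℂ) * ∫ u, (poissonKer z u : ℂ) * f u

theorem integrable_poissonKer_mul {z : ℂ} (hz : 0 < z.im) (f : Lp ℂ 2 (volume : Measure ℝ)) :
    Integrable fun u => (poissonKer z u : ℂ) * f u :=
  (memLp_poissonKer hz).integrable_mul (Lp.memLp f)

theorem poissonInt_sub {z : ℂ} (hz : 0 < z.im) (f : Lp ℂ 2 (volume : Measure ℝ)) (c : ℂ) :
    poissonInt f z - c = 1 / (Real.pi : ℂ) * ∫ u, (poissonKer z u : ℂ) * (f u - c) := by
  have hi : Integrable fun u => (poissonKer z u : ℂ) := (integrable_poissonKer hz).ofReal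
  simp_rw [mul_sub]
  rw [integral_sub (integrable_poissonKer_mul hz f) (hi.mul_const c),
    integral_mul_const, integral_complex_ofReal, integral_poissonKer hz, poissonInt, mul_sub,
    ← mul_assoc, one_div, inv_mul_cancel₀ (by exact_mod_cast Real.pi_ne_zero), one_mul]

theorem tendsto_poissonInt {f : Lp ℂ 2 (volume : Measure ℝ)} {x : ℝ} (hx : IsPoissonPoint f x)
    (a : ℝ) : Tendsto (poissonInt f) (𝓝[cone x a] (x : ℂ)) (𝓝 (f x)) := by
  rw [tendsto_iff_edist_tendsto_0]
  have him : Tendsto Complex.im (𝓝[cone x a] (x : ℂ)) (𝓝[>] 0) := by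
    refine tendsto_nhdsWithin_iff.2 ⟨?_, ?_⟩
    · have := Complex.continuous_im.tendsto (x : ℂ)
      rw [Complex.ofReal_im] at this
      exact this.mono_left nhdsWithin_le_nhds
    · filter_upwards [self_mem_nhdsWithin] with z hz using hz.1
  have h1 := ENNReal.Tendsto.const_mul (hx.comp him)
    (Or.inr (ENNReal.ofReal_ne_top (r := Real.pi⁻¹ * (2 + 2 * a ^ 2))))
  rw [mul_zero] at h1
  refine tendsto_of_tendsto_of_tendsto_of_le_of_le' tendsto_const_nhds h1
    (Eventually.of_forall fun _ => zero_le) ?_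
  filter_upwards [self_mem_nhdsWithin] with z hz
  rw [edist_eq_enorm_sub, poissonInt_sub hz.1, enorm_mul, ENNReal.ofReal_mul (by positivity), mul_assoc]
  refine mul_le_mul' ?_ ?_
  · rw [← ofReal_norm, norm_div, norm_one, Complex.norm_real, Real.norm_of_nonneg Real.pi_pos.le,
      one_div]
  · refine (enorm_integral_le_lintegral_enorm _).trans ?_
    simp only [Function.comp_apply]
    rw [← lintegral_const_mul' _ _ ENNReal.ofReal_ne_top]
    refine lintegral_mono fun u => ?_
    rw [enorm_mul, ← mul_assoc, ← ENNReal.ofReal_mul (by positivity), ← ofReal_norm,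
      Complex.norm_real, Real.norm_of_nonneg (poissonKer_nonneg hz.1 u)]
    gcongr
    exact poissonKer_le hz u

end PoissonIntegral

section PrincipalValue

/-- The conjugate Poisson kernel, times `π`. -/
noncomputable def conjPoissonKer (z : ℂ) (u : ℝ) : ℝ := (u - z.re) / ((u - z.re) ^ 2 + z.im ^ 2)

theorem conjPoissonKer_eq {z : ℂ} (hz : 0 < z.im) (u : ℝ) : conjPoissonKer z u =
    1 / 2 * (1 / ((u : ℂ) - z) + 1 / ((u : ℂ) - (starRingEnd ℂ) z)) := by
  have h1 : (u : ℂ) - z ≠ 0 := fun h => by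
    have := congrArg Complex.im h; simp at this; exact hz.ne' this
  have h2 : (u : ℂ) - (starRingEnd ℂ) z ≠ 0 := fun h => by
    have := congrArg Complex.im h; simp at this; exact hz.ne' this
  have h3 : ((u : ℂ) - z) * ((u : ℂ) - (starRingEnd ℂ) z) =
      (((u - z.re) ^ 2 + z.im ^ 2 : ℝ) : ℂ) := by
    rw [show (u : ℂ) - (starRingEnd ℂ) z = (starRingEnd ℂ) (u - z) by simp, Complex.mul_conj,
      Complex.normSq_apply]
    congr 1
    simp
    ring
  have h4 : 1 * ((u : ℂ) - (starRingEnd ℂ) z) + ((u : ℂ) - z) * 1 = 2 * ((u - z.re : ℝ) : ℂ) := by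
    apply Complex.ext <;> simp; ring
  rw [div_add_div _ _ h1 h2, h3, h4, conjPoissonKer, Complex.ofReal_div]
  field_simp

theorem memLp_conjPoissonKer {z : ℂ} (hz : 0 < z.im) :
    MemLp (fun u => (conjPoissonKer z u : ℂ)) 2 := by
  simp_rw [conjPoissonKer_eq hz]
  refine ((memLp_cauchyKernel hz.ne').add (memLp_cauchyKernel ?_)).const_mul _
  simpa using hz.ne'

theorem toLp_poissonKer {z : ℂ} (hz : 0 < z.im) (hz' : ((starRingEnd ℂ) z).im < 0) :
    (memLp_poissonKer hz).toLp =
      (1 / (2 * Complex.I)) • (cauchyKernel hz.ne' - cauchyKernel hz'.ne) := by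
  apply Lp.ext
  filter_upwards [(memLp_poissonKer hz).coeFn_toLp, Lp.coeFn_smul (1 / (2 * Complex.I))
    (cauchyKernel hz.ne' - cauchyKernel hz'.ne), Lp.coeFn_sub (cauchyKernel hz.ne')
    (cauchyKernel hz'.ne), coeFn_cauchyKernel hz.ne', coeFn_cauchyKernel hz'.ne] with u h1 h2 h3 h4 h5
  rw [h1, h2, Pi.smul_apply, h3, Pi.sub_apply, h4, h5, poissonKer_eq hz, smul_eq_mul]

theorem toLp_conjPoissonKer {z : ℂ} (hz : 0 < z.im) (hz' : ((starRingEnd ℂ) z).im < 0) :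
    (memLp_conjPoissonKer hz).toLp =
      (1 / 2 : ℂ) • (cauchyKernel hz.ne' + cauchyKernel hz'.ne) := by
  apply Lp.ext
  filter_upwards [(memLp_conjPoissonKer hz).coeFn_toLp, Lp.coeFn_smul (1 / 2 : ℂ)
    (cauchyKernel hz.ne' + cauchyKernel hz'.ne), Lp.coeFn_add (cauchyKernel hz.ne')
    (cauchyKernel hz'.ne), coeFn_cauchyKernel hz.ne', coeFn_cauchyKernel hz'.ne] with u h1 h2 h3 h4 h5
  rw [h1, h2, Pi.smul_apply, h3, Pi.add_apply, h4, h5, conjPoissonKer_eq hz, smul_eq_mul]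

theorem toLp_conjPoissonKer_eq_hilbertOp {z : ℂ} (hz : 0 < z.im) :
    (memLp_conjPoissonKer hz).toLp = (-Complex.I) • hilbertOp (memLp_poissonKer hz).toLp := by
  have hz' : ((starRingEnd ℂ) z).im < 0 := by simpa using hz
  rw [toLp_poissonKer hz hz', toLp_conjPoissonKer hz hz', map_smul, map_sub,
    hilbertOp_cauchyKernel_of_pos hz, hilbertOp_cauchyKernel_of_neg hz', smul_smul,
    show -Complex.I * (1 / (2 * Complex.I)) = -(1 / 2) by
      have := Complex.I_ne_zero; field_simp,
    ← neg_add', smul_neg, neg_smul, neg_neg]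

theorem inner_toLp_ofReal {k : ℝ → ℝ} (hk : MemLp (fun u => (k u : ℂ)) 2)
    (f : Lp ℂ 2 (volume : Measure ℝ)) : inner ℂ hk.toLp f = ∫ u, (k u : ℂ) * f u := by
  rw [L2.inner_def]
  refine integral_congr_ae ?_
  filter_upwards [hk.coeFn_toLp] with u hu
  rw [hu, RCLike.inner_apply, Complex.conj_ofReal, mul_comm]

/-- The conjugate Poisson integral of `f` is the Poisson integral of its singular integral. -/
theorem conjPoisson_eq_poissonInt {z : ℂ} (hz : 0 < z.im) (f : Lp ℂ 2 (volume : Measure ℝ)) :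
    1 / ((Real.pi : ℂ) * Complex.I) * ∫ u, (conjPoissonKer z u : ℂ) * f u =
      poissonInt (hilbertOp f) z := by
  rw [← inner_toLp_ofReal (memLp_conjPoissonKer hz), toLp_conjPoissonKer_eq_hilbertOp hz,
    inner_smul_left, inner_hilbertOp,
    inner_toLp_ofReal (memLp_poissonKer hz), poissonInt, map_neg, Complex.conj_I,
    neg_neg]
  have := Complex.I_ne_zero
  field_simp

/-- The difference of the truncated kernel and the conjugate Poisson kernel. -/
noncomputable def truncDiff (x ε : ℝ) (t : ℝ) : ℝ :=
  {t : ℝ | ε < |t - x|}.indicator (fun t => (t - x)⁻¹) t - (t - x) / ((t - x) ^ 2 + ε ^ 2)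

theorem measurable_truncDiff (x ε : ℝ) : Measurable (truncDiff x ε) := by
  refine Measurable.sub (Measurable.indicator (by fun_prop)
    (measurableSet_lt measurable_const (by fun_prop))) (by fun_prop)

theorem abs_truncDiff_le (x : ℝ) {ε : ℝ} (hε : 0 < ε) (t : ℝ) :
    |truncDiff x ε t| ≤ ε / ((t - x) ^ 2 + ε ^ 2) := by
  rw [truncDiff]
  generalize ht : t - x = d
  by_cases h : ε < |d|
  · have hd : d ≠ 0 := by rintro rfl; simp at h; linarith
    rw [indicator_of_mem (by simpa [ht] using h), ht,
      show d⁻¹ - d / (d ^ 2 + ε ^ 2) = (ε / d) * (ε / (d ^ 2 + ε ^ 2)) by field_simp; ring, abs_mul,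
      abs_div, abs_of_pos hε, abs_of_pos (show 0 < ε / (d ^ 2 + ε ^ 2) by positivity)]
    refine mul_le_of_le_one_left (by positivity) ?_
    rw [div_le_one (by linarith)]
    exact h.le
  · rw [indicator_of_notMem (by simpa [ht] using h), zero_sub, abs_neg, abs_div,
      abs_of_pos (show 0 < d ^ 2 + ε ^ 2 by positivity)]
    gcongr
    exact not_lt.1 h

theorem truncDiff_reflect (x ε : ℝ) (t : ℝ) : truncDiff x ε (2 * x - t) = -truncDiff x ε t := by
  have h : ∀ s, truncDiff x ε s = {t : ℝ | ε < |t|}.indicator (fun t => t⁻¹) (s - x) -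
    (s - x) / ((s - x) ^ 2 + ε ^ 2) := fun s => rfl
  rw [h, h, show 2 * x - t - x = -(t - x) by ring]
  generalize t - x = d
  by_cases hd : ε < |d|
  · simp [indicator, hd, inv_neg, neg_div]; ring
  · simp [indicator, hd, neg_div]

theorem integrable_truncDiff (x : ℝ) {ε : ℝ} (hε : 0 < ε) : Integrable (truncDiff x ε) := by
  refine (integrable_poissonKer (z := ⟨x, ε⟩) hε).mono' (measurable_truncDiff x ε).aestronglyMeasurable
    (ae_of_all _ fun t => ?_)
  exact abs_truncDiff_le x hε t

theorem integral_truncDiff (x ε : ℝ) : ∫ t, truncDiff x ε t = 0 := by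
  have h := integral_sub_left_eq_self (truncDiff x ε) volume (2 * x)
  simp_rw [truncDiff_reflect] at h
  rw [integral_neg] at h
  linarith

theorem integrable_truncDiff_mul (x : ℝ) {ε : ℝ} (hε : 0 < ε) (f : Lp ℂ 2 (volume : Measure ℝ)) :
    Integrable fun t => (truncDiff x ε t : ℂ) * f t := by
  refine (integrable_poissonKer_mul (z := ⟨x, ε⟩) hε f).norm.mono'
    ((Complex.measurable_ofReal.comp (measurable_truncDiff x ε)).mul
      (Lp.stronglyMeasurable f).measurable).aestronglyMeasurable (ae_of_all _ fun t => ?_)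
  rw [norm_mul, norm_mul, Complex.norm_real, Complex.norm_real]
  gcongr
  exact (abs_truncDiff_le x hε t).trans (le_abs_self _)

theorem tendsto_integral_truncDiff {f : Lp ℂ 2 (volume : Measure ℝ)} {x : ℝ}
    (hx : IsPoissonPoint f x) :
    Tendsto (fun ε => ∫ t, (truncDiff x ε t : ℂ) * f t) (𝓝[>] 0) (𝓝 0) := by
  rw [tendsto_iff_edist_tendsto_0]
  refine tendsto_of_tendsto_of_tendsto_of_le_of_le' tendsto_const_nhds hx
    (Eventually.of_forall fun _ => zero_le) ?_
  filter_upwards [self_mem_nhdsWithin] with ε hε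
  have hε : 0 < ε := hε
  have hmul := integrable_truncDiff_mul x hε f
  have h0 : ∫ t, (truncDiff x ε t : ℂ) * f t = ∫ t, (truncDiff x ε t : ℂ) * (f t - f x) := by
    have hi : Integrable fun t => (truncDiff x ε t : ℂ) := (integrable_truncDiff x hε).ofReal
    simp_rw [mul_sub]
    rw [integral_sub hmul (hi.mul_const _), integral_mul_const,
      integral_complex_ofReal, integral_truncDiff]
    simp
  rw [edist_zero_right, h0]
  refine (enorm_integral_le_lintegral_enorm _).trans (lintegral_mono fun t => ?_)
  rw [enorm_mul]
  gcongr
  rw [← ofReal_norm, Complex.norm_real]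
  exact ENNReal.ofReal_le_ofReal (abs_truncDiff_le x hε t)

theorem truncated_integral_eq (f : Lp ℂ 2 (volume : Measure ℝ)) (x : ℝ) {ε : ℝ} (hε : 0 < ε) :
    ∫ t in {t : ℝ | ε < |t - x|}, f t / ((t : ℂ) - (x : ℂ)) =
      (∫ t, (truncDiff x ε t : ℂ) * f t) + ∫ t, (conjPoissonKer ⟨x, ε⟩ t : ℂ) * f t := by
  have hmul := integrable_truncDiff_mul x hε f
  have hmul' : Integrable fun t => (conjPoissonKer ⟨x, ε⟩ t : ℂ) * f t :=
    (memLp_conjPoissonKer (z := ⟨x, ε⟩) hε).integrable_mul (Lp.memLp f)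
  rw [← integral_indicator (measurableSet_lt measurable_const (by fun_prop)),
    ← integral_add hmul hmul']
  refine integral_congr_ae (ae_of_all _ fun t => ?_)
  simp only [truncDiff, conjPoissonKer]
  by_cases h : ε < |t - x|
  · simp [indicator, h, div_eq_inv_mul]; ring
  · simp [indicator, h]

theorem isSingularIntegralOperator_hilbertOp :
    IsSingularIntegralOperator volume hilbertOp := by
  intro f
  filter_upwards [ae_isPoissonPoint f, ae_isPoissonPoint (hilbertOp f)] with x h1 h2
  have h3 : Tendsto (fun ε : ℝ => (⟨x, ε⟩ : ℂ)) (𝓝[>] 0) (𝓝[cone x 1] (x : ℂ)) := by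
    refine tendsto_nhdsWithin_iff.2 ⟨?_, ?_⟩
    · have : Continuous fun ε : ℝ => (⟨x, ε⟩ : ℂ) := by
        have : (fun ε : ℝ => (⟨x, ε⟩ : ℂ)) = fun ε : ℝ => (x : ℂ) + ε * Complex.I := by
          ext ε; apply Complex.ext <;> simp
        rw [this]; fun_prop
      exact (this.tendsto 0).mono_left nhdsWithin_le_nhds
    · filter_upwards [self_mem_nhdsWithin] with ε hε
      have hε : 0 < ε := hε
      simp [cone, hε]
  have h4 := ((tendsto_integral_truncDiff h1).const_mul (1 / ((Real.pi : ℂ) * Complex.I))).add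
    ((tendsto_poissonInt h2 1).comp h3)
  rw [mul_zero, zero_add] at h4
  refine h4.congr' ?_
  filter_upwards [self_mem_nhdsWithin] with ε hε
  rw [truncated_integral_eq f x hε, mul_add, conjPoisson_eq_poissonInt (z := ⟨x, ε⟩) hε]
  rfl

/-- The singular integral operator on `L₂(s)`, the compression of the one on `L₂(ℝ)`. -/
noncomputable def hilbertOpOn {s : Set ℝ} (hs : MeasurableSet s) :
    Lp ℂ 2 (volume.restrict s) →L[ℂ] Lp ℂ 2 (volume.restrict s) :=
  restrictTo s ∘L hilbertOp ∘L extendZero hs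

theorem hilbertOpOn_apply {s : Set ℝ} (hs : MeasurableSet s) (f : Lp ℂ 2 (volume.restrict s)) :
    hilbertOpOn hs f = restrictTo s (hilbertOp (extendZero hs f)) := rfl

theorem isSingularIntegralOperator_hilbertOpOn {s : Set ℝ} (hs : MeasurableSet s) :
    IsSingularIntegralOperator (volume.restrict s) (hilbertOpOn hs) := by
  intro f
  filter_upwards [ae_restrict_of_ae (isSingularIntegralOperator_hilbertOp (extendZero hs f)),
    coeFn_restrictTo (s := s) (hilbertOp (extendZero hs f))] with x h1 h2
  rw [hilbertOpOn_apply, h2]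
  refine h1.congr fun ε => ?_
  congr 1
  have hm : MeasurableSet {t : ℝ | ε < |t - x|} := measurableSet_lt measurable_const (by fun_prop)
  rw [Measure.restrict_restrict hm, ← integral_indicator hm, ← integral_indicator (hm.inter hs)]
  refine integral_congr_ae ?_
  filter_upwards [coeFn_extendZero hs f] with t ht
  by_cases h1 : ε < |t - x| <;> by_cases h2 : t ∈ s <;> simp [indicator, h1, h2, ht]

end PrincipalValue

section LaplaceTransform

open Real

/-- The Laplace–Fourier transform `(2π)^(-1/2) ∫_{t > 0} g(t) exp(izt) dt`. -/
noncomputable def laplaceInt (g : ℝ → ℂ) (z : ℂ) : ℂ :=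
  1 / (√(2 * π) : ℂ) * ∫ t, g t * expPlus z t

theorem integrable_mul_expPlus (g : Lp ℂ 2 (volume : Measure ℝ)) {z : ℂ} (hz : 0 < z.im) :
    Integrable fun t => g t * expPlus z t :=
  (Lp.memLp g).integrable_mul (memLp_expPlus hz)

theorem norm_expPlus_le {z w : ℂ} (h : w.im ≤ z.im) (t : ℝ) : ‖expPlus z t‖ ≤ ‖expPlus w t‖ := by
  by_cases ht : t ∈ Ioi (0 : ℝ)
  · simp only [expPlus, indicator_of_mem ht, norm_exp_I_mul]
    have ht : 0 < t := ht
    gcongr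
  · simp [expPlus, ht]

theorem norm_expPlus_le_one {z : ℂ} (hz : 0 < z.im) (t : ℝ) : ‖expPlus z t‖ ≤ 1 := by
  refine (norm_expPlus_le (w := 0) (by simpa using hz.le) t).trans ?_
  by_cases ht : t ∈ Ioi (0 : ℝ) <;> simp [expPlus, ht]

theorem measurable_expPlus (z : ℂ) : Measurable (expPlus z) :=
  Measurable.indicator (by fun_prop) measurableSet_Ioi

theorem hasDerivAt_expPlus (z : ℂ) (t : ℝ) :
    HasDerivAt (fun z => expPlus z t) (Complex.I * t * expPlus z t) z := by
  by_cases ht : t ∈ Ioi (0 : ℝ)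
  · simp only [expPlus, indicator_of_mem ht]
    have h1 : HasDerivAt (fun z : ℂ => Complex.I * z * t) (Complex.I * t) z := by
      simpa using ((hasDerivAt_id z).const_mul Complex.I).mul_const (t : ℂ)
    have := h1.cexp
    rwa [mul_comm] at this
  · simpa [expPlus, ht] using hasDerivAt_const z (0 : ℂ)

theorem norm_mul_expPlus_le {z : ℂ} {c : ℝ} (hc : 0 < c) (hz : c ≤ z.im) (t : ℝ) :
    ‖Complex.I * t * expPlus z t‖ ≤ (2 / c) * ‖expPlus (c / 2 * Complex.I) t‖ := by
  by_cases ht : t ∈ Ioi (0 : ℝ)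
  · simp only [expPlus, indicator_of_mem ht, norm_mul, norm_exp_I_mul, Complex.norm_I, one_mul,
      Complex.norm_real]
    have ht : 0 < t := ht
    have him : (c / 2 * Complex.I : ℂ).im = c / 2 := by simp
    rw [him, norm_of_nonneg ht.le]
    have h1 : rexp (-z.im * t) ≤ rexp (-(c / 2) * t) * rexp (-(c / 2) * t) := by
      rw [← Real.exp_add]
      gcongr
      nlinarith
    have h2 : t * rexp (-(c / 2) * t) ≤ 2 / c := by
      have h3 : c / 2 * t ≤ rexp (c / 2 * t) := by linarith [Real.add_one_le_exp (c / 2 * t)]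
      rw [neg_mul, Real.exp_neg, ← div_eq_mul_inv, div_le_iff₀ (Real.exp_pos _)]
      calc t = 2 / c * (c / 2 * t) := by field_simp
        _ ≤ _ := by gcongr
    calc t * rexp (-z.im * t) ≤ t * (rexp (-(c / 2) * t) * rexp (-(c / 2) * t)) := by gcongr
      _ = t * rexp (-(c / 2) * t) * rexp (-(c / 2) * t) := by ring
      _ ≤ _ := by gcongr
  · simp [expPlus, ht]

theorem differentiableOn_laplaceInt (g : Lp ℂ 2 (volume : Measure ℝ)) :
    DifferentiableOn ℂ (laplaceInt g) {z : ℂ | 0 < z.im} := by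
  intro z₀ hz₀
  have hz₀ : 0 < z₀.im := hz₀
  set c := z₀.im / 2 with hc
  have hc0 : 0 < c := by positivity
  have hgm := (Lp.stronglyMeasurable g).measurable
  have hs : {z : ℂ | c < z.im} ∈ 𝓝 z₀ :=
    (isOpen_lt continuous_const Complex.continuous_im).mem_nhds (by simp [hc]; linarith)
  have h := hasDerivAt_integral_of_dominated_loc_of_deriv_le (μ := (volume : Measure ℝ))
    (F := fun z t => g t * expPlus z t) (F' := fun z t => g t * (Complex.I * t * expPlus z t))
    (bound := fun t => (2 / c) * ‖g t * expPlus (c / 2 * Complex.I) t‖) hs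
    (Eventually.of_forall fun z => (hgm.mul (measurable_expPlus z)).aestronglyMeasurable)
    (integrable_mul_expPlus g hz₀)
    (hgm.mul ((by fun_prop : Measurable fun t : ℝ => Complex.I * (t : ℂ)).mul
      (measurable_expPlus z₀))).aestronglyMeasurable
    (ae_of_all _ fun t z hz => by
      rw [norm_mul (g t), norm_mul (g t), mul_left_comm]
      exact mul_le_mul_of_nonneg_left (norm_mul_expPlus_le hc0 (le_of_lt hz) t) (norm_nonneg _))
    ((integrable_mul_expPlus g (by simpa using hc0)).norm.const_mul _)
    (ae_of_all _ fun t z _ => (hasDerivAt_expPlus z t).const_mul (g t))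
  exact (h.2.const_mul _).differentiableAt.differentiableWithinAt

theorem memLp_mul_expPlus (g : Lp ℂ 2 (volume : Measure ℝ)) {z : ℂ} (hz : 0 < z.im) :
    MemLp (fun t => g t * expPlus z t) 2 := by
  refine MemLp.of_le (Lp.memLp g) ((Lp.stronglyMeasurable g).measurable.mul
    (measurable_expPlus z)).aestronglyMeasurable (ae_of_all _ fun t => ?_)
  rw [norm_mul]
  exact mul_le_of_le_one_right (norm_nonneg _) (norm_expPlus_le_one hz t)

theorem eLpNorm_laplaceInt_le (g : Lp ℂ 2 (volume : Measure ℝ)) {y : ℝ} (hy : 0 < y) :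
    eLpNorm (fun x : ℝ => laplaceInt g ((x : ℂ) + (y : ℂ) * Complex.I)) 2 volume ≤
      eLpNorm g 2 volume := by
  have hy' : 0 < ((y : ℂ) * Complex.I).im := by simpa using hy
  have h1 : (fun x : ℝ => laplaceInt g ((x : ℂ) + (y : ℂ) * Complex.I)) =
      fourierInt fun t => g t * expPlus (y * Complex.I) t := by
    ext x
    rw [laplaceInt, fourierInt]
    congr 2
    ext t
    rw [mul_assoc]
    congr 1
    by_cases ht : t ∈ Ioi (0 : ℝ)
    · simp only [expPlus, indicator_of_mem ht, ← Complex.exp_add]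
      congr 1; ring
    · simp [expPlus, ht]
  rw [h1, ← eLpNorm_congr_ae (coeFn_unitaryFourier (integrable_mul_expPlus g hy')
    (memLp_mul_expPlus g hy')), ← Lp.enorm_def, ← ofReal_norm, LinearIsometryEquiv.norm_map,
    ofReal_norm, Lp.enorm_def, eLpNorm_congr_ae (MemLp.coeFn_toLp _)]
  refine eLpNorm_mono fun t => ?_
  rw [norm_mul]
  exact mul_le_of_le_one_right (norm_nonneg _) (norm_expPlus_le_one hy' t)

theorem isHardyFunction_laplaceInt (g : Lp ℂ 2 (volume : Measure ℝ)) :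
    IsHardyFunction (laplaceInt g) :=
  ⟨differentiableOn_laplaceInt g, eLpNorm g 2 volume, Lp.eLpNorm_lt_top g,
    fun _ hy => eLpNorm_laplaceInt_le g hy⟩

theorem unitaryFourier_exp_add {z : ℂ} (hz : 0 < z.im)
    (hz' : 0 < (-(starRingEnd ℂ) z).im) :
    unitaryFourier ((memLp_expPlus hz').toLp + (memLp_expMinus hz).toLp) =
      (2 / (√(2 * π) : ℂ)) • (memLp_poissonKer hz).toLp := by
  apply Lp.ext
  rw [map_add]
  filter_upwards [Lp.coeFn_add (unitaryFourier (memLp_expPlus hz').toLp)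
      (unitaryFourier (memLp_expMinus hz).toLp), coeFn_unitaryFourier_expPlus hz',
    coeFn_unitaryFourier_expMinus hz, (memLp_poissonKer hz).coeFn_toLp,
    Lp.coeFn_smul (2 / (√(2 * π) : ℂ)) (memLp_poissonKer hz).toLp] with u h1 h2 h3 h4 h5
  rw [h1, Pi.add_apply, h2, h3, h5, Pi.smul_apply, h4, poissonKer_eq hz, smul_eq_mul,
    ← sub_eq_add_neg (u : ℂ)]
  have hI : 1 / (2 * Complex.I) = -(Complex.I / 2) := by
    rw [← div_div, one_div, div_eq_mul_inv, Complex.inv_I]; ring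
  rw [hI]
  ring

/-- The Laplace–Fourier transform is the Poisson integral of the Fourier transform. -/
theorem laplaceInt_eq_poissonInt {g : Lp ℂ 2 (volume : Measure ℝ)}
    (hg : ∀ᵐ t, t ∉ Ioi (0 : ℝ) → g t = 0) {z : ℂ} (hz : 0 < z.im) :
    laplaceInt g z = poissonInt (unitaryFourier g) z := by
  have hz' : 0 < (-(starRingEnd ℂ) z).im := by simpa using hz
  have h1 : ∫ t, g t * expPlus z t =
      inner ℂ ((memLp_expPlus hz').toLp + (memLp_expMinus hz).toLp) g := by
    rw [L2.inner_def]
    refine integral_congr_ae ?_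
    filter_upwards [hg, (memLp_expPlus hz').coeFn_toLp, (memLp_expMinus hz).coeFn_toLp,
      Lp.coeFn_add (memLp_expPlus hz').toLp (memLp_expMinus hz).toLp] with t h1 h2 h3 h4
    rw [h4, Pi.add_apply, h2, h3, RCLike.inner_apply]
    by_cases ht : t ∈ Ioi (0 : ℝ)
    · have ht' : ¬ (t < 0) := not_lt.2 (le_of_lt ht)
      have ht0 : 0 < t := ht
      simp [expMinus, expPlus, ht0, ht', ← Complex.exp_conj]
    · rw [h1 ht]; simp
  rw [laplaceInt, h1, ← LinearIsometryEquiv.inner_map_map unitaryFourier,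
    unitaryFourier_exp_add hz hz', inner_smul_left, inner_toLp_ofReal (memLp_poissonKer hz),
    poissonInt, ← mul_assoc]
  congr 1
  rw [map_div₀, Complex.conj_ofReal, map_ofNat, div_mul_div_comm, one_mul, ← Complex.ofReal_mul,
    mul_self_sqrt (by positivity)]
  push_cast
  have : (π : ℂ) ≠ 0 := by exact_mod_cast pi_ne_zero
  field_simp

theorem unitaryFourier_mem_hardySpace {g : Lp ℂ 2 (volume : Measure ℝ)}
    (hg : ∀ᵐ t, t ∉ Ioi (0 : ℝ) → g t = 0) : unitaryFourier g ∈ hardySpace := by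
  refine ⟨laplaceInt g, isHardyFunction_laplaceInt g, ?_⟩
  filter_upwards [ae_isPoissonPoint (unitaryFourier g)] with x hx a _
  refine (tendsto_poissonInt hx a).congr' ?_
  filter_upwards [self_mem_nhdsWithin] with z hz
  exact (laplaceInt_eq_poissonInt hg hz.1).symm

end LaplaceTransform

section HardySpace

open Real

theorem norm_sq_eq_integral (f : Lp ℂ 2 (volume : Measure ℝ)) : ‖f‖ ^ 2 = ∫ u, ‖f u‖ ^ 2 := by
  rw [← inner_self_eq_norm_sq (𝕜 := ℂ), L2.inner_def, ← integral_re]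
  · exact integral_congr_ae (ae_of_all _ fun u => inner_self_eq_norm_sq (𝕜 := ℂ) (f u))
  · exact L2.integrable_inner f f

theorem integrable_norm_sq (f : Lp ℂ 2 (volume : Measure ℝ)) : Integrable fun u => ‖f u‖ ^ 2 :=
  (memLp_two_iff_integrable_sq_norm (Lp.memLp f).1).1 (Lp.memLp f)

theorem norm_cauchyKernel_sq {w : ℂ} (hw : 0 < w.im) : ‖cauchyKernel hw.ne'‖ ^ 2 = π / w.im := by
  rw [norm_sq_eq_integral, ← integral_poissonKer hw, ← integral_div]
  refine integral_congr_ae ?_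
  filter_upwards [coeFn_cauchyKernel hw.ne'] with u hu
  rw [hu, norm_div, norm_one, div_pow, one_pow, Complex.sq_norm, Complex.normSq_apply, poissonKer]
  simp only [Complex.sub_re, Complex.ofReal_re, Complex.sub_im, Complex.ofReal_im, zero_sub]
  field_simp

/-- Bounded sequences in `L₂` that tend to zero almost everywhere tend to zero weakly. -/
theorem tendsto_inner_of_ae_tendsto {h : ℕ → Lp ℂ 2 (volume : Measure ℝ)} {C : ℝ}
    (hC : ∀ n, ‖h n‖ ≤ C) (h0 : ∀ᵐ x, Tendsto (fun n => h n x) atTop (𝓝 0))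
    (k : Lp ℂ 2 (volume : Measure ℝ)) : Tendsto (fun n => inner ℂ k (h n)) atTop (𝓝 0) := by
  rw [tendsto_zero_iff_norm_tendsto_zero]
  have hbound : ∀ A : ℝ, 0 < A → ∀ n, ‖inner ℂ k (h n)‖ ≤
      (∫ u, ‖k u‖ * min ‖h n u‖ (A * ‖k u‖)) + C ^ 2 / A := by
    intro A hA n
    have hm1 : Integrable fun u => ‖k u‖ * min ‖h n u‖ (A * ‖k u‖) := by
      refine ((integrable_norm_sq k).const_mul A).mono'
        ((Lp.stronglyMeasurable k).norm.mul ((Lp.stronglyMeasurable (h n)).norm.inf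
          ((Lp.stronglyMeasurable k).norm.const_mul A))).aestronglyMeasurable
        (ae_of_all _ fun u => ?_)
      rw [norm_of_nonneg (by positivity)]
      calc ‖k u‖ * min ‖h n u‖ (A * ‖k u‖) ≤ ‖k u‖ * (A * ‖k u‖) := by
            gcongr; exact min_le_right _ _
        _ = A * ‖k u‖ ^ 2 := by ring
    have hm2 : Integrable fun u => ‖h n u‖ ^ 2 / A := (integrable_norm_sq (h n)).div_const A
    calc ‖inner ℂ k (h n)‖ ≤ ∫ u, ‖inner ℂ (k u) (h n u)‖ := by
          rw [L2.inner_def]; exact norm_integral_le_integral_norm _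
      _ ≤ ∫ u, (‖k u‖ * min ‖h n u‖ (A * ‖k u‖) + ‖h n u‖ ^ 2 / A) := by
          refine integral_mono (L2.integrable_inner k (h n)).norm (hm1.add hm2) fun u => ?_
          refine (norm_inner_le_norm _ _).trans ?_
          rcases le_total ‖h n u‖ (A * ‖k u‖) with hle | hle
          · rw [min_eq_left hle]
            have : 0 ≤ ‖h n u‖ ^ 2 / A := by positivity
            linarith
          · rw [min_eq_right hle]
            have h1 : ‖k u‖ * ‖h n u‖ ≤ ‖h n u‖ ^ 2 / A := by
              rw [le_div_iff₀ hA]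
              nlinarith [norm_nonneg (h n u), norm_nonneg (k u)]
            have : 0 ≤ ‖k u‖ * (A * ‖k u‖) := by positivity
            linarith
      _ = (∫ u, ‖k u‖ * min ‖h n u‖ (A * ‖k u‖)) + ‖h n‖ ^ 2 / A := by
          rw [integral_add hm1 hm2, integral_div, norm_sq_eq_integral]
      _ ≤ _ := by gcongr; exact hC n
  have hlim : ∀ A : ℝ, 0 < A →
      Tendsto (fun n => ∫ u, ‖k u‖ * min ‖h n u‖ (A * ‖k u‖)) atTop (𝓝 0) := by
    intro A hA
    rw [show (0 : ℝ) = ∫ _ : ℝ, 0 by simp]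
    refine tendsto_integral_of_dominated_convergence (fun u => A * ‖k u‖ ^ 2) (fun n =>
        ((Lp.stronglyMeasurable k).norm.mul ((Lp.stronglyMeasurable (h n)).norm.inf
          ((Lp.stronglyMeasurable k).norm.const_mul A))).aestronglyMeasurable)
      ((integrable_norm_sq k).const_mul A) (fun n => ae_of_all _ fun u => ?_) ?_
    · rw [norm_of_nonneg (by positivity)]
      calc ‖k u‖ * min ‖h n u‖ (A * ‖k u‖) ≤ ‖k u‖ * (A * ‖k u‖) := by
            gcongr; exact min_le_right _ _
        _ = A * ‖k u‖ ^ 2 := by ring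
    · filter_upwards [h0] with u hu
      have h1 := (hu.norm.min (tendsto_const_nhds (x := A * ‖k u‖))).const_mul ‖k u‖
      rwa [norm_zero, min_eq_left (by positivity), mul_zero] at h1
  refine tendsto_order.2 ⟨fun a ha => Eventually.of_forall fun n => ha.trans_le (norm_nonneg _),
    fun a ha => ?_⟩
  have hA : 0 < 2 * (C ^ 2 + 1) / a := by positivity
  filter_upwards [(hlim _ hA).eventually (gt_mem_nhds (half_pos ha))] with n hn
  refine (hbound _ hA n).trans_lt ?_
  have h2 : C ^ 2 / (2 * (C ^ 2 + 1) / a) ≤ a / 2 := by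
    rw [div_div_eq_mul_div, div_le_div_iff₀ (by positivity) (by positivity)]
    nlinarith
  linarith

variable {F : ℂ → ℂ}

theorem IsHardyFunction.memLp (hF : IsHardyFunction F) {y : ℝ} (hy : 0 < y) :
    MemLp (fun x : ℝ => F ((x : ℂ) + (y : ℂ) * Complex.I)) 2 := by
  obtain ⟨hd, M, hM, hb⟩ := hF
  exact ⟨(continuous_horizontal hd hy).aestronglyMeasurable, (hb y hy).trans_lt hM⟩

theorem IsHardyFunction.exists_norm_le (hF : IsHardyFunction F) :
    ∃ M : ℝ, ∀ (y : ℝ) (hy : 0 < y), ‖(hF.memLp hy).toLp‖ ≤ M := by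
  obtain ⟨hd, M, hM, hb⟩ := hF
  refine ⟨M.toReal, fun y hy => ?_⟩
  rw [Lp.norm_toLp]
  exact ENNReal.toReal_mono hM.ne (hb y hy)

theorem im_conj_add {c : ℂ} (hc : c.im < 0) {y : ℝ} (hy : 0 < y) :
    0 < ((starRingEnd ℂ) c + y * Complex.I).im := by
  simp; linarith

theorem inner_cauchyKernel {w : ℂ} (hw : w.im ≠ 0) {f : ℝ → ℂ} (hf : MemLp f 2) :
    inner ℂ (cauchyKernel hw) hf.toLp = ∫ u : ℝ, f u / (u - (starRingEnd ℂ) w) := by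
  rw [L2.inner_def]
  refine integral_congr_ae ?_
  filter_upwards [coeFn_cauchyKernel hw, hf.coeFn_toLp] with u h1 h2
  rw [h1, h2, RCLike.inner_apply]
  simp [div_eq_mul_inv]

/-- The Cauchy integral of a Hardy function along a horizontal line. -/
noncomputable def lineCauchy (F : ℂ → ℂ) (c : ℂ) (y : ℝ) : ℂ :=
  ∫ x : ℝ, F ((x : ℂ) + (y : ℂ) * Complex.I) / ((x : ℂ) + (y : ℂ) * Complex.I - c)

theorem lineCauchy_eq_inner (hF : IsHardyFunction F) {c : ℂ} {y : ℝ} (hy : 0 < y) {w : ℂ}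
    (hw : w.im ≠ 0) (hwc : (starRingEnd ℂ) w = c - y * Complex.I) :
    lineCauchy F c y = inner ℂ (cauchyKernel hw) (hF.memLp hy).toLp := by
  rw [inner_cauchyKernel, hwc, lineCauchy]
  congr 1
  ext x
  ring

theorem integrable_line (hF : IsHardyFunction F) {c : ℂ} (hc : c.im < 0) {y : ℝ} (hy : 0 < y) :
    Integrable fun x : ℝ =>
      F ((x : ℂ) + (y : ℂ) * Complex.I) / ((x : ℂ) + (y : ℂ) * Complex.I - c) := by
  have him : (c - y * Complex.I).im ≠ 0 := by simp; linarith
  refine ((hF.memLp hy).integrable_mul (memLp_cauchyKernel him)).congr (ae_of_all _ fun x => ?_)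
  simp only [Pi.mul_apply, div_eq_mul_inv, one_mul]
  congr 2
  ring

theorem integral_norm_line_le (hF : IsHardyFunction F) : ∃ M : ℝ, ∀ (c : ℂ) (_ : c.im < 0)
    (y : ℝ) (_ : 0 < y), ∫ x : ℝ,
      ‖F ((x : ℂ) + (y : ℂ) * Complex.I) / ((x : ℂ) + (y : ℂ) * Complex.I - c)‖ ≤
      M ^ 2 + π / (-c.im) := by
  obtain ⟨M, hM⟩ := hF.exists_norm_le
  refine ⟨M, fun c hc y hy => ?_⟩
  have hw := im_conj_add hc hy
  have hi1 := integrable_norm_sq (hF.memLp hy).toLp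
  have hi2 := integrable_norm_sq (cauchyKernel hw.ne')
  have hM0 : ‖(hF.memLp hy).toLp‖ ^ 2 ≤ M ^ 2 :=
    pow_le_pow_left₀ (norm_nonneg _) (hM y hy) 2
  calc _ ≤ ∫ x : ℝ, (‖((hF.memLp hy).toLp : Lp ℂ 2 (volume : Measure ℝ)) x‖ ^ 2 + ‖cauchyKernel hw.ne' x‖ ^ 2) := by
        refine integral_mono_ae (integrable_line hF hc hy).norm (hi1.add hi2) ?_
        filter_upwards [(hF.memLp hy).coeFn_toLp, coeFn_cauchyKernel hw.ne'] with x h1 h2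
        rw [h1, h2, norm_div]
        have h3 : ‖1 / ((x : ℂ) - ((starRingEnd ℂ) c + y * Complex.I))‖ =
            1 / ‖(x : ℂ) + (y : ℂ) * Complex.I - c‖ := by
          rw [norm_div, norm_one, ← Complex.norm_conj]
          congr 2
          simp
          ring
        rw [h3, div_eq_mul_one_div]
        nlinarith [sq_nonneg (‖F ((x : ℂ) + (y : ℂ) * Complex.I)‖ -
          1 / ‖(x : ℂ) + (y : ℂ) * Complex.I - c‖), sq_nonneg (‖F ((x : ℂ) + (y : ℂ) * Complex.I)‖ +
          1 / ‖(x : ℂ) + (y : ℂ) * Complex.I - c‖)]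
    _ = ‖(hF.memLp hy).toLp‖ ^ 2 + ‖cauchyKernel hw.ne'‖ ^ 2 := by
        rw [integral_add hi1 hi2, norm_sq_eq_integral, norm_sq_eq_integral]
    _ ≤ M ^ 2 + π / (-c.im) := by
        rw [norm_cauchyKernel_sq hw]
        have : -c.im ≤ ((starRingEnd ℂ) c + y * Complex.I).im := by simp; linarith
        have h0 : 0 < -c.im := by linarith
        gcongr

theorem differentiableOn_div_sub (hF : IsHardyFunction F) {c : ℂ} (hc : c.im < 0) :
    DifferentiableOn ℂ (fun z => F z / (z - c)) {z : ℂ | 0 < z.im} := by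
  refine hF.1.div (by fun_prop) fun z hz h => ?_
  have hz : 0 < z.im := hz
  have := congrArg Complex.im h
  simp at this
  linarith

theorem integrable_vertical (hF : IsHardyFunction F) {c : ℂ} (hc : c.im < 0) {y₁ y₂ : ℝ}
    (h1 : 0 < y₁) :
    Integrable fun x : ℝ => ∫ y in Ioc y₁ y₂,
      F ((x : ℂ) + (y : ℂ) * Complex.I) / ((x : ℂ) + (y : ℂ) * Complex.I - c) := by
  set H : ℝ × ℝ → ℂ := fun p =>
    F ((p.1 : ℂ) + (p.2 : ℂ) * Complex.I) / ((p.1 : ℂ) + (p.2 : ℂ) * Complex.I - c) with hH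
  have hmeas : AEStronglyMeasurable H (volume.prod (volume.restrict (Ioc y₁ y₂))) := by
    have h2 : (volume : Measure ℝ).prod (volume.restrict (Ioc y₁ y₂)) =
        (volume.prod volume).restrict (univ ×ˢ Ioc y₁ y₂) := by
      rw [← Measure.prod_restrict, Measure.restrict_univ]
    rw [h2]
    refine ContinuousOn.aestronglyMeasurable ?_ (MeasurableSet.univ.prod measurableSet_Ioc)
    refine (differentiableOn_div_sub hF hc).continuousOn.comp (by fun_prop) fun p hp => ?_
    simpa using h1.trans hp.2.1
  obtain ⟨M, hM⟩ := integral_norm_line_le hF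
  have hint : Integrable H (volume.prod (volume.restrict (Ioc y₁ y₂))) := by
    rw [integrable_prod_iff' hmeas]
    refine ⟨(ae_restrict_iff' measurableSet_Ioc).2 (ae_of_all _ fun y hy =>
      integrable_line hF hc (h1.trans hy.1)), ?_⟩
    refine Integrable.mono' (integrable_const (M ^ 2 + π / (-c.im)))
      hmeas.norm.prod_swap.integral_prod_right' ?_
    refine (ae_restrict_iff' measurableSet_Ioc).2 (ae_of_all _ fun y hy => ?_)
    rw [norm_of_nonneg (integral_nonneg fun _ => norm_nonneg _)]
    exact hM c hc y (h1.trans hy.1)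
  exact hint.integral_prod_left

/-- The contour may be shifted. -/
theorem lineCauchy_eq (hF : IsHardyFunction F) {c : ℂ} (hc : c.im < 0) {y₁ y₂ : ℝ}
    (h1 : 0 < y₁) (h2 : y₁ ≤ y₂) : lineCauchy F c y₁ = lineCauchy F c y₂ := by
  set V : ℝ → ℂ := fun x => ∫ y in Ioc y₁ y₂,
      F ((x : ℂ) + (y : ℂ) * Complex.I) / ((x : ℂ) + (y : ℂ) * Complex.I - c) with hV
  have hVi : Integrable V := integrable_vertical hF hc h1
  have hrect : ∀ R : ℝ,
      (∫ x in (-R)..R, F ((x : ℂ) + (y₁ : ℂ) * Complex.I) / ((x : ℂ) + (y₁ : ℂ) * Complex.I - c)) -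
      (∫ x in (-R)..R, F ((x : ℂ) + (y₂ : ℂ) * Complex.I) / ((x : ℂ) + (y₂ : ℂ) * Complex.I - c)) =
      -(Complex.I * (V R - V (-R))) := by
    intro R
    have h := Complex.integral_boundary_rect_eq_zero_of_differentiableOn (fun z => F z / (z - c))
      (⟨-R, y₁⟩ : ℂ) (⟨R, y₂⟩ : ℂ) ((differentiableOn_div_sub hF hc).mono fun z hz => by
        have h3 : z.im ∈ uIcc y₁ y₂ := hz.2
        rw [uIcc_of_le h2] at h3
        exact h1.trans_le h3.1)
    simp only [intervalIntegral.integral_of_le h2, smul_eq_mul] at h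
    simp only [hV]
    linear_combination h
  have hlim : ∀ y : ℝ, 0 < y → Tendsto (fun R : ℝ => ∫ x in (-R)..R,
      F ((x : ℂ) + (y : ℂ) * Complex.I) / ((x : ℂ) + (y : ℂ) * Complex.I - c)) atTop
      (𝓝 (lineCauchy F c y)) := fun y hy =>
    intervalIntegral_tendsto_integral (integrable_line hF hc hy) tendsto_neg_atTop_atBot tendsto_id
  have hlim2 := (hlim y₁ h1).sub (hlim y₂ (h1.trans_le h2))
  simp_rw [hrect] at hlim2
  have hi : Integrable fun R => -(Complex.I * (V R - V (-R))) :=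
    ((hVi.sub hVi.comp_neg).const_mul Complex.I).neg
  have := IntegrableAtFilter.eq_zero_of_tendsto (hi.integrableAtFilter atTop) (fun s hs => by
    obtain ⟨a, ha⟩ := mem_atTop_sets.1 hs
    exact top_le_iff.1 ((Real.volume_Ici (a := a)).symm.le.trans (measure_mono ha))) hlim2
  exact sub_eq_zero.1 this

theorem lineCauchy_eq_zero (hF : IsHardyFunction F) {c : ℂ} (hc : c.im < 0) {y : ℝ}
    (hy : 0 < y) : lineCauchy F c y = 0 := by
  obtain ⟨M, hM⟩ := hF.exists_norm_le
  have hb : ∀ Y : ℝ, y ≤ Y → ‖lineCauchy F c y‖ ≤ √(π / Y) * M := by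
    intro Y hY
    have hY0 := hy.trans_le hY
    have hw := im_conj_add hc hY0
    rw [lineCauchy_eq hF hc hy hY, lineCauchy_eq_inner hF hY0 hw.ne' (by simp; ring)]
    refine (norm_inner_le_norm _ _).trans ?_
    gcongr
    · refine Real.le_sqrt_of_sq_le ?_
      rw [norm_cauchyKernel_sq hw]
      have : Y ≤ ((starRingEnd ℂ) c + Y * Complex.I).im := by simp; linarith
      gcongr
    · exact hM Y hY0
  have hl : Tendsto (fun Y : ℝ => √(π / Y) * M) atTop (𝓝 0) := by
    have := ((continuous_sqrt.tendsto 0).comp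
      (tendsto_const_nhds.div_atTop tendsto_id : Tendsto (fun Y : ℝ => π / Y) atTop (𝓝 0))).mul_const M
    simpa using this
  have := ge_of_tendsto hl (by
    filter_upwards [eventually_ge_atTop y] with Y hY using hb Y hY)
  exact norm_le_zero_iff.1 this

theorem inner_cauchyKernel_of_mem_hardySpace {f : Lp ℂ 2 (volume : Measure ℝ)}
    (hf : f ∈ hardySpace) {w : ℂ} (hw : 0 < w.im) : inner ℂ (cauchyKernel hw.ne') f = 0 := by
  obtain ⟨F, hF, hb⟩ := hf
  obtain ⟨M, hM⟩ := hF.exists_norm_le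
  set y : ℕ → ℝ := fun n => w.im / (n + 2) with hy
  have hy0 : ∀ n, 0 < y n := fun n => by positivity
  have hyw : ∀ n, y n < w.im := fun n => by
    have : (0 : ℝ) ≤ n := n.cast_nonneg
    rw [hy, div_lt_iff₀ (by positivity)]
    nlinarith
  have hylim : Tendsto y atTop (𝓝 0) := by
    refine tendsto_const_nhds.div_atTop ?_
    exact tendsto_atTop_add_const_right _ _ tendsto_natCast_atTop_atTop
  have horth : ∀ n, inner ℂ (cauchyKernel hw.ne') (hF.memLp (hy0 n)).toLp = 0 := fun n => by
    rw [← lineCauchy_eq_inner hF (c := (starRingEnd ℂ) w + y n * Complex.I) (hy0 n) hw.ne'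
      (by ring)]
    refine lineCauchy_eq_zero hF ?_ (hy0 n)
    have := hyw n
    simp; linarith
  have ht := tendsto_inner_of_ae_tendsto (h := fun n => (hF.memLp (hy0 n)).toLp - f)
    (C := M + ‖f‖) (fun n => (norm_sub_le _ _).trans (by gcongr; exact hM _ (hy0 n))) ?_
    (cauchyKernel hw.ne')
  · simp_rw [inner_sub_right, horth, zero_sub] at ht
    exact neg_eq_zero.1 (tendsto_nhds_unique tendsto_const_nhds ht)
  · have hae : ∀ᵐ x : ℝ, ∀ n, ((hF.memLp (hy0 n)).toLp - f : Lp ℂ 2 (volume : Measure ℝ)) x =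
        F ((x : ℂ) + (y n : ℂ) * Complex.I) - f x := ae_all_iff.2 fun n => by
      filter_upwards [Lp.coeFn_sub (hF.memLp (hy0 n)).toLp f, (hF.memLp (hy0 n)).coeFn_toLp]
        with x h1 h2
      rw [h1, Pi.sub_apply, h2]
    filter_upwards [hae, hb] with x h1 h2
    simp_rw [h1]
    rw [← sub_self (f x)]
    refine Tendsto.sub_const ((h2 1 one_pos).comp ?_) _
    refine tendsto_nhdsWithin_iff.2 ⟨?_, Eventually.of_forall fun n => ?_⟩
    · have := ((Complex.continuous_ofReal.tendsto 0).comp hylim).mul_const Complex.I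
      simpa using this.const_add (x : ℂ)
    · simpa using hy0 n

/-- Hardy functions are Fourier transforms of functions vanishing on the negative half-line. -/
theorem ae_eq_zero_of_mem_hardySpace {f : Lp ℂ 2 (volume : Measure ℝ)} (hf : f ∈ hardySpace) :
    ∀ᵐ t, t ∉ Ioi (0 : ℝ) → unitaryFourier.symm f t = 0 := by
  set g := unitaryFourier.symm f with hg
  have hI : 0 < Complex.I.im := by simp
  set h : ℝ → ℂ := fun t => g t * (starRingEnd ℂ) (expMinus Complex.I t) with hh
  have hm : MemLp (fun t => (starRingEnd ℂ) (expMinus Complex.I t)) 2 := (memLp_expMinus hI).star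
  have h1 : Integrable h := (Lp.memLp g).integrable_mul hm
  have h2 : MemLp h 2 := by
    refine MemLp.of_le (Lp.memLp g) h1.aestronglyMeasurable (ae_of_all _ fun t => ?_)
    rw [norm_mul, RCLike.norm_conj]
    exact mul_le_of_le_one_right (norm_nonneg _) (norm_expPlus_le_one hI (-t))
  have h3 := ae_eq_zero_of_fourierInt_eq_zero h1 h2 fun s => by
    have hw : 0 < ((s : ℂ) + Complex.I).im := by simp
    have h4 := inner_cauchyKernel_of_mem_hardySpace hf hw
    rw [cauchyKernel_eq_of_pos hw, inner_smul_left, LinearIsometryEquiv.inner_map_eq_flip,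
      mul_eq_zero, or_iff_right (by simp [pi_pos.le, pi_ne_zero]),
      L2.inner_def] at h4
    rw [← h4]
    refine integral_congr_ae ?_
    filter_upwards [(memLp_expMinus hw).coeFn_toLp] with t ht
    rw [ht, RCLike.inner_apply, hh, mul_assoc]
    congr 1
    by_cases h5 : -t ∈ Ioi (0 : ℝ)
    · simp only [expMinus, expPlus, indicator_of_mem h5, ← Complex.exp_conj, ← Complex.exp_add]
      congr 1
      simp only [map_mul, Complex.conj_I, Complex.conj_ofReal, map_add]
      push_cast
      ring
    · simp [expMinus, expPlus, h5]
  filter_upwards [h3, compl_mem_ae_iff.2 (measure_singleton (0 : ℝ))] with t h4 h5 h6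
  have h7 : -t ∈ Ioi (0 : ℝ) := by
    have h5 : t ≠ 0 := h5
    have h6 : ¬ (0 < t) := h6
    rw [mem_Ioi]
    exact neg_pos.2 (lt_of_le_of_ne (not_lt.1 h6) h5)
  have h8 : (starRingEnd ℂ) (expMinus Complex.I t) ≠ 0 := by
    simp only [expMinus, expPlus, indicator_of_mem h7, ← Complex.exp_conj]
    exact Complex.exp_ne_zero _
  exact (mul_eq_zero.1 h4).resolve_right h8

/-- The Fourier transform as an isometric isomorphism of `L₂(ℝ⁺)` onto the Hardy space. -/
noncomputable def hardyFourier :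
    Lp ℂ 2 ((volume : Measure ℝ).restrict (Ioi 0)) ≃ₗᵢ[ℂ] hardySpace :=
  LinearIsometryEquiv.ofSurjective
    { toFun := fun f => ⟨unitaryFourier (extendZero measurableSet_Ioi f),
        unitaryFourier_mem_hardySpace (by
          filter_upwards [coeFn_extendZero measurableSet_Ioi f] with t ht h
          rw [ht, indicator_of_notMem h])⟩
      map_add' := fun f g => by ext1; simp
      map_smul' := fun c f => by ext1; simp
      norm_map' := fun f => by
        change ‖unitaryFourier (extendZero measurableSet_Ioi f)‖ = ‖f‖
        rw [LinearIsometryEquiv.norm_map, norm_extendZero] } (by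
    rintro ⟨f, hf⟩
    refine ⟨restrictTo (Ioi 0) (unitaryFourier.symm f), Subtype.ext ?_⟩
    change unitaryFourier (extendZero measurableSet_Ioi
      (restrictTo (Ioi 0) (unitaryFourier.symm f))) = f
    have : extendZero measurableSet_Ioi (restrictTo (Ioi 0) (unitaryFourier.symm f)) =
        unitaryFourier.symm f := by
      apply Lp.ext
      filter_upwards [coeFn_extendZero_restrictTo measurableSet_Ioi (unitaryFourier.symm f),
        ae_eq_zero_of_mem_hardySpace hf] with t h1 h2
      rw [h1]
      by_cases h : t ∈ Ioi (0 : ℝ)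
      · simp [h]
      · simp [h, h2 h]
    rw [this, LinearIsometryEquiv.apply_symm_apply])

theorem coe_hardyFourier (f : Lp ℂ 2 ((volume : Measure ℝ).restrict (Ioi 0))) :
    (hardyFourier f : Lp ℂ 2 (volume : Measure ℝ)) =
      unitaryFourier (extendZero measurableSet_Ioi f) := rfl

end HardySpace

section Sech

open Real

theorem norm_expPlus_add_expMinus (c : ℝ) {t : ℝ} (ht : t ≠ 0) :
    ‖expPlus (c * Complex.I) t + expMinus (c * Complex.I) t‖ = rexp (-c * |t|) := by
  have him : ((c : ℂ) * Complex.I).im = c := by simp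
  rcases lt_or_gt_of_ne ht with h | h
  · have h1 : t ∉ Ioi (0 : ℝ) := not_lt.2 h.le
    have h2 : -t ∈ Ioi (0 : ℝ) := neg_pos.2 h
    rw [expMinus, expPlus, indicator_of_notMem h1, indicator_of_mem h2, zero_add, norm_exp_I_mul,
      him, abs_of_neg h]
  · have h1 : t ∈ Ioi (0 : ℝ) := h
    have h2 : -t ∉ Ioi (0 : ℝ) := not_lt.2 (neg_nonpos.2 h.le)
    rw [expMinus, expPlus, indicator_of_mem h1, indicator_of_notMem h2, add_zero, norm_exp_I_mul,
      him, abs_of_pos h]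

theorem integrable_of_exp_bound {f : ℝ → ℂ} (hf : Measurable f) {c C : ℝ} (hc : 0 < c)
    (hb : ∀ t, ‖f t‖ ≤ C * rexp (-c * |t|)) : Integrable f ∧ MemLp f 2 := by
  have him : 0 < ((c : ℂ) * Complex.I).im := by simpa using hc
  have hae : ∀ᵐ t : ℝ, ‖f t‖ ≤
      C * ‖expPlus (c * Complex.I) t + expMinus (c * Complex.I) t‖ := by
    filter_upwards [compl_mem_ae_iff.2 (measure_singleton (0 : ℝ))] with t ht
    rw [norm_expPlus_add_expMinus c ht]
    exact hb t
  refine ⟨memLp_one_iff_integrable.1 (MemLp.of_le_mul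
    (memLp_one_iff_integrable.2 ((integrable_expPlus him).add (integrable_expMinus him)))
    hf.aestronglyMeasurable hae), MemLp.of_le_mul
    ((memLp_expPlus him).add (memLp_expMinus him)) hf.aestronglyMeasurable hae⟩

/-- The function `1 / (2 cosh (t / 2))`. -/
noncomputable def sechKer (t : ℝ) : ℝ := (rexp (t / 2) + rexp (-t / 2))⁻¹

theorem sechKer_pos (t : ℝ) : 0 < sechKer t := by rw [sechKer]; positivity

theorem measurable_sechKer : Measurable sechKer := by unfold sechKer; fun_prop

theorem sechKer_le (t : ℝ) : sechKer t ≤ rexp (-(1 / 2) * |t|) := by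
  rw [sechKer, neg_mul, Real.exp_neg]
  gcongr
  rcases abs_cases t with ⟨h, _⟩ | ⟨h, _⟩ <;> rw [h]
  · rw [show 1 / 2 * t = t / 2 by ring]
    linarith [Real.exp_pos (-t / 2)]
  · rw [show 1 / 2 * -t = -t / 2 by ring]
    linarith [Real.exp_pos (t / 2)]

theorem abs_mul_sechKer_le (t : ℝ) : |t| * sechKer t ≤ 4 * rexp (-(1 / 4) * |t|) := by
  have h1 : |t| ≤ 4 * rexp (1 / 4 * |t|) := by linarith [Real.add_one_le_exp (1 / 4 * |t|)]
  calc |t| * sechKer t ≤ (4 * rexp (1 / 4 * |t|)) * rexp (-(1 / 2) * |t|) := by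
        gcongr
        · exact (sechKer_pos t).le
        · exact sechKer_le t
    _ = 4 * rexp (-(1 / 4) * |t|) := by
        rw [mul_assoc, ← Real.exp_add]; congr 2; ring

theorem integrable_sechKer :
    Integrable (fun t => (sechKer t : ℂ)) ∧ MemLp (fun t => (sechKer t : ℂ)) 2 := by
  refine integrable_of_exp_bound (c := 1 / 2) (C := 1)
    (Complex.measurable_ofReal.comp measurable_sechKer) (by norm_num) fun t => ?_
  rw [Complex.norm_real, norm_of_nonneg (sechKer_pos t).le, one_mul]
  exact sechKer_le t

theorem integrable_mul_sechKer :
    Integrable (fun t : ℝ => ((t * sechKer t : ℝ) : ℂ)) ∧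
      MemLp (fun t : ℝ => ((t * sechKer t : ℝ) : ℂ)) 2 := by
  refine integrable_of_exp_bound (c := 1 / 4) (C := 4)
    (Complex.measurable_ofReal.comp (measurable_id.mul measurable_sechKer)) (by norm_num)
    fun t => ?_
  rw [Complex.norm_real, norm_mul, norm_of_nonneg (sechKer_pos t).le]
  exact abs_mul_sechKer_le t

theorem sigmoid_eq (t : ℝ) : sigmoid t = rexp (t / 2) * sechKer t := by
  have h : rexp (t / 2) * rexp (-t) = rexp (-t / 2) := by rw [← Real.exp_add]; congr 1; ring
  rw [sigmoid_def, sechKer, ← h, ← mul_one_add, mul_inv, ← mul_assoc,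
    mul_inv_cancel₀ (Real.exp_ne_zero _), one_mul]

theorem one_sub_sigmoid_eq (t : ℝ) : 1 - sigmoid t = rexp (-t / 2) * sechKer t := by
  rw [← sigmoid_neg, sigmoid_eq, sechKer, sechKer, neg_neg, add_comm]

theorem ofReal_cpow_eq {p : ℝ} (hp : 0 < p) (z : ℂ) :
    (p : ℂ) ^ z = Complex.exp (Real.log p * z) := by
  rw [Complex.cpow_def_of_ne_zero (by exact_mod_cast hp.ne'), Complex.ofReal_log hp.le]

theorem fourier_sechKer (ξ : ℝ) :
    ∫ t : ℝ, (sechKer t : ℂ) * Complex.exp (Complex.I * (ξ : ℂ) * (t : ℂ)) =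
      π / Complex.cosh (π * ξ) := by
  set u : ℂ := 1 / 2 + Complex.I * ξ with hu
  set v : ℂ := 1 / 2 - Complex.I * ξ with hv
  have hure : 0 < u.re := by simp [hu]
  have hvre : 0 < v.re := by simp [hv]
  have huv : v = 1 - u := by rw [hu, hv]; ring
  have hB := Complex.Gamma_mul_Gamma_eq_betaIntegral hure hvre
  rw [huv, Complex.Gamma_mul_Gamma_one_sub, ← huv, show u + v = 1 by rw [huv]; ring,
    Complex.Gamma_one, one_mul] at hB
  have hsin : Complex.sin (π * u) = Complex.cosh (π * ξ) := by
    rw [hu, show (π : ℂ) * (1 / 2 + Complex.I * ξ) = (π * ξ * Complex.I) + π / 2 by ring,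
      Complex.sin_add_pi_div_two, Complex.cos_mul_I]
  rw [← hsin, hB, Complex.betaIntegral, intervalIntegral.integral_of_le zero_le_one,
    integral_Ioc_eq_integral_Ioo, ← range_sigmoid, ← image_univ,
    integral_image_eq_integral_abs_deriv_smul MeasurableSet.univ
      (fun t _ => (hasDerivAt_sigmoid t).hasDerivWithinAt) sigmoid_injective.injOn,
    Measure.restrict_univ]
  refine integral_congr_ae (ae_of_all _ fun t => ?_)
  have hσ := sigmoid_pos t
  have hσ1 : 0 < 1 - sigmoid t := by linarith [sigmoid_lt_one t]
  have hk := sechKer_pos t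
  have hne : (sigmoid t : ℂ) ≠ 0 := by exact_mod_cast hσ.ne'
  have hne1 : ((1 - sigmoid t : ℝ) : ℂ) ≠ 0 := by exact_mod_cast hσ1.ne'
  simp only
  rw [abs_of_pos (mul_pos hσ hσ1), Complex.real_smul, Complex.ofReal_mul,
    show (1 : ℂ) - (sigmoid t : ℂ) = ((1 - sigmoid t : ℝ) : ℂ) by push_cast; ring,
    Complex.cpow_sub _ _ hne, Complex.cpow_sub _ _ hne1, Complex.cpow_one, Complex.cpow_one]
  have hlog1 : Real.log (sigmoid t) = t / 2 + Real.log (sechKer t) := by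
    rw [sigmoid_eq, Real.log_mul (Real.exp_ne_zero _) hk.ne', Real.log_exp]
  have hlog2 : Real.log (1 - sigmoid t) = -t / 2 + Real.log (sechKer t) := by
    rw [one_sub_sigmoid_eq, Real.log_mul (Real.exp_ne_zero _) hk.ne', Real.log_exp]
  have hprod : (sigmoid t : ℂ) ^ u * ((1 - sigmoid t : ℝ) : ℂ) ^ v =
      (sechKer t : ℂ) * Complex.exp (Complex.I * (ξ : ℂ) * (t : ℂ)) := by
    have hke : (sechKer t : ℂ) = Complex.exp (Real.log (sechKer t)) := by
      rw [← Complex.ofReal_exp, Real.exp_log hk]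
    rw [ofReal_cpow_eq hσ, ofReal_cpow_eq hσ1, hlog1, hlog2, ← Complex.exp_add]
    conv_rhs => rw [hke]
    rw [← Complex.exp_add]
    congr 1
    rw [hu, hv]
    push_cast
    ring
  rw [← hprod]
  field_simp

theorem cosh_pi_mul_ne_zero (ξ : ℝ) : Complex.cosh (π * ξ) ≠ 0 := by
  rw [← Complex.ofReal_mul, ← Complex.ofReal_cosh]
  exact_mod_cast (Real.cosh_pos _).ne'

theorem fourier_mul_sechKer (ξ : ℝ) :
    ∫ t : ℝ, ((t * sechKer t : ℝ) : ℂ) * Complex.exp (Complex.I * (ξ : ℂ) * (t : ℂ)) =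
      Complex.I * π * (Real.tanh (π * ξ) : ℂ) * (π / Complex.cosh (π * ξ)) := by
  have hd := (hasDerivAt_integral_of_dominated_loc_of_deriv_le (μ := (volume : Measure ℝ))
    (F := fun (ξ : ℝ) (t : ℝ) => (sechKer t : ℂ) * Complex.exp (Complex.I * (ξ : ℂ) * (t : ℂ)))
    (F' := fun (ξ : ℝ) (t : ℝ) => Complex.I * (((t * sechKer t : ℝ) : ℂ) *
      Complex.exp (Complex.I * (ξ : ℂ) * (t : ℂ)))) (x₀ := ξ) (s := univ)
    (bound := fun t => ‖((t * sechKer t : ℝ) : ℂ)‖) univ_mem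
    (Eventually.of_forall fun ξ => ((Complex.measurable_ofReal.comp measurable_sechKer).mul
      (by fun_prop)).aestronglyMeasurable)
    (by
      refine integrable_sechKer.1.norm.mono' ((Complex.measurable_ofReal.comp
        measurable_sechKer).mul (by fun_prop)).aestronglyMeasurable (ae_of_all _ fun t => ?_)
      rw [norm_mul, norm_exp_I_mul]; simp)
    (measurable_const.mul ((Complex.measurable_ofReal.comp
      (measurable_id.mul measurable_sechKer)).mul (by fun_prop))).aestronglyMeasurable
    (ae_of_all _ fun t x _ => by
      rw [norm_mul, norm_mul, norm_exp_I_mul]; simp)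
    integrable_mul_sechKer.1.norm
    (ae_of_all _ fun t x _ => by
      have h1 : HasDerivAt (fun x : ℝ => Complex.I * (x : ℂ) * (t : ℂ)) (Complex.I * t) x := by
        simpa using ((hasDerivAt_id x).ofReal_comp.const_mul Complex.I).mul_const (t : ℂ)
      have h2 := (h1.cexp).const_mul (sechKer t : ℂ)
      refine h2.congr_deriv ?_
      push_cast; ring)).2
  have hfun : (fun ξ : ℝ => ∫ t : ℝ, (sechKer t : ℂ) *
      Complex.exp (Complex.I * (ξ : ℂ) * (t : ℂ))) =
      fun ξ : ℝ => (π : ℂ) / Complex.cosh (π * ξ) := funext fourier_sechKer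
  rw [hfun] at hd
  have hd2 : HasDerivAt (fun ξ : ℝ => (π : ℂ) / Complex.cosh (π * ξ))
      (-(π * (Complex.sinh (π * ξ) * π)) / Complex.cosh (π * ξ) ^ 2) ξ := by
    have h1 : HasDerivAt (fun x : ℝ => (π : ℂ) * x) π ξ := by
      simpa using (hasDerivAt_id ξ).ofReal_comp.const_mul (π : ℂ)
    have hc : HasDerivAt (fun ξ : ℝ => Complex.cosh (π * ξ)) (Complex.sinh (π * ξ) * π) ξ := by
      have := (Complex.hasDerivAt_cosh (π * ξ)).comp ξ h1
      exact this
    have h2 := (hasDerivAt_const ξ (π : ℂ)).fun_div hc (cosh_pi_mul_ne_zero ξ)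
    rwa [zero_mul, zero_sub] at h2
  have heq := hd.unique hd2
  rw [integral_const_mul] at heq
  have ht : (Real.tanh (π * ξ) : ℂ) = Complex.sinh (π * ξ) / Complex.cosh (π * ξ) := by
    rw [Complex.ofReal_tanh, Complex.tanh_eq_sinh_div_cosh]; push_cast; rfl
  have hc := cosh_pi_mul_ne_zero ξ
  have h3 := congrArg (fun z => -Complex.I * z) heq
  simp only [← mul_assoc] at h3
  rw [neg_mul, Complex.I_mul_I, neg_neg, one_mul] at h3
  rw [h3, ht]
  field_simp

theorem fourierInt_comp_sub (f : ℝ → ℂ) (s ξ : ℝ) :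
    fourierInt (fun t => f (t - s)) ξ = Complex.exp (Complex.I * ξ * s) * fourierInt f ξ := by
  rw [fourierInt, fourierInt, ← integral_add_right_eq_self _ s, mul_left_comm,
    ← integral_const_mul (Complex.exp (Complex.I * ξ * s))]
  congr 2
  ext t
  rw [add_sub_cancel_right, mul_left_comm, ← Complex.exp_add]
  congr 2
  push_cast
  ring

theorem memLp_sechShift (s : ℝ) : MemLp (fun t => (sechKer (t - s) : ℂ)) 2 :=
  integrable_sechKer.2.comp_measurePreserving (measurePreserving_sub_right volume s)

theorem memLp_mulSechShift (s : ℝ) :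
    MemLp (fun t : ℝ => (((t - s) * sechKer (t - s) : ℝ) : ℂ)) 2 :=
  integrable_mul_sechKer.2.comp_measurePreserving (measurePreserving_sub_right volume s)

theorem coeFn_unitaryFourier_sechShift (s : ℝ) :
    unitaryFourier (memLp_sechShift s).toLp =ᵐ[volume] fun ξ : ℝ =>
      Complex.exp (Complex.I * ξ * s) * (1 / (√(2 * π) : ℂ) * (π / Complex.cosh (π * ξ))) := by
  filter_upwards [coeFn_unitaryFourier (integrable_sechKer.1.comp_sub_right s)
    (memLp_sechShift s)] with ξ hξ
  rw [hξ, fourierInt_comp_sub (fun t => (sechKer t : ℂ)), fourierInt, fourier_sechKer]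

theorem coeFn_unitaryFourier_mulSechShift (s : ℝ) :
    unitaryFourier (memLp_mulSechShift s).toLp =ᵐ[volume] fun ξ : ℝ =>
      Complex.exp (Complex.I * ξ * s) * (1 / (√(2 * π) : ℂ) *
        (Complex.I * π * (Real.tanh (π * ξ) : ℂ) * (π / Complex.cosh (π * ξ)))) := by
  filter_upwards [coeFn_unitaryFourier (integrable_mul_sechKer.1.comp_sub_right s)
    (memLp_mulSechShift s)] with ξ hξ
  rw [hξ, fourierInt_comp_sub (fun t : ℝ => ((t * sechKer t : ℝ) : ℂ)), fourierInt,
    fourier_mul_sechKer]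

theorem measurable_tanh : Measurable fun x : ℝ => (Real.tanh (π * x) : ℂ) := by
  refine Complex.measurable_ofReal.comp ?_
  simp_rw [Real.tanh_eq_sinh_div_cosh]
  exact (Real.continuous_sinh.measurable.comp (measurable_const_mul π)).div
    (Real.continuous_cosh.measurable.comp (measurable_const_mul π))

theorem norm_tanh_le (x : ℝ) : ‖(Real.tanh (π * x) : ℂ)‖ ≤ 1 := by
  rw [Complex.norm_real]
  exact (abs_tanh_lt_one _).le

/-- Multiplication by `tanh (πx)`. -/
noncomputable def tanhOp : Lp ℂ 2 (volume : Measure ℝ) →L[ℂ] Lp ℂ 2 (volume : Measure ℝ) :=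
  mulOp measurable_tanh norm_tanh_le

theorem coeFn_tanhOp (f : Lp ℂ 2 (volume : Measure ℝ)) :
    tanhOp f =ᵐ[volume] fun t => (Real.tanh (π * t) : ℂ) * f t :=
  coeFn_mulOp _ _ f

theorem unitaryFourier_mulSechShift (s : ℝ) :
    unitaryFourier (memLp_mulSechShift s).toLp =
      (Complex.I * π) • tanhOp (unitaryFourier (memLp_sechShift s).toLp) := by
  apply Lp.ext
  filter_upwards [coeFn_unitaryFourier_mulSechShift s, coeFn_unitaryFourier_sechShift s,
    Lp.coeFn_smul (Complex.I * π) (tanhOp (unitaryFourier (memLp_sechShift s).toLp)),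
    coeFn_tanhOp (unitaryFourier (memLp_sechShift s).toLp)] with ξ h1 h2 h3 h4
  rw [h1, h3, Pi.smul_apply, h4, h2, smul_eq_mul]
  ring

/-- The translates of `1 / (2 cosh (t / 2))` are total in `L₂(ℝ)`. -/
theorem dense_span_sechShift :
    Dense (Submodule.span ℂ (range fun s : ℝ => (memLp_sechShift s).toLp) :
      Set (Lp ℂ 2 (volume : Measure ℝ))) := by
  rw [Submodule.dense_iff_topologicalClosure_eq_top, Submodule.topologicalClosure_eq_top_iff,
    Submodule.eq_bot_iff]
  intro v hv
  rw [Submodule.mem_orthogonal] at hv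
  set g := unitaryFourier v with hg
  set q : ℝ → ℂ := fun ξ => ((Real.cosh (π * ξ))⁻¹ : ℝ) with hq
  have hcosh : ∀ ξ : ℝ, (Real.cosh (π * ξ))⁻¹ = 2 * sechKer (2 * π * ξ) := fun ξ => by
    rw [sechKer, Real.cosh_eq, show 2 * π * ξ / 2 = π * ξ by ring,
      show -(2 * π * ξ) / 2 = -(π * ξ) by ring]
    field_simp
  have hqm : Measurable q := by
    simp only [hq, hcosh]
    exact Complex.measurable_ofReal.comp
      ((measurable_sechKer.comp (measurable_const_mul _)).const_mul 2)
  have hq2 : MemLp q 2 := (integrable_of_exp_bound (c := π) (C := 2) hqm pi_pos fun ξ => by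
    rw [hq]
    simp only
    rw [hcosh, Complex.norm_real, norm_mul, norm_of_nonneg (sechKer_pos _).le, norm_ofNat]
    gcongr
    refine (sechKer_le _).trans (le_of_eq ?_)
    rw [abs_mul, abs_of_pos (by positivity : 0 < 2 * π)]
    congr 1; ring).2
  have h1 : Integrable fun ξ => g ξ * q ξ := (Lp.memLp g).integrable_mul hq2
  have h2 : MemLp (fun ξ => g ξ * q ξ) 2 := by
    refine MemLp.of_le (Lp.memLp g) h1.aestronglyMeasurable (ae_of_all _ fun t => ?_)
    rw [norm_mul]
    refine mul_le_of_le_one_right (norm_nonneg _) ?_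
    rw [hq]
    simp only
    rw [Complex.norm_real, norm_of_nonneg (by positivity)]
    exact inv_le_one_of_one_le₀ (Real.one_le_cosh _)
  have h3 := ae_eq_zero_of_fourierInt_eq_zero h1 h2 fun x => by
    have h4 := hv _ (Submodule.subset_span ⟨-x, rfl⟩)
    rw [← LinearIsometryEquiv.inner_map_map unitaryFourier, L2.inner_def] at h4
    have h5 : ∫ ξ, inner ℂ (unitaryFourier (memLp_sechShift (-x)).toLp ξ) (unitaryFourier v ξ) =
        (1 / (√(2 * π) : ℂ) * π) *
          ∫ ξ : ℝ, g ξ * q ξ * Complex.exp (Complex.I * (x : ℂ) * (ξ : ℂ)) := by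
      rw [← integral_const_mul]
      refine integral_congr_ae ?_
      filter_upwards [coeFn_unitaryFourier_sechShift (-x)] with ξ h6
      rw [h6, RCLike.inner_apply, ← hg]
      have h7 : (π : ℂ) / Complex.cosh (π * ξ) = ((π : ℝ) : ℂ) * q ξ := by
        rw [hq]; push_cast; rfl
      have h8 : (starRingEnd ℂ) (q ξ) = q ξ := Complex.conj_ofReal _
      rw [h7]
      simp only [map_mul, map_div₀, map_one, Complex.conj_ofReal, h8, ← Complex.exp_conj,
        Complex.conj_I]
      rw [show -Complex.I * (ξ : ℂ) * ((-x : ℝ) : ℂ) = Complex.I * x * ξ by push_cast; ring]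
      ring
    rw [h5, mul_eq_zero] at h4
    refine h4.resolve_left (mul_ne_zero (one_div_ne_zero sqrt_two_pi_ne_zero) ?_)
    exact_mod_cast pi_ne_zero
  have h9 : g = 0 := by
    apply Lp.ext
    filter_upwards [h3, Lp.coeFn_zero ℂ 2 (volume : Measure ℝ)] with ξ h4 h5
    rw [h5]
    refine (mul_eq_zero.1 h4).resolve_right ?_
    simp only [hq]
    exact_mod_cast (inv_pos.2 (Real.cosh_pos _)).ne'
  exact unitaryFourier.map_eq_zero_iff.1 h9

end Sech

section ExpChange

open Real

theorem norm_exp_half_sq (a : ℝ) : ‖((rexp (a / 2) : ℝ) : ℂ)‖ ^ 2 = rexp a := by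
  rw [Complex.norm_real, norm_of_nonneg (Real.exp_pos _).le, ← Real.exp_nat_mul]
  congr 1
  push_cast
  ring

theorem isWeightedContraction_exp {s s' : Set ℝ} (hs : MeasurableSet s)
    (himg : (fun t => rexp (-t)) '' s = s') :
    IsWeightedContraction (volume.restrict s') (volume.restrict s)
      (fun t => ((rexp (-t / 2) : ℝ) : ℂ)) (fun t => rexp (-t)) := by
  subst himg
  refine IsWeightedContraction.of_deriv (θ' := fun t => -rexp (-t)) hs (by fun_prop) (by fun_prop)
    (fun t _ => ?_) (fun a _ b _ h => by simpa using h) (fun t _ => ?_)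
  · simpa using (hasDerivAt_neg t).exp.hasDerivWithinAt
  · rw [norm_exp_half_sq, abs_neg, abs_of_pos (Real.exp_pos _)]

theorem isWeightedContraction_log {s s' : Set ℝ} (hs' : MeasurableSet s') (hpos : s' ⊆ Ioi 0)
    (himg : (fun x => -Real.log x) '' s' = s) :
    IsWeightedContraction (volume.restrict s) (volume.restrict s')
      (fun x => ((rexp (-Real.log x / 2) : ℝ) : ℂ)) (fun x => -Real.log x) := by
  subst himg
  refine IsWeightedContraction.of_deriv (θ' := fun x => -x⁻¹) hs' (by fun_prop) (by fun_prop)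
    (fun x hx => ?_) (fun a ha b hb h => ?_) (fun x hx => ?_)
  · exact ((Real.hasDerivAt_log (ne_of_gt (hpos hx))).neg).hasDerivWithinAt
  · exact Real.log_injOn_pos (hpos ha) (hpos hb) (by simpa using h)
  · have hx : 0 < x := hpos hx
    rw [norm_exp_half_sq, abs_neg, abs_of_pos (inv_pos.2 hx), Real.exp_neg, Real.exp_log hx]

theorem log_exp_weight (t : ℝ) : -Real.log (rexp (-t)) = t ∧
    ((rexp (-t / 2) : ℝ) : ℂ) * ((rexp (-Real.log (rexp (-t)) / 2) : ℝ) : ℂ) = 1 := by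
  refine ⟨by simp, ?_⟩
  rw [← Complex.ofReal_mul, ← Real.exp_add, Real.log_exp,
    show -t / 2 + - -t / 2 = 0 by ring]
  simp

theorem exp_log_weight {x : ℝ} (hx : 0 < x) : rexp (-(-Real.log x)) = x ∧
    ((rexp (-Real.log x / 2) : ℝ) : ℂ) * ((rexp (-(-Real.log x) / 2) : ℝ) : ℂ) = 1 := by
  refine ⟨by rw [neg_neg, Real.exp_log hx], ?_⟩
  rw [← Complex.ofReal_mul, ← Real.exp_add,
    show -Real.log x / 2 + -(-Real.log x) / 2 = 0 by ring]
  simp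

theorem exp_image_univ : (fun t => rexp (-t)) '' univ = Ioi 0 := by
  ext x
  simp only [image_univ, mem_range, mem_Ioi]
  exact ⟨fun ⟨t, ht⟩ => ht ▸ Real.exp_pos _, fun hx => ⟨-Real.log x, by simp [Real.exp_log hx]⟩⟩

theorem log_image_Ioi : (fun x => -Real.log x) '' Ioi 0 = univ := by
  ext t
  simp only [mem_image, mem_Ioi, mem_univ, iff_true]
  exact ⟨rexp (-t), Real.exp_pos _, by simp⟩

theorem exp_image_Ioi : (fun t => rexp (-t)) '' Ioi 0 = Ioo 0 1 := by
  ext x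
  simp only [mem_image, mem_Ioi, mem_Ioo]
  constructor
  · rintro ⟨t, ht, rfl⟩
    exact ⟨Real.exp_pos _, by simpa using ht⟩
  · rintro ⟨h0, h1⟩
    exact ⟨-Real.log x, neg_pos.2 (Real.log_neg h0 h1), by simp [Real.exp_log h0]⟩

theorem log_image_Ioo : (fun x => -Real.log x) '' Ioo 0 1 = Ioi 0 := by
  ext t
  simp only [mem_image, mem_Ioi, mem_Ioo]
  constructor
  · rintro ⟨x, ⟨h0, h1⟩, rfl⟩
    exact neg_pos.2 (Real.log_neg h0 h1)
  · intro ht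
    exact ⟨rexp (-t), ⟨Real.exp_pos _, by simpa using ht⟩, by simp⟩

theorem isWeightedContraction_exp_line :
    IsWeightedContraction (volume.restrict (Ioi 0)) volume
      (fun t => ((rexp (-t / 2) : ℝ) : ℂ)) (fun t => rexp (-t)) := by
  simpa only [Measure.restrict_univ] using isWeightedContraction_exp MeasurableSet.univ exp_image_univ

theorem isWeightedContraction_log_line :
    IsWeightedContraction volume (volume.restrict (Ioi 0))
      (fun x => ((rexp (-Real.log x / 2) : ℝ) : ℂ)) (fun x => -Real.log x) := by
  simpa only [Measure.restrict_univ] using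
    isWeightedContraction_log measurableSet_Ioi subset_rfl log_image_Ioi

theorem isWeightedContraction_exp_unit :
    IsWeightedContraction (volume.restrict (Icc 0 1)) (volume.restrict (Ioi 0))
      (fun t => ((rexp (-t / 2) : ℝ) : ℂ)) (fun t => rexp (-t)) := by
  rw [← restrict_Ioo_eq_restrict_Icc]
  exact isWeightedContraction_exp measurableSet_Ioi exp_image_Ioi

theorem isWeightedContraction_log_unit :
    IsWeightedContraction (volume.restrict (Ioi 0)) (volume.restrict (Icc 0 1))
      (fun x => ((rexp (-Real.log x / 2) : ℝ) : ℂ)) (fun x => -Real.log x) := by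
  rw [← restrict_Ioo_eq_restrict_Icc]
  exact isWeightedContraction_log measurableSet_Ioo Ioo_subset_Ioi_self log_image_Ioo

/-- The isometric isomorphism `φ ↦ exp(-t/2) φ(exp(-t))` of `L₂(ℝ⁺)` onto `L₂(ℝ)`. -/
noncomputable def expChangeLine :
    Lp ℂ 2 ((volume : Measure ℝ).restrict (Ioi 0)) ≃ₗᵢ[ℂ] Lp ℂ 2 (volume : Measure ℝ) :=
  isWeightedContraction_exp_line.toEquiv isWeightedContraction_log_line
    ((ae_restrict_iff' measurableSet_Ioi).2 (ae_of_all _ fun _ hx => exp_log_weight hx))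
    (ae_of_all _ log_exp_weight)

/-- The isometric isomorphism `φ ↦ exp(-t/2) φ(exp(-t))` of `L₂([0,1])` onto `L₂(ℝ⁺)`. -/
noncomputable def expChangeUnit :
    Lp ℂ 2 ((volume : Measure ℝ).restrict (Icc 0 1)) ≃ₗᵢ[ℂ]
      Lp ℂ 2 ((volume : Measure ℝ).restrict (Ioi 0)) :=
  isWeightedContraction_exp_unit.toEquiv isWeightedContraction_log_unit
    (by
      rw [← restrict_Ioo_eq_restrict_Icc]
      exact (ae_restrict_iff' measurableSet_Ioo).2
        (ae_of_all _ fun _ hx => exp_log_weight hx.1))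
    (ae_of_all _ log_exp_weight)

theorem coeFn_expChangeLine (f : Lp ℂ 2 ((volume : Measure ℝ).restrict (Ioi 0))) :
    expChangeLine f =ᵐ[volume] fun t => ((rexp (-t / 2) : ℝ) : ℂ) * f (rexp (-t)) :=
  IsWeightedContraction.coeFn_toEquiv _ _ _ _ f

theorem coeFn_expChangeLine_symm (f : Lp ℂ 2 (volume : Measure ℝ)) :
    expChangeLine.symm f =ᵐ[volume.restrict (Ioi 0)]
      fun x => ((rexp (-Real.log x / 2) : ℝ) : ℂ) * f (-Real.log x) :=
  IsWeightedContraction.coeFn_toEquiv_symm _ _ _ _ f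

theorem coeFn_expChangeUnit (f : Lp ℂ 2 ((volume : Measure ℝ).restrict (Icc 0 1))) :
    expChangeUnit f =ᵐ[volume.restrict (Ioi 0)]
      fun t => ((rexp (-t / 2) : ℝ) : ℂ) * f (rexp (-t)) :=
  IsWeightedContraction.coeFn_toEquiv _ _ _ _ f

end ExpChange

section HalfLine

open Real

theorem integral_truncated_cauchy {x w ε : ℝ} (hx : 0 < x) (hw : 0 < w) (hε : 0 < ε) (hεx : ε < x) :
    ∫ t in {t : ℝ | ε < |t - x|}, 1 / ((t + w) * (t - x)) ∂(volume.restrict (Ioi 0)) =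
      (Real.log w - Real.log x + Real.log (x + ε + w) - Real.log (x - ε + w)) / (x + w) := by
  set G : ℝ → ℝ := fun t => (Real.log (t - x) - Real.log (t + w)) / (x + w) with hG
  have hd : ∀ t, t - x ≠ 0 → t + w ≠ 0 → HasDerivAt G (1 / ((t + w) * (t - x))) t := by
    intro t h1 h2
    have h3 := ((((hasDerivAt_id t).sub_const x).log h1).sub
      (((hasDerivAt_id t).add_const w).log h2)).div_const (x + w)
    refine h3.congr_deriv ?_
    have : x + w ≠ 0 := by positivity
    simp only [id]
    field_simp
    ring
  have hset : {t : ℝ | ε < |t - x|} ∩ Ioi 0 = Ioo 0 (x - ε) ∪ Ioi (x + ε) := by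
    ext t
    simp only [mem_inter_iff, mem_ofPred_eq, mem_Ioi, mem_union, mem_Ioo, lt_abs]
    constructor
    · rintro ⟨h | h, h0⟩
      · right; linarith
      · left; constructor <;> linarith
    · rintro (⟨h0, h⟩ | h)
      · exact ⟨Or.inr (by linarith), h0⟩
      · exact ⟨Or.inl (by linarith), by linarith⟩
  have hm : MeasurableSet {t : ℝ | ε < |t - x|} := measurableSet_lt measurable_const (by fun_prop)
  have hdisj : Disjoint (Ioo 0 (x - ε)) (Ioi (x + ε)) := by
    rw [Set.disjoint_left]
    rintro t ⟨_, h1⟩ h2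
    have h2 : x + ε < t := h2
    linarith
  have hcont : ContinuousOn (fun t : ℝ => 1 / ((t + w) * (t - x))) (uIcc 0 (x - ε)) := by
    rw [uIcc_of_le (by linarith)]
    refine ContinuousOn.div (by fun_prop) (by fun_prop) fun t ht => ?_
    have h1 : t + w ≠ 0 := by linarith [ht.1]
    have h2 : t - x ≠ 0 := by linarith [ht.2]
    exact mul_ne_zero h1 h2
  have hi1 : IntegrableOn (fun t : ℝ => 1 / ((t + w) * (t - x))) (Ioo 0 (x - ε)) :=
    ((intervalIntegrable_iff_integrableOn_Ioo_of_le (by linarith)).1 hcont.intervalIntegrable)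
  have hder : ∀ t ∈ Ici (x + ε), HasDerivAt G (1 / ((t + w) * (t - x))) t := fun t ht => by
    have ht : x + ε ≤ t := ht
    exact hd t (by linarith) (by linarith)
  have hpos : ∀ t ∈ Ioi (x + ε), 0 ≤ 1 / ((t + w) * (t - x)) := fun t ht => by
    have ht : x + ε < t := ht
    have h1 : 0 < t + w := by linarith
    have h2 : 0 < t - x := by linarith
    positivity
  have hlim : Tendsto G atTop (𝓝 0) := by
    have h1 : Tendsto (fun t : ℝ => 1 - (x + w) / (t + w)) atTop (𝓝 (1 - 0)) :=
      tendsto_const_nhds.sub (tendsto_const_nhds.div_atTop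
        (tendsto_atTop_add_const_right _ _ tendsto_id))
    rw [sub_zero] at h1
    have h2 := (h1.log one_ne_zero).div_const (x + w)
    rw [Real.log_one, zero_div] at h2
    refine h2.congr' ?_
    filter_upwards [eventually_gt_atTop x] with t ht
    have h3 : 0 < t + w := by linarith
    have h4 : 0 < t - x := by linarith
    rw [hG]
    simp only
    rw [← Real.log_div h4.ne' h3.ne']
    congr 2
    field_simp
    ring
  have hi2 := integrableOn_Ioi_deriv_of_nonneg' hder hpos hlim
  rw [Measure.restrict_restrict hm, hset, setIntegral_union hdisj measurableSet_Ioi hi1 hi2,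
    integral_Ioi_of_hasDerivAt_of_nonneg' hder hpos hlim, ← integral_Ioc_eq_integral_Ioo,
    ← intervalIntegral.integral_of_le (by linarith),
    intervalIntegral.integral_eq_sub_of_hasDerivAt (f := G) (fun t ht => ?_)
      hcont.intervalIntegrable]
  · simp only [hG]
    rw [show x - ε - x = -ε by ring, show x + ε - x = ε by ring, zero_sub, zero_add,
      Real.log_neg_eq_log, Real.log_neg_eq_log]
    ring
  · rw [uIcc_of_le (by linarith)] at ht
    exact hd t (by linarith [ht.2]) (by linarith [ht.1])

theorem tendsto_truncated_cauchy {x w : ℝ} (hx : 0 < x) (hw : 0 < w) :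
    Tendsto (fun ε : ℝ => ∫ t in {t : ℝ | ε < |t - x|}, 1 / ((t + w) * (t - x))
      ∂(volume.restrict (Ioi 0))) (𝓝[>] 0) (𝓝 ((Real.log w - Real.log x) / (x + w))) := by
  have h1 : Tendsto (fun ε : ℝ => (Real.log w - Real.log x + Real.log (x + ε + w) -
      Real.log (x - ε + w)) / (x + w)) (𝓝 0) (𝓝 ((Real.log w - Real.log x) / (x + w))) := by
    have hc : ContinuousAt (fun ε : ℝ => (Real.log w - Real.log x + Real.log (x + ε + w) -
      Real.log (x - ε + w)) / (x + w)) 0 := by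
      refine ContinuousAt.div_const (ContinuousAt.sub (continuousAt_const.add
        (ContinuousAt.log (by fun_prop) ?_)) (ContinuousAt.log (by fun_prop) ?_)) _
      · simp; positivity
      · simp; positivity
    have := hc.tendsto
    simpa using this
  refine (h1.mono_left nhdsWithin_le_nhds).congr' ?_
  filter_upwards [Ioo_mem_nhdsGT hx] with ε hε
  exact (integral_truncated_cauchy hx hw hε.1 hε.2).symm

theorem exp_mul_sechKer {x s : ℝ} (hx : 0 < x) :
    rexp (-Real.log x / 2) * sechKer (-Real.log x - s) = rexp (-s / 2) / (x + rexp (-s)) := by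
  rw [sechKer, ← div_eq_mul_inv, div_eq_div_iff (by positivity) (by positivity)]
  conv_lhs => rw [← Real.exp_log hx]
  rw [Real.log_exp, mul_add, mul_add, ← Real.exp_add, ← Real.exp_add, ← Real.exp_add,
    ← Real.exp_add, add_comm]
  congr 2 <;> ring

theorem coeFn_expChangeLine_symm_sechShift (s : ℝ) :
    expChangeLine.symm (memLp_sechShift s).toLp =ᵐ[volume.restrict (Ioi 0)]
      fun x => ((rexp (-s / 2) / (x + rexp (-s)) : ℝ) : ℂ) := by
  filter_upwards [coeFn_expChangeLine_symm (memLp_sechShift s).toLp,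
    isWeightedContraction_log_line.ae_imp (memLp_sechShift s).coeFn_toLp,
    ae_restrict_mem measurableSet_Ioi] with x h1 h2 h3
  rw [h1, h2 (by exact_mod_cast (Real.exp_pos _).ne'), ← exp_mul_sechKer h3]
  push_cast
  rfl

theorem coeFn_expChangeLine_symm_mulSechShift (s : ℝ) :
    expChangeLine.symm (memLp_mulSechShift s).toLp =ᵐ[volume.restrict (Ioi 0)]
      fun x => (((-Real.log x - s) * (rexp (-s / 2) / (x + rexp (-s))) : ℝ) : ℂ) := by
  filter_upwards [coeFn_expChangeLine_symm (memLp_mulSechShift s).toLp,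
    isWeightedContraction_log_line.ae_imp (memLp_mulSechShift s).coeFn_toLp,
    ae_restrict_mem measurableSet_Ioi] with x h1 h2 h3
  rw [h1, h2 (by exact_mod_cast (Real.exp_pos _).ne'), ← exp_mul_sechKer h3]
  push_cast
  ring

theorem hilbertOpOn_sechShift (s : ℝ) :
    hilbertOpOn measurableSet_Ioi (expChangeLine.symm (memLp_sechShift s).toLp) =
      (1 / ((π : ℂ) * Complex.I)) • expChangeLine.symm (memLp_mulSechShift s).toLp := by
  apply Lp.ext
  filter_upwards [isSingularIntegralOperator_hilbertOpOn measurableSet_Ioi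
      (expChangeLine.symm (memLp_sechShift s).toLp),
    coeFn_expChangeLine_symm_mulSechShift s, ae_restrict_mem measurableSet_Ioi,
    Lp.coeFn_smul (1 / ((π : ℂ) * Complex.I)) (expChangeLine.symm (memLp_mulSechShift s).toLp)]
    with x h1 h2 h3 h4
  have h3 : 0 < x := h3
  rw [h4, Pi.smul_apply, h2, smul_eq_mul]
  refine tendsto_nhds_unique h1 (Tendsto.const_mul _ ?_)
  have h5 := ((Complex.continuous_ofReal.tendsto _).comp
    (tendsto_truncated_cauchy h3 (Real.exp_pos (-s)))).const_mul ((rexp (-s / 2) : ℝ) : ℂ)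
  rw [Real.log_exp] at h5
  have h6 : ((rexp (-s / 2) : ℝ) : ℂ) * (((-s - Real.log x) / (x + rexp (-s)) : ℝ) : ℂ) =
      (((-Real.log x - s) * (rexp (-s / 2) / (x + rexp (-s))) : ℝ) : ℂ) := by
    rw [← Complex.ofReal_mul]
    congr 1
    ring
  rw [h6] at h5
  refine h5.congr fun ε => ?_
  simp only [Function.comp_apply]
  rw [← integral_complex_ofReal, ← integral_const_mul]
  refine integral_congr_ae ?_
  filter_upwards [ae_restrict_of_ae (coeFn_expChangeLine_symm_sechShift s)] with t ht
  rw [ht]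
  push_cast
  rw [div_div, mul_one_div]

/-- The exponential change of variables diagonalizes the singular integral operator of the
half-line. -/
theorem unitaryFourier_expChangeLine_hilbertOpOn
    (f : Lp ℂ 2 ((volume : Measure ℝ).restrict (Ioi 0))) :
    unitaryFourier (expChangeLine (hilbertOpOn measurableSet_Ioi f)) =
      tanhOp (unitaryFourier (expChangeLine f)) := by
  have h : (unitaryFourier.toContinuousLinearEquiv : Lp ℂ 2 (volume : Measure ℝ) →L[ℂ] Lp ℂ 2 (volume : Measure ℝ)) ∘L
      (expChangeLine.toContinuousLinearEquiv :
        Lp ℂ 2 ((volume : Measure ℝ).restrict (Ioi 0)) →L[ℂ] Lp ℂ 2 (volume : Measure ℝ)) ∘L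
      hilbertOpOn measurableSet_Ioi ∘L
      (expChangeLine.symm.toContinuousLinearEquiv :
        Lp ℂ 2 (volume : Measure ℝ) →L[ℂ] Lp ℂ 2 ((volume : Measure ℝ).restrict (Ioi 0))) =
      tanhOp ∘L (unitaryFourier.toContinuousLinearEquiv : Lp ℂ 2 (volume : Measure ℝ) →L[ℂ] Lp ℂ 2 (volume : Measure ℝ)) := by
    refine ContinuousLinearMap.ext_on dense_span_sechShift ?_
    rintro _ ⟨s, rfl⟩
    change unitaryFourier (expChangeLine (hilbertOpOn measurableSet_Ioi
      (expChangeLine.symm (memLp_sechShift s).toLp))) =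
      tanhOp (unitaryFourier (memLp_sechShift s).toLp)
    rw [hilbertOpOn_sechShift, map_smul, LinearIsometryEquiv.apply_symm_apply, map_smul,
      unitaryFourier_mulSechShift, smul_smul]
    have h1 : (π : ℂ) ≠ 0 := by exact_mod_cast pi_ne_zero
    rw [show 1 / ((π : ℂ) * Complex.I) * (Complex.I * π) = 1 by
      have := Complex.I_ne_zero; field_simp, one_smul]
  have h2 := congrArg (fun T : Lp ℂ 2 (volume : Measure ℝ) →L[ℂ] Lp ℂ 2 (volume : Measure ℝ) =>
    T (expChangeLine f)) h
  simp only [ContinuousLinearMap.comp_apply] at h2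
  change unitaryFourier (expChangeLine (hilbertOpOn measurableSet_Ioi
    (expChangeLine.symm (expChangeLine f)))) = tanhOp (unitaryFourier (expChangeLine f)) at h2
  rwa [LinearIsometryEquiv.symm_apply_apply] at h2

end HalfLine

section Toeplitz

open Real

/-- `P⁺ = (I + S) / 2` is the projection onto the Fourier transforms of functions supported on
the positive half-line. -/
theorem half_add_hilbertOp (h : Lp ℂ 2 (volume : Measure ℝ)) :
    (1 / 2 : ℂ) • (h + hilbertOp h) = unitaryFourier
      (extendZero measurableSet_Ioi (restrictTo (Ioi 0) (unitaryFourier.symm h))) := by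
  set g := unitaryFourier.symm h with hg
  have h1 : h = unitaryFourier g := (LinearIsometryEquiv.apply_symm_apply _ _).symm
  rw [hilbertOp_apply, ← hg, h1, ← map_add, ← map_smul]
  congr 1
  apply Lp.ext
  filter_upwards [Lp.coeFn_smul (1 / 2 : ℂ) (g + signOp g), Lp.coeFn_add g (signOp g),
    coeFn_signOp g, coeFn_extendZero_restrictTo measurableSet_Ioi g,
    compl_mem_ae_iff.2 (measure_singleton (0 : ℝ))] with t h2 h3 h4 h5 h6
  have h6 : t ≠ 0 := h6
  rw [h2, Pi.smul_apply, h3, Pi.add_apply, h4, h5, smul_eq_mul]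
  rcases lt_or_gt_of_ne h6 with h | h
  · simp [Real.sign_of_neg h, h.le]
  · have : t ∈ Ioi (0 : ℝ) := h
    rw [Real.sign_of_pos h, indicator_of_mem this]
    push_cast
    ring

/-- The operator on the Hardy space that corresponds to an operator on `L₂(ℝ⁺)`. -/
noncomputable def hardyConj (A : Lp ℂ 2 ((volume : Measure ℝ).restrict (Ioi 0)) →L[ℂ]
    Lp ℂ 2 ((volume : Measure ℝ).restrict (Ioi 0))) : hardySpace →L[ℂ] hardySpace :=
  (hardyFourier.toContinuousLinearEquiv :
    Lp ℂ 2 ((volume : Measure ℝ).restrict (Ioi 0)) →L[ℂ] hardySpace) ∘L A ∘L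
    (hardyFourier.symm.toContinuousLinearEquiv :
      hardySpace →L[ℂ] Lp ℂ 2 ((volume : Measure ℝ).restrict (Ioi 0)))

theorem hardyConj_hardyFourier (A : Lp ℂ 2 ((volume : Measure ℝ).restrict (Ioi 0)) →L[ℂ]
    Lp ℂ 2 ((volume : Measure ℝ).restrict (Ioi 0)))
    (f : Lp ℂ 2 ((volume : Measure ℝ).restrict (Ioi 0))) :
    hardyConj A (hardyFourier f) = hardyFourier (A f) := by
  change hardyFourier (A (hardyFourier.symm (hardyFourier f))) = _
  rw [LinearIsometryEquiv.symm_apply_apply]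

theorem isToeplitzOperator_hardyConj {g : ℝ → ℂ}
    {A : Lp ℂ 2 ((volume : Measure ℝ).restrict (Ioi 0)) →L[ℂ]
      Lp ℂ 2 ((volume : Measure ℝ).restrict (Ioi 0))}
    {M : Lp ℂ 2 (volume : Measure ℝ) → Lp ℂ 2 (volume : Measure ℝ)}
    (hM : ∀ f, M f =ᵐ[volume] fun x => g x * f x)
    (hA : ∀ f, A f = restrictTo (Ioi 0) (unitaryFourier.symm
      (M (unitaryFourier (extendZero measurableSet_Ioi f))))) :
    IsToeplitzOperator g (hardyConj A) := by
  refine ⟨hilbertOp, isSingularIntegralOperator_hilbertOp, fun f => ?_⟩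
  obtain ⟨φ, rfl⟩ := hardyFourier.surjective f
  refine ⟨M (hardyFourier φ), hM _, ?_⟩
  rw [hardyConj_hardyFourier, coe_hardyFourier, coe_hardyFourier, half_add_hilbertOp, hA]

theorem hilbertOpOn_Ioi_eq (z : ℂ) (f : Lp ℂ 2 ((volume : Measure ℝ).restrict (Ioi 0))) :
    hilbertOpOn measurableSet_Ioi f - z • f = restrictTo (Ioi 0) (unitaryFourier.symm
      (-(signOp (unitaryFourier (extendZero measurableSet_Ioi f)) +
        z • unitaryFourier (extendZero measurableSet_Ioi f)))) := by
  rw [neg_add', ← unitaryFourier_hilbertOp, ← map_smul, ← map_sub,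
    LinearIsometryEquiv.symm_apply_apply, map_sub, map_smul, restrictTo_extendZero,
    hilbertOpOn_apply]

theorem coeFn_neg_sign_add (z : ℂ) (f : Lp ℂ 2 (volume : Measure ℝ)) :
    (-(signOp f + z • f) : Lp ℂ 2 (volume : Measure ℝ)) =ᵐ[volume]
      fun x => -((Real.sign x : ℂ) + z) * f x := by
  filter_upwards [Lp.coeFn_neg (signOp f + z • f), Lp.coeFn_add (signOp f) (z • f),
    coeFn_signOp f, Lp.coeFn_smul z f] with x h1 h2 h3 h4
  rw [h1, Pi.neg_apply, h2, Pi.add_apply, h3, h4, Pi.smul_apply, smul_eq_mul]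
  ring

theorem expChangeLine_restrictTo (φ : Lp ℂ 2 ((volume : Measure ℝ).restrict (Icc 0 1))) :
    expChangeLine (restrictTo (Ioi 0) (extendZero measurableSet_Icc φ)) =
      extendZero measurableSet_Ioi (expChangeUnit φ) := by
  have hexp : ∀ t, ((rexp (-t / 2) : ℝ) : ℂ) ≠ 0 := fun t => by
    exact_mod_cast (Real.exp_pos _).ne'
  apply Lp.ext
  filter_upwards [coeFn_expChangeLine (restrictTo (Ioi 0) (extendZero measurableSet_Icc φ)),
    isWeightedContraction_exp_line.ae_imp
      (coeFn_restrictTo (s := Ioi 0) (extendZero measurableSet_Icc φ)),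
    isWeightedContraction_exp_line.ae_imp (ae_restrict_of_ae (coeFn_extendZero measurableSet_Icc φ)),
    coeFn_extendZero measurableSet_Ioi (expChangeUnit φ),
    (ae_restrict_iff' measurableSet_Ioi).1 (coeFn_expChangeUnit φ),
    compl_mem_ae_iff.2 (measure_singleton (0 : ℝ))] with t h1 h2 h3 h4 h5 h6
  have h6 : t ≠ 0 := h6
  rw [h1, h2 (hexp t), h3 (hexp t), h4]
  rcases lt_or_gt_of_ne h6 with h | h
  · have h7 : t ∉ Ioi (0 : ℝ) := not_lt.2 h.le
    have h8 : rexp (-t) ∉ Icc (0 : ℝ) 1 := fun h => by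
      have := h.2
      rw [Real.exp_le_one_iff] at this
      linarith
    rw [indicator_of_notMem h7, indicator_of_notMem h8, mul_zero]
  · have h7 : t ∈ Ioi (0 : ℝ) := h
    have h8 : rexp (-t) ∈ Icc (0 : ℝ) 1 := ⟨(Real.exp_pos _).le, by
      rw [Real.exp_le_one_iff]; linarith⟩
    rw [indicator_of_mem h7, indicator_of_mem h8, h5 h7]

theorem restrictTo_expChangeLine (h : Lp ℂ 2 (volume : Measure ℝ)) :
    restrictTo (Ioi 0) (expChangeLine (restrictTo (Ioi 0) h)) =
      expChangeUnit (restrictTo (Icc 0 1) h) := by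
  have hexp : ∀ t, ((rexp (-t / 2) : ℝ) : ℂ) ≠ 0 := fun t => by
    exact_mod_cast (Real.exp_pos _).ne'
  apply Lp.ext
  filter_upwards [coeFn_restrictTo (s := Ioi 0) (expChangeLine (restrictTo (Ioi 0) h)),
    ae_restrict_of_ae (coeFn_expChangeLine (restrictTo (Ioi 0) h)),
    ae_restrict_of_ae (isWeightedContraction_exp_line.ae_imp (coeFn_restrictTo (s := Ioi 0) h)),
    coeFn_expChangeUnit (restrictTo (Icc 0 1) h),
    isWeightedContraction_exp_unit.ae_imp (coeFn_restrictTo (s := Icc 0 1) h)] with t h1 h2 h3 h4 h5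
  rw [h1, h2, h3 (hexp t), h4, h5 (hexp t)]

theorem extendZero_restrictTo_extendZero
    (φ : Lp ℂ 2 ((volume : Measure ℝ).restrict (Icc 0 1))) :
    extendZero measurableSet_Ioi (restrictTo (Ioi 0) (extendZero measurableSet_Icc φ)) =
      extendZero measurableSet_Icc φ := by
  apply Lp.ext
  filter_upwards [coeFn_extendZero_restrictTo measurableSet_Ioi (extendZero measurableSet_Icc φ),
    coeFn_extendZero measurableSet_Icc φ,
    compl_mem_ae_iff.2 (measure_singleton (0 : ℝ))] with t h1 h2 h3
  have h3 : t ≠ 0 := h3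
  rw [h1]
  by_cases h : t ∈ Ioi (0 : ℝ)
  · rw [indicator_of_mem h]
  · rw [indicator_of_notMem h, h2, indicator_of_notMem]
    exact fun h' => h (lt_of_le_of_ne h'.1 h3.symm)

/-- In the exponential variable, the singular integral operator of the unit interval is the
compression of a convolution operator to the half-line. -/
theorem expChangeUnit_hilbertOpOn (φ : Lp ℂ 2 ((volume : Measure ℝ).restrict (Icc 0 1))) :
    expChangeUnit (hilbertOpOn measurableSet_Icc φ) = restrictTo (Ioi 0) (unitaryFourier.symm
      (tanhOp (unitaryFourier (extendZero measurableSet_Ioi (expChangeUnit φ))))) := by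
  rw [← expChangeLine_restrictTo, ← unitaryFourier_expChangeLine_hilbertOpOn,
    LinearIsometryEquiv.symm_apply_apply, hilbertOpOn_apply, hilbertOpOn_apply,
    extendZero_restrictTo_extendZero, restrictTo_expChangeLine]

end Toeplitz

section Spectrum

open Real

theorem mem_spectrum_of_approx_eigenvector {E : Type*} [NormedAddCommGroup E] [NormedSpace ℂ E]
    {A : E →L[ℂ] E} {z : ℂ} (h : ∀ c : ℝ, 0 < c → ∃ v : E, v ≠ 0 ∧ ‖A v - z • v‖ ≤ c * ‖v‖) :
    z ∈ spectrum ℂ A := by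
  rw [spectrum.mem_iff]
  rintro ⟨u, hu⟩
  set B : E →L[ℂ] E := ↑u⁻¹ with hB
  obtain ⟨v, hv, hle⟩ := h (1 / (2 * (‖B‖ + 1))) (by positivity)
  have h1 : B ((u : E →L[ℂ] E) v) = v := by
    have := congrArg (fun T : E →L[ℂ] E => T v) (Units.inv_mul u)
    exact this
  have h2 : (u : E →L[ℂ] E) v = -(A v - z • v) := by
    rw [hu]
    simp [Algebra.algebraMap_eq_smul_one]
  have h3 : ‖v‖ ≤ ‖B‖ * (1 / (2 * (‖B‖ + 1)) * ‖v‖) := by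
    calc ‖v‖ = ‖B ((u : E →L[ℂ] E) v)‖ := by rw [h1]
      _ ≤ ‖B‖ * ‖(u : E →L[ℂ] E) v‖ := B.le_opNorm _
      _ ≤ _ := by rw [h2, norm_neg]; gcongr
  have h4 : ‖B‖ * (1 / (2 * (‖B‖ + 1)) * ‖v‖) ≤ ‖v‖ / 2 := by
    rw [← mul_assoc, mul_one_div, div_mul_eq_mul_div, div_le_div_iff₀ (by positivity) (by norm_num)]
    nlinarith [norm_nonneg v, norm_nonneg B]
  have h5 : 0 < ‖v‖ := norm_pos_iff.2 hv
  linarith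

theorem enorm_sq_eq_lintegral (f : Lp ℂ 2 (volume : Measure ℝ)) :
    ‖f‖ₑ ^ 2 = ∫⁻ u, ‖f u‖ₑ ^ 2 := by
  rw [Lp.enorm_def, IsWeightedContraction.eLpNorm_two_eq, ← ENNReal.rpow_natCast,
    ← ENNReal.rpow_mul]
  norm_num

theorem continuous_tanh_pi : Continuous fun x : ℝ => (Real.tanh (π * x) : ℂ) := by
  refine Complex.continuous_ofReal.comp ?_
  simp_rw [Real.tanh_eq_sinh_div_cosh]
  exact (Real.continuous_sinh.comp (continuous_const_mul π)).div
    (Real.continuous_cosh.comp (continuous_const_mul π)) fun x => (Real.cosh_pos _).ne'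

theorem tendsto_lintegral_poisson_tanh (x : ℝ) :
    Tendsto (fun ε : ℝ => ∫⁻ u, ENNReal.ofReal (ε / ((u - x) ^ 2 + ε ^ 2)) *
      ‖(Real.tanh (π * u) : ℂ) - (Real.tanh (π * x) : ℂ)‖ₑ ^ 2) (𝓝[>] 0) (𝓝 0) := by
  set Ψ : ℝ → ℝ≥0∞ := fun u => ‖(Real.tanh (π * u) : ℂ) - (Real.tanh (π * x) : ℂ)‖ₑ ^ 2 with hΨ
  have hm : Measurable Ψ := ((measurable_tanh.sub_const _).enorm.pow_const 2)
  have hle : ∀ (δ : ℝ≥0∞) (r : ℝ), 0 < r → (∀ u ∈ Metric.ball x r, Ψ u ≤ δ) →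
      ENNReal.ofReal r⁻¹ * ∫⁻ u in Metric.ball x r, Ψ u ≤ 2 * δ := by
    intro δ r hr h
    calc ENNReal.ofReal r⁻¹ * ∫⁻ u in Metric.ball x r, Ψ u
        ≤ ENNReal.ofReal r⁻¹ * ∫⁻ _ in Metric.ball x r, δ := by
          gcongr 1
          exact setLIntegral_mono' Metric.isOpen_ball.measurableSet h
      _ = (ENNReal.ofReal r⁻¹ * ENNReal.ofReal (2 * r)) * δ := by
          rw [setLIntegral_const, Real.volume_ball]; ring
      _ = 2 * δ := by
          rw [← ENNReal.ofReal_mul (by positivity), show r⁻¹ * (2 * r) = 2 by field_simp]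
          simp
  refine tendsto_lintegral_poisson hm ?_ (K := 2 * 4) (by finiteness) fun r hr =>
    hle 4 r hr fun u _ => ?_
  · have hc : Tendsto Ψ (𝓝 x) (𝓝 0) := by
      have h1 : Continuous Ψ :=
        (ENNReal.continuous_pow 2).comp (continuous_tanh_pi.sub continuous_const).enorm
      simpa [hΨ] using h1.tendsto x
    rw [ENNReal.tendsto_nhds_zero]
    intro δ hδ
    obtain ⟨r₀, hr₀, h⟩ := Metric.eventually_nhds_iff_ball.1
      ((ENNReal.tendsto_nhds_zero.1 hc) (δ / 2) (ENNReal.half_pos hδ.ne'))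
    filter_upwards [Ioo_mem_nhdsGT hr₀] with r hr
    refine (hle (δ / 2) r hr.1 fun u hu => h u (Metric.ball_subset_ball hr.2.le hu)).trans ?_
    rw [ENNReal.mul_div_cancel (by norm_num) (by norm_num)]
  · have h1 : ‖(Real.tanh (π * u) : ℂ) - (Real.tanh (π * x) : ℂ)‖ₑ ≤ 2 := by
      rw [← ofReal_norm]
      refine ENNReal.ofReal_le_of_le_toReal ?_
      refine (norm_sub_le _ _).trans ?_
      have := norm_tanh_le u
      have := norm_tanh_le x
      simp only [ENNReal.toReal_ofNat]
      linarith
    calc Ψ u ≤ 2 ^ 2 := pow_le_pow_left' h1 2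
      _ = 4 := by norm_num

theorem ofReal_mul_enorm_kernel {x ε : ℝ} (hε : 0 < ε) (u : ℝ) :
    ENNReal.ofReal ε * ‖1 / ((u : ℂ) - ⟨x, -ε⟩)‖ₑ ^ 2 =
      ENNReal.ofReal (ε / ((u - x) ^ 2 + ε ^ 2)) := by
  rw [← ofReal_norm, ← ENNReal.ofReal_pow (norm_nonneg _), ← ENNReal.ofReal_mul hε.le,
    norm_div, norm_one, div_pow, Complex.sq_norm, Complex.normSq_apply]
  congr 1
  simp only [Complex.sub_re, Complex.ofReal_re, Complex.sub_im, Complex.ofReal_im]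
  ring

theorem exists_approx_tanh (x : ℝ) {c : ℝ} (hc : 0 < c) :
    ∃ φ : Lp ℂ 2 ((volume : Measure ℝ).restrict (Ioi 0)), φ ≠ 0 ∧
      ‖tanhOp (unitaryFourier (extendZero measurableSet_Ioi φ)) -
        (Real.tanh (π * x) : ℂ) • unitaryFourier (extendZero measurableSet_Ioi φ)‖ ≤ c * ‖φ‖ := by
  have hcπ : 0 < ENNReal.ofReal (c ^ 2 * π) := ENNReal.ofReal_pos.2 (by positivity)
  obtain ⟨ε, hεle, hε⟩ := ((ENNReal.tendsto_nhds_zero.1 (tendsto_lintegral_poisson_tanh x) _ hcπ).and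
    self_mem_nhdsWithin).exists
  have hε : 0 < ε := hε
  set w : ℂ := ⟨x, -ε⟩ with hw
  have hwim : w.im < 0 := by simpa [hw] using hε
  set k := cauchyKernel hwim.ne with hk
  set p := (memLp_expPlus (z := -w) (by simpa using hwim)).toLp with hp
  set C : ℂ := -Complex.I * (√(2 * π) : ℂ) with hC
  have hC0 : C ≠ 0 := mul_ne_zero (neg_ne_zero.2 Complex.I_ne_zero) sqrt_two_pi_ne_zero
  have hkp : k = C • unitaryFourier p := cauchyKernel_eq_of_neg hwim
  have hext : extendZero measurableSet_Ioi (restrictTo (Ioi 0) p) = p := by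
    apply Lp.ext
    filter_upwards [coeFn_extendZero_restrictTo measurableSet_Ioi p,
      (memLp_expPlus (z := -w) (by simpa using hwim)).coeFn_toLp] with t h1 h2
    rw [h1]
    by_cases ht : t ∈ Ioi (0 : ℝ)
    · rw [indicator_of_mem ht]
    · rw [indicator_of_notMem ht, hp, h2, expPlus, indicator_of_notMem ht]
  have hknorm : ENNReal.ofReal ε * ‖k‖ₑ ^ 2 = ENNReal.ofReal π := by
    rw [enorm_sq_eq_lintegral, ← lintegral_const_mul' _ _ ENNReal.ofReal_ne_top,
      ← integral_poissonKer (z := ⟨x, ε⟩) hε, ofReal_integral_eq_lintegral_ofReal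
        (integrable_poissonKer (z := ⟨x, ε⟩) hε)
        (ae_of_all _ (poissonKer_nonneg (z := ⟨x, ε⟩) hε))]
    refine lintegral_congr_ae ?_
    filter_upwards [coeFn_cauchyKernel hwim.ne] with u hu
    rw [hk, hu, hw, ofReal_mul_enorm_kernel hε]
    rfl
  have hD : ENNReal.ofReal ε * ‖tanhOp k - (Real.tanh (π * x) : ℂ) • k‖ₑ ^ 2 ≤
      ENNReal.ofReal (c ^ 2 * π) := by
    rw [enorm_sq_eq_lintegral, ← lintegral_const_mul' _ _ ENNReal.ofReal_ne_top]
    refine le_trans (le_of_eq (lintegral_congr_ae ?_)) hεle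
    filter_upwards [Lp.coeFn_sub (tanhOp k) ((Real.tanh (π * x) : ℂ) • k), coeFn_tanhOp k,
      Lp.coeFn_smul (Real.tanh (π * x) : ℂ) k, coeFn_cauchyKernel hwim.ne] with u h1 h2 h3 h4
    rw [h1, Pi.sub_apply, h2, h3, Pi.smul_apply, smul_eq_mul, ← sub_mul, hk, h4, hw, enorm_mul,
      mul_pow, mul_left_comm, ofReal_mul_enorm_kernel hε, mul_comm]
  have hle : ‖tanhOp k - (Real.tanh (π * x) : ℂ) • k‖ ≤ c * ‖k‖ := by
    rw [← ofReal_norm, ← ENNReal.ofReal_pow (norm_nonneg _), ← ENNReal.ofReal_mul hε.le] at hknorm hD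
    have h1 : ε * ‖k‖ ^ 2 = π := (ENNReal.ofReal_eq_ofReal_iff (by positivity) pi_pos.le).1 hknorm
    have h2 := (ENNReal.ofReal_le_ofReal_iff (by positivity)).1 hD
    refine le_of_sq_le_sq ?_ (by positivity)
    rw [mul_pow]
    have h3 : ε * ‖tanhOp k - (Real.tanh (π * x) : ℂ) • k‖ ^ 2 ≤ ε * (c ^ 2 * ‖k‖ ^ 2) :=
      h2.trans (le_of_eq (by linear_combination (-(c ^ 2)) * h1))
    exact le_of_mul_le_mul_left h3 hε
  have hφ : ‖restrictTo (Ioi 0) p‖ = ‖p‖ := by rw [← norm_extendZero measurableSet_Ioi, hext]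
  refine ⟨restrictTo (Ioi 0) p, ?_, ?_⟩
  · intro h0
    rw [h0, norm_zero] at hφ
    have hk0 : k = 0 := by
      rw [hkp, norm_eq_zero.1 hφ.symm, map_zero, smul_zero]
    rw [hk0, enorm_zero, zero_pow two_ne_zero, mul_zero] at hknorm
    exact (ENNReal.ofReal_pos.2 pi_pos).ne hknorm
  · rw [hext, hφ]
    rw [hkp, map_smul, smul_comm, ← smul_sub, norm_smul, norm_smul, LinearIsometryEquiv.norm_map,
      mul_left_comm] at hle
    exact le_of_mul_le_mul_left hle (norm_pos_iff.2 hC0)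

theorem tanh_mem_spectrum_halfLine (x : ℝ) :
    (Real.tanh (π * x) : ℂ) ∈ spectrum ℂ (hilbertOpOn (measurableSet_Ioi (a := (0 : ℝ)))) := by
  refine mem_spectrum_of_approx_eigenvector fun c hc => ?_
  obtain ⟨φ, hφ, hle⟩ := exists_approx_tanh x hc
  set v := expChangeLine.symm (extendZero measurableSet_Ioi φ) with hv
  have hXv : expChangeLine v = extendZero measurableSet_Ioi φ :=
    LinearIsometryEquiv.apply_symm_apply _ _
  have hnorm : ‖v‖ = ‖φ‖ := by rw [hv, LinearIsometryEquiv.norm_map, norm_extendZero]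
  refine ⟨v, fun h0 => hφ ?_, ?_⟩
  · rw [h0, norm_zero] at hnorm
    exact norm_eq_zero.1 hnorm.symm
  · rw [← hXv, ← unitaryFourier_expChangeLine_hilbertOpOn, ← map_smul, ← map_smul, ← map_sub,
      ← map_sub, LinearIsometryEquiv.norm_map, LinearIsometryEquiv.norm_map, ← hnorm] at hle
    exact hle

theorem tanh_mem_spectrum_unit (x : ℝ) :
    (Real.tanh (π * x) : ℂ) ∈
      spectrum ℂ (hilbertOpOn (measurableSet_Icc (a := (0 : ℝ)) (b := 1))) := by
  refine mem_spectrum_of_approx_eigenvector fun c hc => ?_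
  obtain ⟨φ, hφ, hle⟩ := exists_approx_tanh x hc
  set v := expChangeUnit.symm φ with hv
  have hXv : expChangeUnit v = φ := LinearIsometryEquiv.apply_symm_apply _ _
  have hnorm : ‖v‖ = ‖φ‖ := by rw [hv, LinearIsometryEquiv.norm_map]
  refine ⟨v, fun h0 => hφ ?_, ?_⟩
  · rw [h0, norm_zero] at hnorm
    exact norm_eq_zero.1 hnorm.symm
  · rw [hnorm]
    refine le_trans ?_ hle
    rw [← LinearIsometryEquiv.norm_map expChangeUnit, map_sub, map_smul,
      expChangeUnit_hilbertOpOn, hXv]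
    have h1 : φ = restrictTo (Ioi 0) (unitaryFourier.symm
        (unitaryFourier (extendZero measurableSet_Ioi φ))) := by
      rw [LinearIsometryEquiv.symm_apply_apply, restrictTo_extendZero]
    conv_lhs => enter [1, 2, 2]; rw [h1]
    rw [← map_smul, ← map_smul, ← map_sub, ← map_sub]
    exact (norm_restrictTo_le _).trans (LinearIsometryEquiv.norm_map _ _).le

theorem norm_hilbertOpOn_le {s : Set ℝ} (hs : MeasurableSet s) : ‖hilbertOpOn hs‖ ≤ 1 := by
  refine ContinuousLinearMap.opNorm_le_bound _ zero_le_one fun f => ?_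
  rw [one_mul, hilbertOpOn_apply]
  exact (norm_restrictTo_le _).trans ((norm_hilbertOp_le _).trans (norm_extendZero hs f).le)

theorem isSelfAdjoint_hilbertOpOn {s : Set ℝ} (hs : MeasurableSet s) :
    IsSelfAdjoint (hilbertOpOn hs) := by
  rw [ContinuousLinearMap.isSelfAdjoint_iff_isSymmetric]
  intro f g
  change inner ℂ (hilbertOpOn hs f) g = inner ℂ f (hilbertOpOn hs g)
  rw [hilbertOpOn_apply, hilbertOpOn_apply, ← inner_extendZero hs, inner_hilbertOp,
    ← inner_conj_symm, inner_extendZero hs, inner_conj_symm]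

theorem spectrum_hilbertOpOn {s : Set ℝ} (hs : MeasurableSet s)
    (h : ∀ x : ℝ, (Real.tanh (π * x) : ℂ) ∈ spectrum ℂ (hilbertOpOn hs)) :
    spectrum ℂ (hilbertOpOn hs) = (fun r : ℝ => (r : ℂ)) '' Icc (-1) 1 := by
  apply Subset.antisymm
  · intro z hz
    have h1 : z = z.re := (isSelfAdjoint_hilbertOpOn hs).mem_spectrum_eq_re hz
    have h2 : ‖z‖ ≤ 1 := by
      refine (spectrum.norm_le_norm_mul_of_mem hz).trans ?_
      exact mul_le_one₀ (norm_hilbertOpOn_le hs) (norm_nonneg _) ContinuousLinearMap.norm_id_le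
    exact ⟨z.re, abs_le.1 ((Complex.abs_re_le_norm z).trans h2), h1.symm⟩
  · rw [← closure_Ioo (show (-1 : ℝ) ≠ 1 by norm_num)]
    refine (image_closure_subset_closure_image Complex.continuous_ofReal).trans
      (closure_minimal ?_ (spectrum.isClosed _))
    rintro _ ⟨r, hr, rfl⟩
    have := h (artanh r / π)
    rwa [mul_div_cancel₀ _ pi_ne_zero, tanh_artanh hr] at this

theorem spectrum_hilbertOp : spectrum ℂ hilbertOp = {-1, 1} := by
  apply Subset.antisymm
  · intro z hz
    have h1 : hilbertOp ^ 2 = 1 := by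
      ext1 f
      rw [pow_two]
      exact hilbertOp_hilbertOp f
    have h2 := spectrum.pow_mem_pow hilbertOp 2 hz
    rw [h1] at h2
    have h3 : z ^ 2 = 1 := by
      by_contra hne
      refine h2 (spectrum.mem_resolventSet_iff.2 ?_)
      have h4 := (IsUnit.mk0 _ (sub_ne_zero.2 hne)).map (algebraMap ℂ
        (Lp ℂ 2 (volume : Measure ℝ) →L[ℂ] Lp ℂ 2 (volume : Measure ℝ)))
      rwa [map_sub, map_one] at h4
    rcases mul_eq_zero.1 (show (z - 1) * (z + 1) = 0 by linear_combination h3) with h | h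
    · exact Or.inr (sub_eq_zero.1 h)
    · exact Or.inl (eq_neg_of_add_eq_zero_left h)
  · have hne : ∀ {w : ℂ} (hw : w.im ≠ 0), cauchyKernel hw ≠ 0 := by
      intro w hw h0
      have h1 := coeFn_cauchyKernel hw
      rw [h0] at h1
      have h2 : ∀ᵐ u : ℝ, False := by
        filter_upwards [h1, Lp.coeFn_zero ℂ 2 (volume : Measure ℝ)] with u h3 h4
        rw [h4] at h3
        have h5 : (u : ℂ) - w ≠ 0 := fun h => hw (by
          have := congrArg Complex.im h
          simpa using this)
        exact (one_div_ne_zero h5) h3.symm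
      exact h2.exists.choose_spec
    rintro z (rfl | rfl)
    · refine mem_spectrum_of_approx_eigenvector fun c hc =>
        ⟨cauchyKernel (w := Complex.I) (by simp), hne _, ?_⟩
      rw [hilbertOp_cauchyKernel_of_pos (w := Complex.I) (by simp)]
      simp
      positivity
    · refine mem_spectrum_of_approx_eigenvector fun c hc =>
        ⟨cauchyKernel (w := -Complex.I) (by simp), hne _, ?_⟩
      rw [hilbertOp_cauchyKernel_of_neg (w := -Complex.I) (by simp)]
      simp
      positivity

end Spectrum

theorem exists_toeplitz_sign (z : ℂ) : ∃ T : hardySpace →L[ℂ] hardySpace,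
    IsToeplitzOperator (fun x => -((Real.sign x : ℂ) + z)) T ∧
      ∀ f, hardyFourier (hilbertOpOn measurableSet_Ioi f - z • f) = T (hardyFourier f) := by
  set A : Lp ℂ 2 ((volume : Measure ℝ).restrict (Ioi 0)) →L[ℂ]
    Lp ℂ 2 ((volume : Measure ℝ).restrict (Ioi 0)) :=
      hilbertOpOn measurableSet_Ioi - z • ContinuousLinearMap.id ℂ _ with hA
  refine ⟨hardyConj A, isToeplitzOperator_hardyConj (coeFn_neg_sign_add z) (hilbertOpOn_Ioi_eq z),
    fun f => ?_⟩
  rw [hardyConj_hardyFourier]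
  rfl

theorem exists_toeplitz_tanh : ∃ T : hardySpace →L[ℂ] hardySpace,
    IsToeplitzOperator (fun x => (Real.tanh (Real.pi * x) : ℂ)) T ∧
      ∀ φ, hardyFourier (expChangeUnit (hilbertOpOn measurableSet_Icc φ)) =
        T (hardyFourier (expChangeUnit φ)) := by
  set A : Lp ℂ 2 ((volume : Measure ℝ).restrict (Ioi 0)) →L[ℂ]
      Lp ℂ 2 ((volume : Measure ℝ).restrict (Ioi 0)) :=
    (expChangeUnit.toContinuousLinearEquiv :
        Lp ℂ 2 ((volume : Measure ℝ).restrict (Icc 0 1)) →L[ℂ]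
          Lp ℂ 2 ((volume : Measure ℝ).restrict (Ioi 0))) ∘L hilbertOpOn measurableSet_Icc ∘L
      (expChangeUnit.symm.toContinuousLinearEquiv :
        Lp ℂ 2 ((volume : Measure ℝ).restrict (Ioi 0)) →L[ℂ]
          Lp ℂ 2 ((volume : Measure ℝ).restrict (Icc 0 1))) with hA
  have hAY : ∀ φ, A (expChangeUnit φ) = expChangeUnit (hilbertOpOn measurableSet_Icc φ) := by
    intro φ
    change expChangeUnit (hilbertOpOn measurableSet_Icc
      (expChangeUnit.symm (expChangeUnit φ))) = _
    rw [LinearIsometryEquiv.symm_apply_apply]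
  refine ⟨hardyConj A, isToeplitzOperator_hardyConj coeFn_tanhOp fun f => ?_, fun φ => ?_⟩
  · obtain ⟨φ, rfl⟩ := expChangeUnit.surjective f
    rw [hAY, expChangeUnit_hilbertOpOn]
  · rw [hardyConj_hardyFourier, hAY]

theorem mainTheorem10 :
    ∃ (S : Lp ℂ 2 (volume : Measure ℝ) →L[ℂ] Lp ℂ 2 (volume : Measure ℝ))
      (Splus : Lp ℂ 2 ((volume : Measure ℝ).restrict (Ioi 0)) →L[ℂ]
        Lp ℂ 2 ((volume : Measure ℝ).restrict (Ioi 0)))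
      (Sunit : Lp ℂ 2 ((volume : Measure ℝ).restrict (Icc 0 1)) →L[ℂ]
        Lp ℂ 2 ((volume : Measure ℝ).restrict (Icc 0 1))),
      -- these are the operators `S_J` for `J = ℝ`, `J = ℝ⁺`, `J = [0,1]`
      IsSingularIntegralOperator volume S ∧
      IsSingularIntegralOperator (volume.restrict (Ioi 0)) Splus ∧
      IsSingularIntegralOperator (volume.restrict (Icc 0 1)) Sunit ∧
      -- their spectra
      spectrum ℂ S = {-1, 1} ∧
      spectrum ℂ Splus = (fun r : ℝ => (r : ℂ)) '' Icc (-1) 1 ∧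
      spectrum ℂ Sunit = (fun r : ℝ => (r : ℂ)) '' Icc (-1) 1 ∧
      -- the unitary equivalences with Toeplitz operators
      ∃ (F : Lp ℂ 2 ((volume : Measure ℝ).restrict (Ioi 0)) ≃ₗᵢ[ℂ] hardySpace)
        (Y : Lp ℂ 2 ((volume : Measure ℝ).restrict (Icc 0 1)) ≃ₗᵢ[ℂ]
          Lp ℂ 2 ((volume : Measure ℝ).restrict (Ioi 0))),
        (∀ f : Lp ℂ 2 ((volume : Measure ℝ).restrict (Ioi 0)),
          IsFourierTransform (volume.restrict (Ioi 0)) f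
          (F f : Lp ℂ 2 (volume : Measure ℝ))) ∧
        (∀ φ, ∀ᵐ t ∂((volume : Measure ℝ).restrict (Ioi 0)),
          Y φ t = (Real.exp (-t / 2) : ℂ) * φ (Real.exp (-t))) ∧
        (∀ z : ℂ, ∃ T : hardySpace →L[ℂ] hardySpace,
          IsToeplitzOperator (fun x => -((Real.sign x : ℂ) + z)) T ∧
          ∀ f, F (Splus f - z • f) = T (F f)) ∧
        (∃ T : hardySpace →L[ℂ] hardySpace,
          IsToeplitzOperator (fun x => (Real.tanh (Real.pi * x) : ℂ)) T ∧
          ∀ φ, F (Y (Sunit φ)) = T (F (Y φ))) := by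
  refine ⟨hilbertOp, hilbertOpOn measurableSet_Ioi, hilbertOpOn measurableSet_Icc,
    isSingularIntegralOperator_hilbertOp, isSingularIntegralOperator_hilbertOpOn _,
    isSingularIntegralOperator_hilbertOpOn _, spectrum_hilbertOp,
    spectrum_hilbertOpOn _ tanh_mem_spectrum_halfLine,
    spectrum_hilbertOpOn _ tanh_mem_spectrum_unit, hardyFourier, expChangeUnit,
    fun f => ?_, coeFn_expChangeUnit, exists_toeplitz_sign, exists_toeplitz_tanh⟩
  exact isFourierTransform_unitaryFourier measurableSet_Ioi f
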